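/- Let $\Phi$ be a reduced irreducible crystallographic root system in a finite-dimensional real vector space $V$, with coroots in $V^*$ and pairing $\langle\cdot,\cdot\rangle$ between $V^*$ and $V$. Let $\alpha_1,\dots,\alpha_n$ be an enumeration of simple roots, $\alpha_0=\sum_i n_i\alpha_i$ the highest root, $S_0=\{0,1,\dots,n\}$, $s_i$ ($i\ge1$) the reflection $\lambda\mapsto\lambda-\langle\lambda,\alpha_i\rangle\alpha_i^\vee$ of $V^*$, and $s_0:\lambda\mapsto\lambda-(\langle\lambda,\alpha_0\rangle-1)\alpha_0^\vee$. Let $W_a=\langle s_0,\dots,s_n\rangle$ be the affine Weyl group and $\ell$ its length function with respect to $s_0,\dots,s_n$. For $I\subseteq S_0$ put $I^\complement=S_0\setminus I$, $(W_a)_I=\langle s_i:i\in I\rangle$, ${}^IW_a=\{w:\ell(s_iw)>\ell(w)\ \forall i\in I\}$ and $W_a^I=\{w:\ell(ws_i)>\ell(w)\ \forall i\in I\}$; these are systems of representatives for $(W_a)_I\backslash W_a$ and $W_a/(W_a)_I$. Let $\mathcal A_0=\{\lambda\in V^*:0<\langle\lambda,\alpha\rangle<1\ \forall\alpha\in\Phi^+\}$,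 $H_0=\{\langle\lambda,\alpha_0\rangle=1\}$, $H_i=\{\langle\lambda,\alpha_i\rangle=0\}$ for $i\ge1$, $v_0=0$ and $v_i=\varpi_i^\vee/n_i$ for $i\ge1$, where $\varpi_i^\vee$ are the fundamental coweights, and $f_I=\overline{\mathcal A_0}\cap\bigcap_{i\in I}H_i$. **Theorem.** (1) For $I\subseteq S_0$, $f_I$ is the convex hull of $\{v_i:i\notin I\}$. The translates $w f_I$ ($w\in W_a$, $I\subsetneq S_0$) are the simplices of a locally finite triangulation of $V^*$, which is $W_a$-equivariant: $W_a$ permutes the simplices, and an element that maps a simplex to itself fixes it pointwise. The type $i$ of a vertex $wv_i$ is well defined; orient each simplex by increasing type of its vertices. The cellular chain complex $C_*$ is then a complex of left $\mathbb Z[W_a]$-modules with $$C_k\cong\bigoplus_{|I|=n-k}\mathbb Z[W_a/(W_a)_I]\cong\bigoplus_{|I|=n-k}\mathbb Z[W_a^I],$$ the coset $w(W_a)_I$ corresponding to the cell $wf_I$, and, for $I^\complement=\{j_0<\dots<j_k\}$ with $k\geq 1$, $$\partial_k(w(W_a)_I)=\sum_{u=0}^k(-1)^u\,w(W_a)_{I\cup\{j_u\}},\qquad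 \partial_0=0.$$ (2) The dual cochain complex $\operatorname{Hom}(C_*,\mathbb Z)$, with the right action of $W_a$ and the simplicial cup product $[x_0,\dots,x_k]^*\cup[y_0,\dots,y_l]^*=\delta_{x_k,y_0}[x_0,\dots,x_k,y_1,\dots,y_l]^*$ (the right-hand side being $0$ if these points do not span a simplex), is a unital $\mathbb Z[W_a]$-dg-algebra: the product is associative and $W_a$-equivariant and the differential is $W_a$-equivariant and a graded derivation. The finitely supported cochains $C^*$ (the span of the dual cells) are closed under all these operations and form a (not necessarily unital) $\mathbb Z[W_a]$-dg-algebra with components $$C^k\cong\bigoplus_{|I|=n-k}\mathbb Z[(W_a)_I\backslash W_a]\cong\bigoplus_{|I|=n-k}\mathbb Z[{}^IW_a],$$ the coset $(W_a)_Iw$, written ${}^Iw$, corresponding to the dual $(w^{-1}f_I)^*$ of the cell $w^{-1}f_I$. (3) For $I^\complement=\{j_0<\dots<j_k\}$, $j_{-1}=-1$ and $j_{k+1}=n+1$, the group $(W_a)_I$ is finite and $$d^k({}^Iw)=\sum_{u=0}^{k+1}\ \sum_{j_{u-1}<j<j_u}(-1)^u\sum_{x}{}^{I\setminus\{j\}}(xw),$$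 where $x$ runs over the minimal length representatives $\{x\in(W_a)_I:\ell(s_ix)>\ell(x)\ \forall i\in I\setminus\{j\}\}$ of $(W_a)_{I\setminus\{j\}}\backslash(W_a)_I$. If $w\in{}^IW_a$, then each such $xw$ lies in ${}^{I\setminus\{j\}}W_a$. (4) For $I,J\subsetneq S_0$ and $x,y\in W_a$, $${}^Ix\cup{}^Jy=\delta_{\max I^\complement,\,\min J^\complement}\cdot\begin{cases}{}^{I\cap J}\big((xy^{-1})_J\,y\big)&\text{if }xy^{-1}\in(W_a)_I(W_a)_J,\\0&\text{otherwise.}\end{cases}$$ Here, for $w\in(W_a)_I(W_a)_J$, $w_J$ denotes the unique $v\in(W_a)_J$ such that $w=uv$ with $u\in(W_a)_I\cap W_a^{I\cap J}$ and $\ell(w)=\ell(u)+\ell(v)$. -/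

import Mathlib

open Set

/-! ### Oriented simplicial chains and cochains

`F` is a set of simplices (finite vertex sets) in `E`.  The labelling `τ : E → ℕ` takes distinct
values on the vertices of each simplex, and each simplex is oriented by increasing labels.  For a
triangulated space this is the cellular chain complex with respect to these orientations. -/

namespace SimplicialCochains

open scoped Classical in
/-- The position (counted from `0`) of the vertex `x` in the simplex `s` ordered by labels. -/
noncomputable def position {E : Type*} (τ : E → ℕ) (s : Finset E) (x : E) : ℕ :=
  (s.filter fun y => τ y < τ x).card

/-- The group of `k`-chains: the free abelian group on the `k`-simplices. -/
def chains {E : Type*} (F : Set (Finset E)) (k : ℕ) : Submodule ℤ (Finset E →₀ ℤ) :=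
  Finsupp.supported ℤ ℤ {s | s ∈ F ∧ s.card = k + 1}

open scoped Classical in
/-- The boundary `∂[x₀, …, xₖ] = ∑ᵤ (-1)ᵘ [x₀, …, x̂ᵤ, …, xₖ]` (and `∂[x₀] = 0`). -/
noncomputable def boundary {E : Type*} (τ : E → ℕ) : (Finset E →₀ ℤ) →ₗ[ℤ] (Finset E →₀ ℤ) :=
  Finsupp.linearCombination ℤ fun s =>
    ∑ x ∈ s, if (s.erase x).Nonempty then
      (-1 : ℤ) ^ position τ s x • Finsupp.single (s.erase x) (1 : ℤ) else 0

/-- The group of `k`-cochains `Hom(Cₖ, ℤ)`: integer functions on the `k`-simplices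
(extended by zero to all finite subsets of `E`). -/
def cochains {E : Type*} (F : Set (Finset E)) (k : ℕ) : Submodule ℤ (Finset E → ℤ) where
  carrier := {f | ∀ s, f s ≠ 0 → s ∈ F ∧ s.card = k + 1}
  zero_mem' := by intro s h; exact absurd rfl h
  add_mem' := by
    intro f g hf hg s h
    by_cases h0 : f s = 0
    · exact hg s fun h1 => h (by simp [h0, h1])
    · exact hf s h0
  smul_mem' := by
    intro c f hf s h
    exact hf s fun h0 => h (by simp [h0])

/-- The group of finitely supported `k`-cochains: the free abelian group on the duals `e*` of the
`k`-simplices `e`. -/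
def finiteCochains {E : Type*} (F : Set (Finset E)) (k : ℕ) : Submodule ℤ (Finset E → ℤ) where
  carrier := {f | f ∈ cochains F k ∧ (Function.support f).Finite}
  zero_mem' := ⟨(cochains F k).zero_mem, by simp⟩
  add_mem' := by
    rintro f g ⟨hf, hf'⟩ ⟨hg, hg'⟩
    exact ⟨(cochains F k).add_mem hf hg, (hf'.union hg').subset (Function.support_add f g)⟩
  smul_mem' := by
    rintro c f ⟨hf, hf'⟩
    exact ⟨(cochains F k).smul_mem c hf, hf'.subset (Function.support_const_smul_subset c f)⟩

open scoped Classical in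
/-- The coboundary, dual to the boundary: `(d f)(s) = f(∂ s)` for `s ∈ F`. -/
noncomputable def coboundary {E : Type*} (F : Set (Finset E)) (τ : E → ℕ) :
    (Finset E → ℤ) →ₗ[ℤ] (Finset E → ℤ) where
  toFun f s := if s ∈ F then Finsupp.linearCombination ℤ f (boundary τ (Finsupp.single s 1)) else 0
  map_add' f g := by
    funext s
    by_cases h : s ∈ F
    · simp [h, Finsupp.linearCombination_apply, Finsupp.sum_add, mul_add]
    · simp [h]
  map_smul' c f := by
    funext s
    by_cases h : s ∈ F
    · simp [h, Finsupp.linearCombination_apply, Finsupp.mul_sum, mul_left_comm]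
    · simp [h]

open scoped Classical in
/-- The simplicial cup product:
`(f ∪ g)[x₀, …, xₘ] = ∑ᵤ f[x₀, …, xᵤ] g[xᵤ, …, xₘ]`, where only `u = p` contributes if
`f` has degree `p`.  On dual simplices it reads
`[x₀, …, xₖ]* ∪ [y₀, …, yₗ]* = δ_{xₖ, y₀} [x₀, …, xₖ, y₁, …, yₗ]*`. -/
noncomputable def cup {E : Type*} (F : Set (Finset E)) (τ : E → ℕ) :
    (Finset E → ℤ) →ₗ[ℤ] (Finset E → ℤ) →ₗ[ℤ] (Finset E → ℤ) :=
  LinearMap.mk₂ ℤ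
    (fun f g s => if s ∈ F then
      ∑ x ∈ s, f (s.filter fun y => τ y ≤ τ x) * g (s.filter fun y => τ x ≤ τ y) else 0)
    (by
      intro f f' g; funext s
      by_cases h : s ∈ F <;> simp [h, add_mul, Finset.sum_add_distrib])
    (by
      intro c f g; funext s
      by_cases h : s ∈ F <;> simp [h, mul_assoc, Finset.mul_sum])
    (by
      intro f g g'; funext s
      by_cases h : s ∈ F <;> simp [h, mul_add, Finset.sum_add_distrib])
    (by
      intro c f g; funext s
      by_cases h : s ∈ F <;> simp [h, mul_left_comm, Finset.mul_sum])

end SimplicialCochains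

/-- A (not necessarily unital) `ℤ[G]`-dg-algebra: a cochain complex `C⁰ → C¹ → ⋯` of right
`ℤ[G]`-modules with an associative product `Cᵖ ⊗ C^q → C^{p+q}` for which the differential is a
graded derivation and on which `G` acts by algebra automorphisms.  The components `C k` are
submodules of an ambient group `X` on which the differential, the product and the action are
defined; the right action of `G` is a representation of `Gᵐᵒᵖ`. -/
structure IsDGAlgebra {G X : Type*} [Group G] [AddCommGroup X] (act : Representation ℤ Gᵐᵒᵖ X)
    (C : ℕ → Submodule ℤ X) (d : X →ₗ[ℤ] X) (mul : X →ₗ[ℤ] X →ₗ[ℤ] X) : Prop where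
  independent : iSupIndep C
  act_mem : ∀ g k, ∀ a ∈ C k, act g a ∈ C k
  d_mem : ∀ k, ∀ a ∈ C k, d a ∈ C (k + 1)
  d_d : ∀ k, ∀ a ∈ C k, d (d a) = 0
  d_act : ∀ g k, ∀ a ∈ C k, d (act g a) = act g (d a)
  mul_mem : ∀ p q, ∀ a ∈ C p, ∀ b ∈ C q, mul a b ∈ C (p + q)
  mul_assoc : ∀ p q r, ∀ a ∈ C p, ∀ b ∈ C q, ∀ c ∈ C r, mul (mul a b) c = mul a (mul b c)
  mul_act : ∀ g p q, ∀ a ∈ C p, ∀ b ∈ C q, act g (mul a b) = mul (act g a) (act g b)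
  leibniz : ∀ p q, ∀ a ∈ C p, ∀ b ∈ C q,
    d (mul a b) = mul (d a) b + (-1 : ℤ) ^ p • mul a (d b)

/-- The left `ℤ[G]`-module `⨁ᵢ ℤ[G/Hᵢ]`. -/
noncomputable def leftCosetRep {G σ : Type*} [Group G] (H : σ → Subgroup G) :
    Representation ℤ G ((Σ i, G ⧸ H i) →₀ ℤ) where
  toFun g := Finsupp.lmapDomain ℤ ℤ fun q => ⟨q.1, g • q.2⟩
  map_one' := Finsupp.lhom_ext fun q c => by simp
  map_mul' g h := Finsupp.lhom_ext fun q c => by simp [mul_smul]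

/-- The set `H\G` of right cosets `Hg`. -/
abbrev RightCosets {G : Type*} [Group G] (H : Subgroup G) : Type _ :=
  Quotient (QuotientGroup.rightRel H)

/-- The right coset `Hg`. -/
def RightCosets.mk {G : Type*} [Group G] (H : Subgroup G) (g : G) : RightCosets H :=
  Quotient.mk (QuotientGroup.rightRel H) g

/-- The right translation `Hx ↦ Hxg`. -/
def RightCosets.translate {G : Type*} [Group G] {H : Subgroup G} (g : G) :
    RightCosets H → RightCosets H :=
  Quotient.map' (fun x => x * g) (by
    intro x y h
    rw [QuotientGroup.rightRel_apply] at h ⊢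
    simpa [mul_assoc] using h)

/-- The right `ℤ[G]`-module `⨁ᵢ ℤ[Hᵢ\G]`. -/
noncomputable def rightCosetRep {G σ : Type*} [Group G] (H : σ → Subgroup G) :
    Representation ℤ Gᵐᵒᵖ ((Σ i, RightCosets (H i)) →₀ ℤ) where
  toFun g := Finsupp.lmapDomain ℤ ℤ fun q => ⟨q.1, RightCosets.translate g.unop q.2⟩
  map_one' := Finsupp.lhom_ext fun ⟨i, q⟩ c => by
    induction q using Quotient.inductionOn'
    simp [RightCosets.translate]
  map_mul' g h := Finsupp.lhom_ext fun ⟨i, q⟩ c => by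
    induction q using Quotient.inductionOn'
    simp [RightCosets.translate, mul_assoc]

/-! ### The affine Weyl group and the fundamental alcove

`P` is a reduced irreducible crystallographic root system in the real vector space `V = M`, with
coroots in `V* = N` and pairing `⟨λ, α⟩ = P.toLinearMap α λ`.  The simple roots of the base `b` are
enumerated as `α₁, …, αₙ` by `e`, and `S₀ = {0, 1, …, n}` is `Fin (n + 1)`. -/

namespace AffineWeyl

section

variable {ι M N : Type*} [AddCommGroup M] [Module ℝ M] [AddCommGroup N] [Module ℝ N]

/-- `θ` indexes a highest root `α₀`: every root `α` satisfies `α ≤ α₀`, that is, `α₀ - α` is a sum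
of simple roots. -/
def IsHighestRoot {P : RootPairing ι ℝ M N} (b : P.Base) (θ : ι) : Prop :=
  ∀ i, P.root θ - P.root i ∈ AddSubmonoid.closure (P.root '' b.support)

theorem nonempty_index (P : RootPairing ι ℝ M N) [P.IsRootSystem] [P.IsIrreducible] :
    Nonempty ι := by
  by_contra h
  rw [not_nonempty_iff] at h
  have h1 := RootPairing.IsIrreducible.nontrivial P
  have h2 : Submodule.span ℝ (range P.root) = ⊤ := RootPairing.IsRootSystem.span_root_eq_top
  rw [range_eq_empty, Submodule.span_empty] at h2
  exact bot_ne_top h2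

end

section

variable {ι M N : Type*} [AddCommGroup M] [Module ℝ M] [AddCommGroup N] [Module ℝ N]
  {P : RootPairing ι ℝ M N} [P.IsRootSystem] [P.IsIrreducible] (b : P.Base) {n : ℕ}
  (e : Fin n ≃ b.support)

/-- The index of the highest root `α₀`. -/
noncomputable def highestRoot : ι :=
  @Classical.epsilon ι (nonempty_index P) (IsHighestRoot b)

/-- The fundamental coweights: `⟨ϖᵢ^∨, αⱼ⟩ = δᵢⱼ`. -/
noncomputable def fundamentalCoweight (i : b.support) : N :=
  P.toLinearMap.flip.toPerfPair.symm (b.toWeightBasis.coord i)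

/-- The points `v₀ = 0` and `vᵢ = ϖᵢ^∨ / nᵢ`, where `α₀ = ∑ nᵢ αᵢ`. -/
noncomputable def alcoveVertex : Fin (n + 1) → N :=
  Fin.cases 0 fun i =>
    (b.toWeightBasis.repr (P.root (highestRoot b)) (e i))⁻¹ • fundamentalCoweight b (e i)

/-- The hyperplanes `H₀ = {⟨λ, α₀⟩ = 1}` and `Hᵢ = {⟨λ, αᵢ⟩ = 0}` for `i ≥ 1`. -/
noncomputable def wall : Fin (n + 1) → Set N :=
  Fin.cases {x | P.toLinearMap (P.root (highestRoot b)) x = 1} fun i =>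
    {x | P.toLinearMap (P.root (e i)) x = 0}

/-- The fundamental alcove `{λ | 0 < ⟨λ, α⟩ < 1 for all positive roots α}`. -/
def fundamentalAlcove : Set N :=
  {x | ∀ i, b.IsPos i → 0 < P.toLinearMap (P.root i) x ∧ P.toLinearMap (P.root i) x < 1}

/-- The affine reflections `s₀ : λ ↦ s_{α₀}(λ) + α₀^∨` and `sᵢ : λ ↦ s_{αᵢ}(λ)` for `i ≥ 1`. -/
noncomputable def affineReflection : Fin (n + 1) → (N ≃ᵃ[ℝ] N) :=
  Fin.cases
    ((P.coreflection (highestRoot b)).toAffineEquiv.trans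
      (AffineEquiv.constVAdd ℝ N (P.coroot (highestRoot b))))
    fun i => (P.coreflection (e i)).toAffineEquiv

/-- The affine Weyl group `W_a = ⟨s₀, …, sₙ⟩` of affine transformations of `V*`. -/
noncomputable def affineWeylGroup : Subgroup (N ≃ᵃ[ℝ] N) :=
  Subgroup.closure (range (affineReflection b e))

/-- The generators `s₀, …, sₙ` of `W_a`. -/
noncomputable def simpleReflection (i : Fin (n + 1)) : affineWeylGroup b e :=
  ⟨affineReflection b e i, Subgroup.subset_closure (mem_range_self i)⟩

/-- The length of an element of `W_a`: the least number of factors in an expression as a product of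
the generators `s₀, …, sₙ`. -/
noncomputable def len (w : affineWeylGroup b e) : ℕ :=
  sInf {m | ∃ l : List (Fin (n + 1)), l.length = m ∧ (l.map (simpleReflection b e)).prod = w}

/-- The standard parabolic subgroup `(W_a)_I`. -/
noncomputable def parabolic (I : Finset (Fin (n + 1))) : Subgroup (affineWeylGroup b e) :=
  Subgroup.closure (simpleReflection b e '' I)

/-- `^I W_a = {w | ℓ(sᵢ w) > ℓ(w) for all i ∈ I}`. -/
def minRight (I : Finset (Fin (n + 1))) : Set (affineWeylGroup b e) :=
  {w | ∀ i ∈ I, len b e w < len b e (simpleReflection b e i * w)}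

/-- `W_a^I = {w | ℓ(w sᵢ) > ℓ(w) for all i ∈ I}`. -/
def minLeft (I : Finset (Fin (n + 1))) : Set (affineWeylGroup b e) :=
  {w | ∀ i ∈ I, len b e w < len b e (w * simpleReflection b e i)}

/-- `v` is the factor in `(W_a)_J` of a length-additive factorisation `w = u v` with
`u ∈ (W_a)_I^{I ∩ J}`. -/
def IsParabolicFactor (I J : Finset (Fin (n + 1))) (w v : affineWeylGroup b e) : Prop :=
  v ∈ parabolic b e J ∧ ∃ u ∈ parabolic b e I, u ∈ minLeft b e (I ∩ J) ∧ w = u * v ∧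
    len b e w = len b e u + len b e v

/-- The factor `w_J` of an element `w` of `(W_a)_I (W_a)_J`. -/
noncomputable def parabolicFactor (I J : Finset (Fin (n + 1))) (w : affineWeylGroup b e) :
    affineWeylGroup b e :=
  Classical.epsilon (IsParabolicFactor b e I J w)

/-- The image `w s` of a finite set `s` of points. -/
def move (w : affineWeylGroup b e) (s : Finset N) : Finset N :=
  s.map (w : N ≃ᵃ[ℝ] N).toEquiv.toEmbedding

open scoped Classical in
/-- The vertices `{vᵢ | i ∉ I}` of the face `f_I` of the closed fundamental alcove. -/
noncomputable def faceVertices (I : Finset (Fin (n + 1))) : Finset N :=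
  Iᶜ.image (alcoveVertex b e)

/-- The simplices of the alcove triangulation, given by their vertices: all translates `w f_I` of
the nonempty faces of the closed fundamental alcove. -/
def alcoveSimplices : Set (Finset N) :=
  {s | ∃ (w : affineWeylGroup b e) (I : Finset (Fin (n + 1))), I ≠ Finset.univ ∧
    s = move b e w (faceVertices b e I)}

/-- The type `i ∈ {0, …, n}` of a vertex `w vᵢ` of the alcove triangulation, which orders the
vertices of each simplex. -/
noncomputable def vertexType (x : N) : ℕ :=
  sInf {m | ∃ (i : Fin (n + 1)) (w : affineWeylGroup b e), (i : ℕ) = m ∧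
    (w : N ≃ᵃ[ℝ] N) (alcoveVertex b e i) = x}

theorem move_one (s : Finset N) : move b e 1 s = s := by
  apply Finset.coe_injective
  simp only [move, Finset.coe_map]
  exact image_id (s : Set N)

theorem move_mul (w w' : affineWeylGroup b e) (s : Finset N) :
    move b e (w * w') s = move b e w (move b e w' s) := by
  simp only [move, Finset.map_map]
  rfl

/-- The left action of `W_a` on chains, permuting the simplices. -/
noncomputable def chainAction : Representation ℤ (affineWeylGroup b e) (Finset N →₀ ℤ) where
  toFun w := Finsupp.lmapDomain ℤ ℤ (move b e w)
  map_one' := Finsupp.lhom_ext fun s c => by simp [move_one]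
  map_mul' w w' := Finsupp.lhom_ext fun s c => by simp [move_mul]

/-- The right action of `W_a` on cochains: `(f · w)(s) = f(w s)`. -/
noncomputable def cochainAction :
    Representation ℤ (affineWeylGroup b e)ᵐᵒᵖ (Finset N → ℤ) where
  toFun w := LinearMap.funLeft ℤ ℤ (move b e w.unop)
  map_one' := LinearMap.ext fun f => funext fun s => by
    simp [LinearMap.funLeft_apply, move_one]
  map_mul' w w' := LinearMap.ext fun f => funext fun s => by
    simp [LinearMap.funLeft_apply, move_mul]

/-- The chain given by the single cell `w f_I`. -/
noncomputable def cell (I : Finset (Fin (n + 1))) (w : affineWeylGroup b e) : Finset N →₀ ℤ :=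
  Finsupp.single (move b e w (faceVertices b e I)) 1

open scoped Classical in
/-- The dual `(w⁻¹ f_I)*` of the cell `w⁻¹ f_I`, which is the cochain corresponding to the right
coset `(W_a)_I w`. -/
noncomputable def dualCell (I : Finset (Fin (n + 1))) (w : affineWeylGroup b e) :
    Finset N → ℤ :=
  Pi.single (move b e w⁻¹ (faceVertices b e I)) 1

/-- The number of elements of `S₀ \ I` smaller than `j`. -/
def below (I : Finset (Fin (n + 1))) (j : Fin (n + 1)) : ℕ :=
  (Iᶜ.filter fun i => i < j).card

end

end AffineWeyl

/-!
# The alcove triangulation and its dg-algebra of cochains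

Everything rests on the signs of affine roots, that is, of the functions `α + k` with `α` a root and
`k` an integer.  A root `α₀` of maximal height is a highest root (`exists_isHighestRoot`): a positive
root to which no simple root can be added is dominant, hence involves all simple roots because the
Dynkin diagram is connected, so it pairs positively with `α₀`.  With the simple affine roots
`a₀ = 1 - α₀` and `aᵢ = αᵢ`, the numbers `nᵢ aᵢ(x)` are the barycentric coordinates of `x` with
respect to the vertices `vᵢ` (`sum_smul_alcoveVertex`), and every affine root has constant sign on
the simplex `v₀, …, vₙ`.

An affine root that is positive on `A₀` and negative on `sᵢ A₀` vanishes at all `vⱼ`, `j ≠ i`, so it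
is `aᵢ` (`IsAffineRoot.eq_simpleForm`).  Following the sign of `aᵢ` along the gallery of a word gives
the exchange condition (`exchange`), and with it the dictionary between lengths and geometry:
`ℓ(sᵢ w) > ℓ(w)` if and only if `w A₀` lies on the same side of `Hᵢ` as `A₀`
(`len_lt_simple_mul_iff`).  All the Coxeter-theoretic facts are read off from it.  For `u ∈ (W_a)_I`
and `w ∈ ^IW_a`, the affine root `aᵢ ∘ u`, `i ∈ I`, is a combination of the `aⱼ`, `j ∈ I`, with
coefficients of one sign, so it has the same sign on `w A₀` as on `A₀` (`sameSide_mul_iff`); hence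
lengths add (`len_mul`) and minimal representatives are unique.  The parabolic subgroup `(W_a)_I` is
the pointwise stabiliser of the face `f_I` (`mem_parabolic_iff`), so
`(W_a)_I ∩ (W_a)_J = (W_a)_{I ∩ J}`, and the parabolic factor in the formula for the cup product
exists and is unique (`existsUnique_parabolicFactor`).

The closed alcove is a strict fundamental domain: its translates cover, because reflecting in a wall
lowers the number of affine roots separating a point from `A₀`, and points of the closed alcove in
one orbit agree (`eq_and_mem_parabolic`).  Two simplices therefore meet in a common face, simplices
correspond to cosets (`move_eq_move_iff`), and the triangulation is locally finite, since an alcove is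
determined by the integer parts of the roots at its centre (`finite_setOf_near`).

The dg-algebra axioms hold for every simplicial complex with vertices ordered by labels; in the
Leibniz rule the terms in which the cut vertex is deleted telescope
(`sum_neg_one_pow_position`).  The formulas for `∂`, `d` and `∪` on cells are then evaluated on each
simplex `z f_K`: the cells above `f_I` in the direction `j` are counted by the unique minimal
representative of a coset (`finsum_dualCell_move`), and a cup product is nonzero at `z f_K` only if
`z⁻¹` lies in both cosets `(W_a)_I x` and `(W_a)_J y` (`cup_dualCell`).
-/

set_option linter.unusedSectionVars false

namespace SimplicialCochains

/-! ### The dg-algebra of cochains of an ordered simplicial complex -/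

/-- `F` is an abstract simplicial complex without the empty simplex, and the labels `τ` are
distinct on the vertices of each simplex. -/
structure IsOrderedComplex {E : Type*} (F : Set (Finset E)) (τ : E → ℕ) : Prop where
  nonempty : ∀ s ∈ F, s.Nonempty
  down_closed : ∀ s ∈ F, ∀ t ⊆ s, t.Nonempty → t ∈ F
  injOn : ∀ s ∈ F, InjOn τ (s : Set E)

section

open scoped Classical

variable {E : Type*} {F : Set (Finset E)} {τ : E → ℕ}

theorem position_eq_erase_add (τ : E → ℕ) {s : Finset E} {x : E} (hx : x ∈ s) (y : E) :
    position τ s y = position τ (s.erase x) y + if τ x < τ y then 1 else 0 := by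
  rw [position, position]
  conv_lhs => rw [← Finset.insert_erase hx]
  rw [Finset.filter_insert]
  split_ifs
  · rw [Finset.card_insert_of_notMem (by simp)]
  · rfl

/-- Deleting two vertices in either order gives opposite signs, which is the reason for `∂ ∂ = 0` and
`d d = 0`. -/
theorem sum_sum_erase_eq_zero {A : Type*} [AddCommGroup A] {s : Finset E}
    (hs : InjOn τ (s : Set E)) (g : Finset E → A) :
    ∑ x ∈ s, (-1 : ℤ) ^ position τ s x •
      ∑ y ∈ s.erase x, (-1 : ℤ) ^ position τ (s.erase x) y • g ((s.erase x).erase y) = 0 := by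
  simp_rw [Finset.smul_sum, smul_smul, ← pow_add]
  rw [Finset.sum_sigma']
  refine Finset.sum_involution (fun q _ => ⟨q.2, q.1⟩) ?_ ?_ ?_ ?_
  · rintro ⟨x, y⟩ h
    simp only [Finset.mem_sigma, Finset.mem_erase] at h
    obtain ⟨hx, hyx, hy⟩ := h
    have h1 := position_eq_erase_add τ hx y
    have h2 := position_eq_erase_add τ hy x
    have hne : τ x ≠ τ y := fun h => hyx (hs hx hy h).symm
    simp only
    rw [Finset.erase_right_comm (a := y) (b := x), ← add_smul]
    rcases lt_or_gt_of_ne hne with h | h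
    · rw [if_pos h] at h1
      rw [if_neg h.not_gt, add_zero] at h2
      rw [h1, ← h2, show position τ (s.erase x) y + 1 + position τ s x =
        (position τ s x + position τ (s.erase x) y) + 1 by ring, pow_succ]
      simp
    · rw [if_pos h] at h2
      rw [if_neg h.not_gt, add_zero] at h1
      rw [h2, ← h1, show position τ s y + position τ (s.erase y) x =
        position τ (s.erase y) x + position τ s y by ring,
        show position τ (s.erase y) x + 1 + position τ s y =
        (position τ (s.erase y) x + position τ s y) + 1 by ring, pow_succ]
      simp
  · rintro ⟨x, y⟩ h _ h'
    simp only [Finset.mem_sigma, Finset.mem_erase] at h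
    simp only [Sigma.mk.injEq] at h'
    exact h.2.1 h'.1
  · rintro ⟨x, y⟩ h
    simp only [Finset.mem_sigma, Finset.mem_erase] at h ⊢
    exact ⟨h.2.2, h.2.1.symm, h.1⟩
  · rintro ⟨x, y⟩ h
    rfl

/-- An alternating sum over the vertices in which consecutive initial segments cancel. -/
theorem sum_neg_one_pow_position (τ : E → ℕ) (G : Finset E → ℤ) (s : Finset E) :
    InjOn τ (s : Set E) →
    ∑ z ∈ s, (-1 : ℤ) ^ position τ s z *
      (G (s.filter fun y => τ y < τ z) + G (s.filter fun y => τ y ≤ τ z)) =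
      G ∅ - (-1) ^ s.card * G s := by
  induction s using Finset.induction_on_max_value τ with
  | empty => simp
  | insert a s ha hmax ih =>
    intro hs
    have hlt : ∀ x ∈ s, τ x < τ a := fun x hx => lt_of_le_of_ne (hmax x hx) fun h => by
      have := hs (by simp [hx]) (by simp) h
      exact ha (this ▸ hx)
    have h1 : ((insert a s).filter fun y => τ y < τ a) = s := by
      ext y
      simp only [Finset.mem_filter, Finset.mem_insert]
      constructor
      · rintro ⟨rfl | h, h'⟩
        · exact absurd h' (lt_irrefl _)
        · exact h
      · exact fun h => ⟨Or.inr h, hlt y h⟩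
    have h2 : ((insert a s).filter fun y => τ y ≤ τ a) = insert a s :=
      Finset.filter_true_of_mem fun y hy => by
        rcases Finset.mem_insert.1 hy with rfl | h
        · exact le_rfl
        · exact hmax y h
    have h3 : ∀ z ∈ s, ((insert a s).filter fun y => τ y < τ z) = s.filter fun y => τ y < τ z :=
      fun z hz => by rw [Finset.filter_insert, if_neg (hlt z hz).not_gt]
    have h4 : ∀ z ∈ s, ((insert a s).filter fun y => τ y ≤ τ z) = s.filter fun y => τ y ≤ τ z :=
      fun z hz => by rw [Finset.filter_insert, if_neg (hlt z hz).not_ge]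
    rw [Finset.sum_insert ha, Finset.sum_congr rfl fun z hz => by
      rw [position, h3 z hz, h4 z hz, ← position], ih (hs.mono (by simp)), position, h1, h2,
      Finset.card_insert_of_notMem ha]
    ring

/-! ### Explicit formulas -/

theorem boundary_single (τ : E → ℕ) (s : Finset E) : boundary τ (Finsupp.single s 1) =
    ∑ x ∈ s, (-1 : ℤ) ^ position τ s x •
      if (s.erase x).Nonempty then Finsupp.single (s.erase x) (1 : ℤ) else 0 := by
  rw [boundary, Finsupp.linearCombination_single, one_smul]
  refine Finset.sum_congr rfl fun x _ => ?_
  split_ifs <;> simp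

theorem coboundary_apply {s : Finset E} (hs : s ∈ F) {f : Finset E → ℤ} (hf : f ∅ = 0) :
    coboundary F τ f s = ∑ x ∈ s, (-1 : ℤ) ^ position τ s x * f (s.erase x) := by
  change (if s ∈ F then Finsupp.linearCombination ℤ f (boundary τ (Finsupp.single s 1)) else 0) = _
  rw [if_pos hs, boundary_single, map_sum]
  refine Finset.sum_congr rfl fun x _ => ?_
  rw [map_smul]
  split_ifs with h
  · simp
  · rw [Finset.not_nonempty_iff_eq_empty] at h
    simp [h, hf]

theorem coboundary_apply_of_notMem {s : Finset E} (hs : s ∉ F) (f : Finset E → ℤ) :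
    coboundary F τ f s = 0 := if_neg hs

theorem cup_apply {s : Finset E} (hs : s ∈ F) (f g : Finset E → ℤ) : cup F τ f g s =
    ∑ x ∈ s, f (s.filter fun y => τ y ≤ τ x) * g (s.filter fun y => τ x ≤ τ y) := if_pos hs

theorem cup_apply_of_notMem {s : Finset E} (hs : s ∉ F) (f g : Finset E → ℤ) :
    cup F τ f g s = 0 := if_neg hs

theorem apply_empty_of_mem_cochains {k : ℕ} {f : Finset E → ℤ} (hf : f ∈ cochains F k) :
    f ∅ = 0 := by
  by_contra h
  simpa using (hf ∅ h).2

theorem IsOrderedComplex.empty_notMem (hF : IsOrderedComplex F τ) : ∅ ∉ F :=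
  fun h => by simpa using hF.nonempty _ h

/-- The formula for the cup product also holds at the empty set, where both sides vanish. -/
theorem IsOrderedComplex.cup_apply' (hF : IsOrderedComplex F τ) {s t : Finset E} (hs : s ∈ F)
    (ht : t ⊆ s) (f g : Finset E → ℤ) : cup F τ f g t =
    ∑ x ∈ t, f (t.filter fun y => τ y ≤ τ x) * g (t.filter fun y => τ x ≤ τ y) := by
  rcases t.eq_empty_or_nonempty with rfl | h
  · simp [cup_apply_of_notMem hF.empty_notMem]
  · exact cup_apply (hF.down_closed s hs t ht h) f g

/-- The formula for the coboundary also holds at the empty set, where both sides vanish. -/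
theorem IsOrderedComplex.coboundary_apply' (hF : IsOrderedComplex F τ) {s t : Finset E}
    (hs : s ∈ F) (ht : t ⊆ s) {f : Finset E → ℤ} (hf : f ∅ = 0) :
    coboundary F τ f t = ∑ x ∈ t, (-1 : ℤ) ^ position τ t x * f (t.erase x) := by
  rcases t.eq_empty_or_nonempty with rfl | h
  · simp [coboundary_apply_of_notMem hF.empty_notMem]
  · exact coboundary_apply (hF.down_closed s hs t ht h) hf

/-! ### The chain complex -/

theorem IsOrderedComplex.boundary_mem (hF : IsOrderedComplex F τ) {k : ℕ} {c : Finset E →₀ ℤ}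
    (hc : c ∈ chains F (k + 1)) : boundary τ c ∈ chains F k := by
  rw [boundary, Finsupp.linearCombination_apply]
  refine Submodule.sum_mem _ fun s hs => Submodule.smul_mem _ _ (Submodule.sum_mem _ fun x hx => ?_)
  obtain ⟨h1, h2⟩ := (Finsupp.mem_supported ℤ c).1 hc hs
  split_ifs with h
  · refine Submodule.smul_mem _ _ (Finsupp.single_mem_supported ℤ _ ⟨?_, ?_⟩)
    · exact hF.down_closed s h1 _ (Finset.erase_subset _ _) h
    · rw [Finset.card_erase_of_mem hx, h2]; rfl
  · exact zero_mem _

theorem IsOrderedComplex.boundary_boundary (hF : IsOrderedComplex F τ) {k : ℕ}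
    {c : Finset E →₀ ℤ} (hc : c ∈ chains F k) : boundary τ (boundary τ c) = 0 := by
  have hc' : c = ∑ s ∈ c.support, c s • Finsupp.single s 1 := by
    conv_lhs => rw [← c.sum_single]
    simp [Finsupp.sum]
  rw [hc', map_sum, map_sum]
  refine Finset.sum_eq_zero fun s hs => ?_
  rw [map_smul, map_smul]
  have hinj := hF.injOn s ((Finsupp.mem_supported ℤ c).1 hc hs).1
  suffices h : boundary τ (boundary τ (Finsupp.single s 1)) = 0 by rw [h, smul_zero]
  rw [boundary_single, map_sum]
  refine Eq.trans (Finset.sum_congr rfl fun x _ => ?_) (sum_sum_erase_eq_zero hinj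
    (fun t => if t.Nonempty then Finsupp.single t (1 : ℤ) else 0))
  rw [map_smul]
  split_ifs with h
  · rw [boundary_single]
  · rw [Finset.not_nonempty_iff_eq_empty] at h
    simp [h]

/-! ### Differential and product -/

theorem IsOrderedComplex.card_filter_add (hF : IsOrderedComplex F τ) {s : Finset E} (hs : s ∈ F)
    {x : E} (hx : x ∈ s) : (s.filter fun y => τ y ≤ τ x).card +
      (s.filter fun y => τ x ≤ τ y).card = s.card + 1 := by
  rw [← Finset.card_union_add_card_inter]
  congr 1
  · congr 1
    ext y
    simp only [Finset.mem_union, Finset.mem_filter]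
    have := le_total (τ x) (τ y)
    tauto
  · rw [Finset.card_eq_one]
    refine ⟨x, ?_⟩
    ext y
    simp only [Finset.mem_inter, Finset.mem_filter, Finset.mem_singleton]
    constructor
    · rintro ⟨⟨h1, h2⟩, -, h3⟩
      exact hF.injOn s hs h1 hx (le_antisymm h2 h3)
    · rintro rfl
      simp [hx]

theorem coboundary_mem {k : ℕ} {f : Finset E → ℤ} (hf : f ∈ cochains F k) :
    coboundary F τ f ∈ cochains F (k + 1) := by
  intro s h
  by_cases hs : s ∈ F
  · refine ⟨hs, ?_⟩
    rw [coboundary_apply hs (apply_empty_of_mem_cochains hf)] at h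
    obtain ⟨x, hx, h⟩ := Finset.exists_ne_zero_of_sum_ne_zero h
    have h1 := (hf _ (right_ne_zero_of_mul h)).2
    rw [← h1, Finset.card_erase_add_one hx]
  · exact absurd (coboundary_apply_of_notMem hs f) h

theorem IsOrderedComplex.coboundary_coboundary (hF : IsOrderedComplex F τ) {k : ℕ}
    {f : Finset E → ℤ} (hf : f ∈ cochains F k) : coboundary F τ (coboundary F τ f) = 0 := by
  funext s
  by_cases hs : s ∈ F
  · change _ = (0 : ℤ)
    rw [coboundary_apply hs (apply_empty_of_mem_cochains (coboundary_mem hf)),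
      ← sum_sum_erase_eq_zero (hF.injOn s hs) f]
    refine Finset.sum_congr rfl fun x _ => ?_
    rw [hF.coboundary_apply' hs (Finset.erase_subset _ _) (apply_empty_of_mem_cochains hf)]
    simp
  · exact coboundary_apply_of_notMem hs _

theorem IsOrderedComplex.cup_mem (hF : IsOrderedComplex F τ) {p q : ℕ} {f g : Finset E → ℤ}
    (hf : f ∈ cochains F p) (hg : g ∈ cochains F q) : cup F τ f g ∈ cochains F (p + q) := by
  intro s h
  by_cases hs : s ∈ F
  · refine ⟨hs, ?_⟩
    rw [cup_apply hs] at h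
    obtain ⟨x, hx, h⟩ := Finset.exists_ne_zero_of_sum_ne_zero h
    have h1 := (hf _ (left_ne_zero_of_mul h)).2
    have h2 := (hg _ (right_ne_zero_of_mul h)).2
    have h3 := hF.card_filter_add hs hx
    omega
  · exact absurd (cup_apply_of_notMem hs f g) h

theorem IsOrderedComplex.cup_assoc (hF : IsOrderedComplex F τ) (f g h : Finset E → ℤ) :
    cup F τ (cup F τ f g) h = cup F τ f (cup F τ g h) := by
  funext s
  by_cases hs : s ∈ F
  swap
  · rw [cup_apply_of_notMem hs, cup_apply_of_notMem hs]
  rw [cup_apply hs, cup_apply hs]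
  have h1 : ∀ x ∈ s, cup F τ f g (s.filter fun y => τ y ≤ τ x) * h (s.filter fun y => τ x ≤ τ y) =
      ∑ z ∈ s, if τ z ≤ τ x then f (s.filter fun y => τ y ≤ τ z) *
        g (s.filter fun y => τ z ≤ τ y ∧ τ y ≤ τ x) * h (s.filter fun y => τ x ≤ τ y) else 0 := by
    intro x _
    rw [hF.cup_apply' hs (Finset.filter_subset _ _), Finset.sum_mul, Finset.sum_filter]
    refine Finset.sum_congr rfl fun z _ => ?_
    split_ifs with hzx
    · rw [Finset.filter_filter, Finset.filter_filter]
      congr 3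
      · refine Finset.filter_congr fun y _ => ?_
        omega
      · refine Finset.filter_congr fun y _ => ?_
        omega
    · rfl
  have h2 : ∀ z ∈ s, f (s.filter fun y => τ y ≤ τ z) * cup F τ g h (s.filter fun y => τ z ≤ τ y) =
      ∑ x ∈ s, if τ z ≤ τ x then f (s.filter fun y => τ y ≤ τ z) *
        g (s.filter fun y => τ z ≤ τ y ∧ τ y ≤ τ x) * h (s.filter fun y => τ x ≤ τ y) else 0 := by
    intro z _
    rw [hF.cup_apply' hs (Finset.filter_subset _ _), Finset.mul_sum, Finset.sum_filter]
    refine Finset.sum_congr rfl fun x _ => ?_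
    split_ifs with hzx
    · rw [Finset.filter_filter, Finset.filter_filter, mul_assoc]
      congr 3
      refine Finset.filter_congr fun y _ => ?_
      omega
    · rfl
  rw [Finset.sum_congr rfl h1, Finset.sum_congr rfl h2, Finset.sum_comm]

/-- The graded Leibniz rule.  Besides the common terms, `d f ∪ g` and `(-1)ᵖ f ∪ d g` contain those
in which the cut vertex is deleted; these telescope. -/
theorem IsOrderedComplex.coboundary_cup (hF : IsOrderedComplex F τ) {p q : ℕ}
    {f g : Finset E → ℤ} (hf : f ∈ cochains F p) (hg : g ∈ cochains F q) :
    coboundary F τ (cup F τ f g) =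
      cup F τ (coboundary F τ f) g + (-1 : ℤ) ^ p • cup F τ f (coboundary F τ g) := by
  have hf0 := apply_empty_of_mem_cochains hf
  have hg0 := apply_empty_of_mem_cochains hg
  funext s
  by_cases hs : s ∈ F
  swap
  · simp [coboundary_apply_of_notMem hs, cup_apply_of_notMem hs]
  have hinj : ∀ x ∈ s, ∀ y ∈ s, y ≠ x → τ y ≠ τ x :=
    fun x hx y hy h h' => h (hF.injOn s hs hy hx h')
  have hL : coboundary F τ (cup F τ f g) s = ∑ z ∈ s, ∑ x ∈ s.erase z,
      ((if τ x < τ z then (-1 : ℤ) ^ position τ s x *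
          f ((s.filter fun y => τ y ≤ τ z).erase x) * g (s.filter fun y => τ z ≤ τ y) else 0) +
        if τ z < τ x then (-1 : ℤ) ^ position τ s x *
          f (s.filter fun y => τ y ≤ τ z) * g ((s.filter fun y => τ z ≤ τ y).erase x) else 0) := by
    rw [coboundary_apply hs (cup_apply_of_notMem hF.empty_notMem f g)]
    rw [Finset.sum_comm' (t' := s) (s' := fun x => s.erase x)
      (by intro x y; simp only [Finset.mem_erase]; tauto)]
    refine Finset.sum_congr rfl fun x hx => ?_
    rw [hF.cup_apply' hs (Finset.erase_subset _ _), Finset.mul_sum]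
    refine Finset.sum_congr rfl fun z hz => ?_
    rw [Finset.mem_erase] at hz
    rw [Finset.filter_erase, Finset.filter_erase]
    rcases lt_or_gt_of_ne (hinj x hx z hz.2 hz.1) with h | h
    · rw [if_neg h.not_gt, if_pos h, Finset.erase_eq_of_notMem (a := x)
        (s := s.filter fun y => τ y ≤ τ z) (by simp [h])]
      ring
    · rw [if_neg h.not_gt, if_pos h, Finset.erase_eq_of_notMem (a := x)
        (s := s.filter fun y => τ z ≤ τ y) (by simp [h])]
      ring
  have hR1 : cup F τ (coboundary F τ f) g s = ∑ z ∈ s,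
      ((-1 : ℤ) ^ position τ s z * f (s.filter fun y => τ y < τ z) *
          g (s.filter fun y => τ z ≤ τ y) +
        ∑ x ∈ s.erase z, if τ x < τ z then (-1 : ℤ) ^ position τ s x *
          f ((s.filter fun y => τ y ≤ τ z).erase x) * g (s.filter fun y => τ z ≤ τ y) else 0) := by
    rw [cup_apply hs]
    refine Finset.sum_congr rfl fun z hz => ?_
    have h1 : (s.filter fun y => τ y ≤ τ z).erase z = s.filter fun y => τ y < τ z := by
      ext y
      simp only [Finset.mem_erase, Finset.mem_filter]
      constructor
      · rintro ⟨h1, h2, h3⟩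
        exact ⟨h2, lt_of_le_of_ne h3 (hinj z hz y h2 h1)⟩
      · rintro ⟨h1, h2⟩
        exact ⟨by rintro rfl; exact lt_irrefl _ h2, h1, h2.le⟩
    have h2 : ∀ x, τ x ≤ τ z → position τ (s.filter fun y => τ y ≤ τ z) x = position τ s x := by
      intro x hx
      rw [position, position, Finset.filter_filter]
      congr 1
      refine Finset.filter_congr fun y _ => ?_
      omega
    rw [hF.coboundary_apply' hs (Finset.filter_subset _ _) hf0,
      ← Finset.add_sum_erase _ _ (show z ∈ s.filter fun y => τ y ≤ τ z by simp [hz]), h1,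
      h2 z le_rfl, add_mul, Finset.sum_mul, ← Finset.sum_filter]
    congr 1
    refine Finset.sum_congr ?_ fun x hx => ?_
    · ext y
      simp only [Finset.mem_erase, Finset.mem_filter]
      constructor
      · rintro ⟨h1, h2⟩
        exact ⟨⟨by rintro rfl; exact lt_irrefl _ h2, h1⟩, h2⟩
      · rintro ⟨⟨h1, h2⟩, h3⟩
        exact ⟨h2, h3⟩
    · rw [Finset.mem_filter] at hx
      rw [h2 x hx.2.le]
  have hR2 : (-1 : ℤ) ^ p * cup F τ f (coboundary F τ g) s = ∑ z ∈ s,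
      ((-1 : ℤ) ^ position τ s z * f (s.filter fun y => τ y ≤ τ z) *
          g (s.filter fun y => τ z < τ y) +
        ∑ x ∈ s.erase z, if τ z < τ x then (-1 : ℤ) ^ position τ s x *
          f (s.filter fun y => τ y ≤ τ z) * g ((s.filter fun y => τ z ≤ τ y).erase x) else 0) := by
    rw [cup_apply hs, Finset.mul_sum]
    refine Finset.sum_congr rfl fun z hz => ?_
    by_cases hfz : f (s.filter fun y => τ y ≤ τ z) = 0
    · simp [hfz]
    have h1 : (s.filter fun y => τ z ≤ τ y).erase z = s.filter fun y => τ z < τ y := by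
      ext y
      simp only [Finset.mem_erase, Finset.mem_filter]
      constructor
      · rintro ⟨h1, h2, h3⟩
        exact ⟨h2, lt_of_le_of_ne h3 (hinj z hz y h2 h1).symm⟩
      · rintro ⟨h1, h2⟩
        exact ⟨by rintro rfl; exact lt_irrefl _ h2, h1, h2.le⟩
    -- As `f` has degree `p`, the cut vertex is in position `p`, which accounts for `(-1)ᵖ`.
    have h3 : position τ s z = p := by
      have h4 : (s.filter fun y => τ y ≤ τ z) = insert z (s.filter fun y => τ y < τ z) := by
        ext y
        simp only [Finset.mem_insert, Finset.mem_filter]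
        constructor
        · rintro ⟨h1, h2⟩
          by_cases h : y = z
          · exact Or.inl h
          · exact Or.inr ⟨h1, lt_of_le_of_ne h2 (hinj z hz y h1 h)⟩
        · rintro (rfl | ⟨h1, h2⟩)
          · exact ⟨hz, le_rfl⟩
          · exact ⟨h1, h2.le⟩
      have h5 := (hf _ hfz).2
      rw [h4, Finset.card_insert_of_notMem (by simp)] at h5
      exact Nat.succ_injective h5
    have h2 : ∀ x, τ z ≤ τ x →
        p + position τ (s.filter fun y => τ z ≤ τ y) x = position τ s x := by
      intro x hx
      rw [← h3, position, position, position, Finset.filter_filter,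
        ← Finset.card_union_of_disjoint]
      · congr 1
        ext y
        simp only [Finset.mem_union, Finset.mem_filter]
        have := lt_or_ge (τ y) (τ z)
        constructor
        · rintro (⟨h1, h2⟩ | ⟨h1, h2, h3⟩)
          · exact ⟨h1, by omega⟩
          · exact ⟨h1, h3⟩
        · rintro ⟨h1, h2⟩
          exact this.imp (fun h => ⟨h1, h⟩) fun h => ⟨h1, h, h2⟩
      · rw [Finset.disjoint_filter]
        intro y _ h1 h2
        omega
    rw [hF.coboundary_apply' hs (Finset.filter_subset _ _) hg0,
      ← Finset.add_sum_erase _ _ (show z ∈ s.filter fun y => τ z ≤ τ y by simp [hz]), h1,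
      mul_add, mul_add, Finset.mul_sum, Finset.mul_sum, ← Finset.sum_filter]
    congr 1
    · rw [← h2 z le_rfl, pow_add]
      ring
    refine Finset.sum_congr ?_ fun x hx => ?_
    · ext y
      simp only [Finset.mem_erase, Finset.mem_filter]
      constructor
      · rintro ⟨h1, h2⟩
        exact ⟨⟨by rintro rfl; exact lt_irrefl _ h2, h1⟩, h2⟩
      · rintro ⟨⟨h1, h2⟩, h3⟩
        exact ⟨h2, h3⟩
    · rw [Finset.mem_filter] at hx
      rw [← h2 x hx.2.le, pow_add]
      ring
  -- The terms in which the cut vertex is deleted cancel.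
  have hT : ∑ z ∈ s, ((-1 : ℤ) ^ position τ s z * f (s.filter fun y => τ y < τ z) *
        g (s.filter fun y => τ z ≤ τ y) + (-1 : ℤ) ^ position τ s z *
        f (s.filter fun y => τ y ≤ τ z) * g (s.filter fun y => τ z < τ y)) = 0 := by
    have h1 := sum_neg_one_pow_position τ (fun t => f t * g (s \ t)) s (hF.injOn s hs)
    simp only [hf0, zero_mul, Finset.sdiff_self, hg0, mul_zero, sub_zero] at h1
    rw [← h1]
    refine Finset.sum_congr rfl fun z _ => ?_
    rw [← Finset.filter_not, ← Finset.filter_not]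
    simp only [not_lt, not_le]
    ring
  rw [Pi.add_apply, Pi.smul_apply, smul_eq_mul, hL, hR1, hR2, ← Finset.sum_add_distrib]
  rw [← sub_eq_zero, ← neg_eq_zero, ← hT, ← Finset.sum_sub_distrib, ← Finset.sum_neg_distrib]
  refine Finset.sum_congr rfl fun z _ => ?_
  rw [Finset.sum_add_distrib]
  ring

/-! ### Finitely supported cochains, unit and symmetries -/

theorem iSupIndep_cochains (F : Set (Finset E)) : iSupIndep (cochains F) := by
  intro k
  rw [Submodule.disjoint_def]
  intro f hf hf'
  have h1 : (⨆ j, ⨆ (_ : j ≠ k), cochains F j) ≤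
      { carrier := {f : Finset E → ℤ | ∀ s, s.card = k + 1 → f s = 0}
        zero_mem' := fun s _ => rfl
        add_mem' := fun {f g} hf hg s hs => by simp [hf s hs, hg s hs]
        smul_mem' := fun c f hf s hs => by simp [hf s hs] : Submodule ℤ (Finset E → ℤ) } := by
    refine iSup₂_le fun j hj f hf s hs => ?_
    by_contra h
    have := (hf s h).2
    omega
  funext s
  by_contra h
  exact h (h1 hf' s (hf s h).2)

theorem finiteCochains_le (F : Set (Finset E)) (k : ℕ) : finiteCochains F k ≤ cochains F k :=
  fun _ h => h.1

/-- Each simplex has finitely many cofaces, so the coboundary preserves finite supports. -/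
theorem coboundary_mem_finiteCochains (hstar : ∀ t ∈ F, {s ∈ F | t ⊆ s}.Finite) {k : ℕ}
    {f : Finset E → ℤ} (hf : f ∈ finiteCochains F k) :
    coboundary F τ f ∈ finiteCochains F (k + 1) := by
  refine ⟨coboundary_mem hf.1, (hf.2.biUnion fun t ht => hstar t (hf.1 t ht).1).subset ?_⟩
  intro s h
  have hs := (coboundary_mem hf.1 s h).1
  rw [Function.mem_support, coboundary_apply hs (apply_empty_of_mem_cochains hf.1)] at h
  obtain ⟨x, hx, h⟩ := Finset.exists_ne_zero_of_sum_ne_zero h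
  exact mem_iUnion₂.2 ⟨s.erase x, right_ne_zero_of_mul h, hs, Finset.erase_subset _ _⟩

theorem IsOrderedComplex.cup_mem_finiteCochains (hF : IsOrderedComplex F τ) {p q : ℕ}
    {f g : Finset E → ℤ} (hf : f ∈ finiteCochains F p) (hg : g ∈ finiteCochains F q) :
    cup F τ f g ∈ finiteCochains F (p + q) := by
  refine ⟨hF.cup_mem hf.1 hg.1, (hf.2.image2 (fun s t => s ∪ t) hg.2).subset ?_⟩
  intro s h
  have hs := (hF.cup_mem hf.1 hg.1 s h).1
  rw [Function.mem_support, cup_apply hs] at h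
  obtain ⟨x, hx, h⟩ := Finset.exists_ne_zero_of_sum_ne_zero h
  refine ⟨_, left_ne_zero_of_mul h, _, right_ne_zero_of_mul h, ?_⟩
  ext y
  simp only [Finset.mem_union, Finset.mem_filter]
  have := le_total (τ x) (τ y)
  tauto

/-- A finitely supported cochain is the coefficient function of a chain. -/
noncomputable def chainsEquivFiniteCochains {E : Type*} (F : Set (Finset E)) (k : ℕ) :
    chains F k ≃ₗ[ℤ] finiteCochains F k where
  toFun c := ⟨c.1, fun _ h => (Finsupp.mem_supported ℤ c.1).1 c.2 (Finsupp.mem_support_iff.2 h),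
    c.1.hasFiniteSupport⟩
  invFun f := ⟨Finsupp.ofSupportFinite f.1 f.2.2, (Finsupp.mem_supported ℤ _).2 fun s h =>
    f.2.1 s (Finsupp.mem_support_iff.1 h)⟩
  map_add' _ _ := rfl
  map_smul' _ _ := rfl
  left_inv _ := Subtype.ext (Finsupp.ext fun _ => rfl)
  right_inv _ := Subtype.ext rfl

/-- The cochain with value one on all vertices. -/
noncomputable def unitCochain (F : Set (Finset E)) (s : Finset E) : ℤ :=
  if s ∈ F ∧ s.card = 1 then 1 else 0

theorem unitCochain_mem (F : Set (Finset E)) : unitCochain F ∈ cochains F 0 := by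
  intro s h
  by_contra h'
  exact h (if_neg h')

theorem IsOrderedComplex.coboundary_unitCochain (hF : IsOrderedComplex F τ) :
    coboundary F τ (unitCochain F) = 0 := by
  funext s
  by_cases hs : s ∈ F
  swap
  · exact coboundary_apply_of_notMem hs _
  change _ = (0 : ℤ)
  rw [coboundary_apply hs (apply_empty_of_mem_cochains (unitCochain_mem F))]
  by_cases h2 : s.card = 2
  · obtain ⟨x, y, hxy, rfl⟩ := Finset.card_eq_two.1 h2
    have hne : τ x ≠ τ y := fun h => hxy (hF.injOn _ hs (by simp) (by simp) h)
    have h1 : ∀ z, z ∈ ({x, y} : Finset E) → unitCochain F {z} = 1 := fun z hz =>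
      if_pos ⟨hF.down_closed _ hs _ (by simpa using hz) (by simp), by simp⟩
    rw [Finset.sum_pair hxy, Finset.pair_comm x y, Finset.erase_insert (by simpa using hxy.symm),
      Finset.pair_comm y x, Finset.erase_insert (by simpa using hxy), h1 x (by simp),
      h1 y (by simp), position, position]
    rcases lt_or_gt_of_ne hne with h | h
    · simp [Finset.filter_insert, Finset.filter_singleton, h, h.not_gt]
    · simp [Finset.filter_insert, Finset.filter_singleton, h, h.not_gt]
  · refine Finset.sum_eq_zero fun x hx => ?_
    rw [unitCochain, if_neg, mul_zero]
    rintro ⟨-, h⟩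
    rw [Finset.card_erase_of_mem hx] at h
    omega

theorem IsOrderedComplex.unitCochain_cup (hF : IsOrderedComplex F τ) {k : ℕ}
    {f : Finset E → ℤ} (hf : f ∈ cochains F k) : cup F τ (unitCochain F) f = f := by
  funext s
  by_cases hs : s ∈ F
  swap
  · rw [cup_apply_of_notMem hs]
    by_contra h
    exact hs (hf s (Ne.symm h)).1
  rw [cup_apply hs]
  obtain ⟨x, hx, hmin⟩ := s.exists_min_image τ (hF.nonempty s hs)
  have h1 : (s.filter fun y => τ y ≤ τ x) = {x} := by
    ext y
    simp only [Finset.mem_filter, Finset.mem_singleton]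
    exact ⟨fun h => hF.injOn s hs h.1 hx (le_antisymm h.2 (hmin y h.1)),
      by rintro rfl; exact ⟨hx, le_rfl⟩⟩
  rw [Finset.sum_eq_single x]
  · rw [h1, Finset.filter_true_of_mem hmin, unitCochain, if_pos, one_mul]
    exact ⟨hF.down_closed s hs _ (by simpa using hx) (by simp), by simp⟩
  · intro z hz hzx
    rw [unitCochain, if_neg, zero_mul]
    rintro ⟨-, h⟩
    exact hzx (Finset.card_le_one.1 h.le z (by simp [hz]) x (by simp [hx, hmin z hz]))
  · exact fun h => absurd hx h

theorem IsOrderedComplex.cup_unitCochain (hF : IsOrderedComplex F τ) {k : ℕ}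
    {f : Finset E → ℤ} (hf : f ∈ cochains F k) : cup F τ f (unitCochain F) = f := by
  funext s
  by_cases hs : s ∈ F
  swap
  · rw [cup_apply_of_notMem hs]
    by_contra h
    exact hs (hf s (Ne.symm h)).1
  rw [cup_apply hs]
  obtain ⟨x, hx, hmax⟩ := s.exists_max_image τ (hF.nonempty s hs)
  have h1 : (s.filter fun y => τ x ≤ τ y) = {x} := by
    ext y
    simp only [Finset.mem_filter, Finset.mem_singleton]
    exact ⟨fun h => hF.injOn s hs h.1 hx (le_antisymm (hmax y h.1) h.2),
      by rintro rfl; exact ⟨hx, le_rfl⟩⟩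
  rw [Finset.sum_eq_single x]
  · rw [h1, Finset.filter_true_of_mem hmax, unitCochain, if_pos, mul_one]
    exact ⟨hF.down_closed s hs _ (by simpa using hx) (by simp), by simp⟩
  · intro z hz hzx
    rw [unitCochain, if_neg, mul_zero]
    rintro ⟨-, h⟩
    exact hzx (Finset.card_le_one.1 h.le z (by simp [hz]) x (by simp [hx, hmax z hz]))
  · exact fun h => absurd hx h

/-- A permutation of the vertices that preserves the complex and the labels. -/
structure IsSymmetry (F : Set (Finset E)) (τ : E → ℕ) (σ : E ≃ E) : Prop where
  map_mem_iff : ∀ s : Finset E, s.map σ.toEmbedding ∈ F ↔ s ∈ F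
  label : ∀ s ∈ F, ∀ x ∈ s, τ (σ x) = τ x

theorem IsSymmetry.filter_map {σ : E ≃ E} (hσ : IsSymmetry F τ σ) {s : Finset E} (hs : s ∈ F)
    (p : ℕ → Prop) [DecidablePred p] : ((s.map σ.toEmbedding).filter fun y => p (τ y)) =
      (s.filter fun y => p (τ y)).map σ.toEmbedding := by
  rw [Finset.filter_map]
  congr 1
  refine Finset.filter_congr fun y hy => ?_
  change p (τ (σ y)) ↔ _
  rw [hσ.label s hs y hy]

theorem IsSymmetry.position_map {σ : E ≃ E} (hσ : IsSymmetry F τ σ) {s : Finset E} (hs : s ∈ F)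
    {x : E} (hx : x ∈ s) : position τ (s.map σ.toEmbedding) (σ x) = position τ s x := by
  rw [position, hσ.label s hs x hx, hσ.filter_map hs (fun m => m < τ x), Finset.card_map, position]

theorem IsSymmetry.boundary_map {σ : E ≃ E} (hσ : IsSymmetry F τ σ) {k : ℕ}
    {c : Finset E →₀ ℤ} (hc : c ∈ chains F k) :
    boundary τ (Finsupp.lmapDomain ℤ ℤ (fun s : Finset E => s.map σ.toEmbedding) c) =
      Finsupp.lmapDomain ℤ ℤ (fun s : Finset E => s.map σ.toEmbedding) (boundary τ c) := by
  have hc' : c = ∑ s ∈ c.support, c s • Finsupp.single s 1 := by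
    conv_lhs => rw [← c.sum_single]
    simp [Finsupp.sum]
  rw [hc']
  simp only [map_sum, map_smul]
  refine Finset.sum_congr rfl fun s hs => ?_
  have hs' := ((Finsupp.mem_supported ℤ c).1 hc hs).1
  congr 1
  rw [boundary_single, Finsupp.lmapDomain_apply, Finsupp.mapDomain_single, boundary_single,
    Finset.sum_map, map_sum]
  refine Finset.sum_congr rfl fun x hx => ?_
  rw [map_smul, Equiv.toEmbedding_apply, hσ.position_map hs' hx]
  have h1 : (s.map σ.toEmbedding).erase (σ x) = (s.erase x).map σ.toEmbedding := by
    rw [Finset.map_erase]; rfl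
  rw [h1]
  by_cases h : (s.erase x).Nonempty
  · rw [if_pos (Finset.map_nonempty.2 h), if_pos h, Finsupp.lmapDomain_apply,
      Finsupp.mapDomain_single]
  · rw [if_neg (mt Finset.map_nonempty.1 h), if_neg h, map_zero]

theorem IsSymmetry.coboundary_map {σ : E ≃ E} (hσ : IsSymmetry F τ σ) {f : Finset E → ℤ}
    (hf : f ∅ = 0) (s : Finset E) : coboundary F τ (fun t => f (t.map σ.toEmbedding)) s =
      coboundary F τ f (s.map σ.toEmbedding) := by
  by_cases hs : s ∈ F
  · rw [coboundary_apply hs (by simpa using hf), coboundary_apply ((hσ.map_mem_iff s).2 hs) hf,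
      Finset.sum_map]
    refine Finset.sum_congr rfl fun x hx => ?_
    rw [Equiv.toEmbedding_apply, hσ.position_map hs hx, Finset.map_erase]
    rfl
  · rw [coboundary_apply_of_notMem hs, coboundary_apply_of_notMem (mt (hσ.map_mem_iff s).1 hs)]

theorem IsSymmetry.cup_map {σ : E ≃ E} (hσ : IsSymmetry F τ σ) (f g : Finset E → ℤ)
    (s : Finset E) :
    cup F τ (fun t => f (t.map σ.toEmbedding)) (fun t => g (t.map σ.toEmbedding)) s =
      cup F τ f g (s.map σ.toEmbedding) := by
  by_cases hs : s ∈ F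
  · rw [cup_apply hs, cup_apply ((hσ.map_mem_iff s).2 hs), Finset.sum_map]
    refine Finset.sum_congr rfl fun x hx => ?_
    rw [Equiv.toEmbedding_apply, hσ.label s hs x hx, hσ.filter_map hs (fun m => m ≤ τ x),
      hσ.filter_map hs (fun m => τ x ≤ m)]
  · rw [cup_apply_of_notMem hs, cup_apply_of_notMem (mt (hσ.map_mem_iff s).1 hs)]

theorem IsSymmetry.map_mem_cochains {σ : E ≃ E} (hσ : IsSymmetry F τ σ) {k : ℕ}
    {f : Finset E → ℤ} (hf : f ∈ cochains F k) :
    (fun t : Finset E => f (t.map σ.toEmbedding)) ∈ cochains F k := by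
  intro s h
  have := hf _ h
  rwa [hσ.map_mem_iff, Finset.card_map] at this

theorem IsSymmetry.map_mem_finiteCochains {σ : E ≃ E} (hσ : IsSymmetry F τ σ) {k : ℕ}
    {f : Finset E → ℤ} (hf : f ∈ finiteCochains F k) :
    (fun t : Finset E => f (t.map σ.toEmbedding)) ∈ finiteCochains F k :=
  ⟨hσ.map_mem_cochains hf.1,
    hf.2.preimage (Finset.map_injective σ.toEmbedding).injOn⟩

theorem IsSymmetry.unitCochain_map {σ : E ≃ E} (hσ : IsSymmetry F τ σ) (s : Finset E) :
    unitCochain F (s.map σ.toEmbedding) = unitCochain F s := by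
  rw [unitCochain, unitCochain, hσ.map_mem_iff, Finset.card_map]

theorem IsOrderedComplex.isDGAlgebra {G : Type*} [Group G] (hF : IsOrderedComplex F τ)
    (act : Representation ℤ Gᵐᵒᵖ (Finset E → ℤ)) (σ : Gᵐᵒᵖ → E ≃ E)
    (hσ : ∀ g, IsSymmetry F τ (σ g))
    (hact : ∀ g f, act g f = fun s => f (s.map (σ g).toEmbedding)) :
    IsDGAlgebra act (cochains F) (coboundary F τ) (cup F τ) where
  independent := iSupIndep_cochains F
  act_mem g k f hf := by rw [hact]; exact (hσ g).map_mem_cochains hf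
  d_mem k f hf := coboundary_mem hf
  d_d k f hf := hF.coboundary_coboundary hf
  d_act g k f hf := by
    rw [hact, hact]
    exact funext ((hσ g).coboundary_map (apply_empty_of_mem_cochains hf))
  mul_mem p q f hf g hg := hF.cup_mem hf hg
  mul_assoc p q r f _ g _ h _ := hF.cup_assoc f g h
  mul_act g p q f _ f' _ := by
    rw [hact, hact, hact]
    exact (funext ((hσ g).cup_map f f')).symm
  leibniz p q f hf g hg := hF.coboundary_cup hf hg

theorem IsOrderedComplex.isDGAlgebra_finite {G : Type*} [Group G] (hF : IsOrderedComplex F τ)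
    (hstar : ∀ t ∈ F, {s ∈ F | t ⊆ s}.Finite)
    (act : Representation ℤ Gᵐᵒᵖ (Finset E → ℤ)) (σ : Gᵐᵒᵖ → E ≃ E)
    (hσ : ∀ g, IsSymmetry F τ (σ g))
    (hact : ∀ g f, act g f = fun s => f (s.map (σ g).toEmbedding)) :
    IsDGAlgebra act (finiteCochains F) (coboundary F τ) (cup F τ) where
  independent := (iSupIndep_cochains F).mono (finiteCochains_le F)
  act_mem g k f hf := by rw [hact]; exact (hσ g).map_mem_finiteCochains hf
  d_mem k f hf := coboundary_mem_finiteCochains hstar hf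
  d_d k f hf := hF.coboundary_coboundary hf.1
  d_act g k f hf := (hF.isDGAlgebra act σ hσ hact).d_act g k f hf.1
  mul_mem p q f hf g hg := hF.cup_mem_finiteCochains hf hg
  mul_assoc p q r f _ g _ h _ := hF.cup_assoc f g h
  mul_act g p q f hf f' hf' := (hF.isDGAlgebra act σ hσ hact).mul_act g p q f hf.1 f' hf'.1
  leibniz p q f hf g hg := hF.coboundary_cup hf.1 hg.1

end

end SimplicialCochains

namespace AffineWeyl

/-! ### The highest root -/

section

variable {ι M N : Type*} [Finite ι] [AddCommGroup M] [Module ℝ M] [AddCommGroup N] [Module ℝ N]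
  {P : RootPairing ι ℝ M N}

theorem exists_eq_sum_of_mem_closure (b : P.Base) {x : M}
    (hx : x ∈ AddSubmonoid.closure (P.root '' b.support)) :
    ∃ f : ι → ℤ, 0 ≤ f ∧ x = ∑ j ∈ b.support, f j • P.root j := by
  classical
  refine AddSubmonoid.closure_induction ?_ ⟨0, le_rfl, by simp⟩ ?_ hx
  · rintro - ⟨j, hj, rfl⟩
    refine ⟨Pi.single j 1, by simp, ?_⟩
    rw [Finset.sum_eq_single j]
    · simp
    · intro k _ hk; simp [hk]
    · intro h; exact absurd hj h
  · rintro _ _ _ _ ⟨f, hf, rfl⟩ ⟨g, hg, rfl⟩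
    exact ⟨f + g, add_nonneg hf hg, by simp [add_smul, Finset.sum_add_distrib]⟩

theorem isPos_of_mem_closure (b : P.Base) {i : ι}
    (hi : P.root i ∈ AddSubmonoid.closure (P.root '' b.support)) : b.IsPos i := by
  obtain ⟨f, hf, h⟩ := exists_eq_sum_of_mem_closure b hi
  rw [RootPairing.Base.isPos_iff', RootPairing.Base.height_eq_sum h]
  exact Finset.sum_nonneg fun j _ => hf j

theorem mem_closure_of_isPos (b : P.Base) {i : ι} (hi : b.IsPos i) :
    P.root i ∈ AddSubmonoid.closure (P.root '' b.support) := by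
  refine (b.root_mem_or_neg_mem i).resolve_right fun h => ?_
  let := P.indexNeg
  have h1 : b.IsPos (-i) := isPos_of_mem_closure b (by simpa using h)
  exact (RootPairing.Base.IsPos.neg_iff_not b i).1 h1 hi

theorem neg_mem_closure_of_not_isPos (b : P.Base) {i : ι} (hi : ¬ b.IsPos i) :
    -P.root i ∈ AddSubmonoid.closure (P.root '' b.support) :=
  (b.root_mem_or_neg_mem i).resolve_left fun h => hi (isPos_of_mem_closure b h)

variable [P.IsRootSystem]

theorem coeff_nonneg_of_mem_closure (b : P.Base) {x : M}
    (hx : x ∈ AddSubmonoid.closure (P.root '' b.support)) (j : b.support) :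
    0 ≤ b.toWeightBasis.repr x j := by
  classical
  induction hx using AddSubmonoid.closure_induction with
  | mem x hx =>
    obtain ⟨k, hk, rfl⟩ := hx
    have := b.toWeightBasis_repr_root ⟨k, hk⟩
    simp only at this
    rw [this, Finsupp.single_apply]
    split_ifs <;> simp
  | zero => simp
  | add x y _ _ h1 h2 => simpa using add_nonneg h1 h2

variable [P.IsCrystallographic]

theorem pairing_eq_sum_coeff (b : P.Base) (i k : ι) :
    P.pairing i k = ∑ j, b.toWeightBasis.repr (P.root i) j * P.pairing j k := by
  have h := b.toWeightBasis.sum_repr (P.root i)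
  rw [← P.root_coroot'_eq_pairing]
  conv_lhs => rw [← h]
  simp [P.root_coroot'_eq_pairing]

theorem pairing_le_zero_of_ne (b : P.Base) {i j : b.support} (h : i ≠ j) :
    P.pairing i j ≤ 0 := by
  have := b.pairingIn_le_zero_of_ne (i := i) (j := j) (fun h' => h (Subtype.ext h')) i.2 j.2
  rw [← P.algebraMap_pairingIn ℤ]
  simpa using this

variable [P.IsReduced] [P.IsIrreducible]

/-- A positive dominant root involves every simple root: the support of the root is closed under
passing to neighbours in the Dynkin diagram, which is connected. -/
theorem coeff_pos_of_dominant (b : P.Base) {i : ι} (hi : b.IsPos i)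
    (hd : ∀ j ∈ b.support, 0 ≤ P.pairing i j) (j : b.support) :
    0 < b.toWeightBasis.repr (P.root i) j := by
  have h0 := coeff_nonneg_of_mem_closure b (mem_closure_of_isPos b hi)
  obtain ⟨k, hk⟩ : ∃ k, b.toWeightBasis.repr (P.root i) k ≠ 0 := by
    by_contra! h
    apply P.ne_zero i
    rw [← b.toWeightBasis.sum_repr (P.root i)]
    simp [h]
  refine lt_of_le_of_ne (h0 j) (Ne.symm ?_)
  refine b.induction_on_cartanMatrix
    (fun j => b.toWeightBasis.repr (P.root i) j ≠ 0) hk fun k l hk hlk hl => ?_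
  have hkl : k ≠ l := by rintro rfl; exact hk hl
  have h1 : ∀ m, b.toWeightBasis.repr (P.root i) m * P.pairing m l ≤ 0 := by
    intro m
    by_cases hm : m = l
    · subst hm; simp [hl]
    · exact mul_nonpos_of_nonneg_of_nonpos (h0 m) (pairing_le_zero_of_ne b hm)
  have h2 := hd l l.2
  rw [pairing_eq_sum_coeff b] at h2
  have h3 := (Finset.sum_eq_zero_iff_of_nonpos (fun m _ => h1 m)).1
    (le_antisymm (Finset.sum_nonpos fun m _ => h1 m) h2) k (Finset.mem_univ k)
  have h4 : P.pairing k l ≠ 0 := by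
    have : b.cartanMatrix k l ≠ 0 := fun h => hlk (b.cartanMatrix_apply_eq_zero_iff_symm.1 h)
    exact fun h => this (b.cartanMatrix_apply_eq_zero_iff_pairing.2 h)
  exact (mul_ne_zero hk h4) h3

/-- If no simple root can be added to a positive root, then the root is dominant. -/
theorem dominant_of_add_notMem (b : P.Base) {i : ι} (hi : b.IsPos i)
    (h : ∀ j ∈ b.support, P.root i + P.root j ∉ range P.root) :
    ∀ j ∈ b.support, 0 ≤ P.pairing i j := by
  intro j hj
  by_contra! hneg
  have h1 : P.pairingIn ℤ i j < 0 := by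
    rw [← P.algebraMap_pairingIn ℤ] at hneg
    simpa using hneg
  refine h j hj (P.root_add_root_mem_of_pairingIn_neg h1 fun h2 => ?_)
  let := P.indexNeg
  have h3 : i = -j := P.root.injective (by simpa using h2)
  subst h3
  exact (RootPairing.Base.IsPos.neg_iff_not b j).1 hi (RootPairing.Base.isPos_of_mem_support hj)

/-- A root of maximal height is a highest root. -/
theorem exists_isHighestRoot (b : P.Base) : ∃ θ, IsHighestRoot b θ := by
  have := nonempty_index P
  obtain ⟨θ, hθ⟩ := Finite.exists_max b.height
  have hpos : b.IsPos θ := by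
    let := P.indexNeg
    rcases RootPairing.Base.IsPos.or_neg b θ with h | h
    · exact h
    · exact lt_of_lt_of_le h (hθ _)
  have hadd : ∀ i, b.height i = b.height θ → ∀ j ∈ b.support,
      P.root i + P.root j ∉ range P.root := by
    rintro i hi j hj ⟨k, hk⟩
    have h1 := b.height_add hk
    have h2 := hθ k
    rw [RootPairing.Base.height_one_of_mem_support hj] at h1
    omega
  have hdom := dominant_of_add_notMem b hpos (hadd θ rfl)
  refine ⟨θ, fun i => ?_⟩
  -- Ascending induction on the height: a root which admits no ascent is dominant, so it pairs
  -- positively with `θ` and the difference from `θ` is again a root.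
  induction hm : (b.height θ - b.height i).toNat using Nat.strong_induction_on generalizing i with
  | _ m ih =>
  by_cases hi : b.IsPos i
  swap
  · rw [sub_eq_add_neg]
    exact add_mem (mem_closure_of_isPos b hpos) (neg_mem_closure_of_not_isPos b hi)
  by_cases hex : ∃ j ∈ b.support, P.root i + P.root j ∈ range P.root
  · obtain ⟨j, hj, k, hk⟩ := hex
    have h1 := b.height_add hk
    have h2 := hθ k
    rw [RootPairing.Base.height_one_of_mem_support hj] at h1
    have h3 := ih _ (by omega) k rfl
    have h4 : P.root θ - P.root i = (P.root θ - P.root k) + P.root j := by rw [hk]; abel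
    rw [h4]
    exact add_mem h3 (AddSubmonoid.subset_closure (mem_image_of_mem _ hj))
  · push Not at hex
    have hdi := dominant_of_add_notMem b hi hex
    have hc := coeff_pos_of_dominant b hpos hdom
    have hpair : 0 < P.pairing θ i := by
      rw [pairing_eq_sum_coeff b]
      obtain ⟨k, hk, hk'⟩ := hi.exists_mem_support_pos_pairingIn
      refine Finset.sum_pos' (fun j _ => mul_nonneg (hc j).le ?_) ⟨⟨k, hk⟩, Finset.mem_univ _, ?_⟩
      · have h1 := hdi j j.2
        rw [← P.algebraMap_pairingIn ℤ] at h1 ⊢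
        by_contra! h2
        have h3 := (P.pairingIn_lt_zero_iff ℤ).1 (by simpa using h2 : P.pairingIn ℤ j i < 0)
        simp at h1
        omega
      · refine mul_pos (hc _) ?_
        rw [← P.algebraMap_pairingIn ℤ]
        simpa using hk'
    by_cases hiθ : θ = i
    · subst hiθ; simp
    obtain ⟨k, hk⟩ := P.root_sub_root_mem_of_pairingIn_pos (i := θ) (j := i)
      (by rw [← P.algebraMap_pairingIn ℤ] at hpair; simpa using hpair) hiθ
    rw [← hk]
    apply mem_closure_of_isPos
    rw [RootPairing.Base.isPos_iff', b.height_sub hk]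
    have := hθ i
    omega

theorem isHighestRoot_highestRoot (b : P.Base) : IsHighestRoot b (highestRoot b) :=
  @Classical.epsilon_spec_aux ι (nonempty_index P) _ (exists_isHighestRoot b)

end

end AffineWeyl

namespace AffineWeyl

section

variable {ι M N : Type*} [Finite ι] [AddCommGroup M] [Module ℝ M] [AddCommGroup N] [Module ℝ N]
  {P : RootPairing ι ℝ M N} [P.IsRootSystem] [P.IsCrystallographic] [P.IsReduced]
  [P.IsIrreducible] (b : P.Base) {n : ℕ} (e : Fin n ≃ b.support)

/-! ### Barycentric coordinates of the fundamental alcove -/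

/-- The marks `n₀ = 1` and `nᵢ`, where `α₀ = ∑ nᵢ αᵢ`. -/
noncomputable def mark : Fin (n + 1) → ℝ :=
  Fin.cases 1 fun i => b.toWeightBasis.repr (P.root (highestRoot b)) (e i)

/-- The simple affine roots `a₀ = 1 - α₀` and `aᵢ = αᵢ`. -/
noncomputable def simpleForm : Fin (n + 1) → (N →ᵃ[ℝ] ℝ) :=
  Fin.cases (AffineMap.const ℝ N 1 - (P.toLinearMap (P.root (highestRoot b))).toAffineMap)
    fun i => (P.toLinearMap (P.root (e i))).toAffineMap

/-- The index of the root which is the linear part of a simple affine root. -/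
noncomputable def simpleIndex : Fin (n + 1) → ι :=
  Fin.cases (P.reflectionPerm (highestRoot b) (highestRoot b)) fun i => e i

@[simp] theorem mark_zero : mark b e 0 = 1 := rfl

@[simp] theorem mark_succ (i : Fin n) :
    mark b e i.succ = b.toWeightBasis.repr (P.root (highestRoot b)) (e i) := rfl

@[simp] theorem simpleForm_zero (x : N) :
    simpleForm b e 0 x = 1 - P.toLinearMap (P.root (highestRoot b)) x := rfl

@[simp] theorem simpleForm_succ (i : Fin n) (x : N) :
    simpleForm b e i.succ x = P.toLinearMap (P.root (e i)) x := rfl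

@[simp] theorem alcoveVertex_zero : alcoveVertex b e 0 = 0 := rfl

@[simp] theorem alcoveVertex_succ (i : Fin n) : alcoveVertex b e i.succ =
    (b.toWeightBasis.repr (P.root (highestRoot b)) (e i))⁻¹ • fundamentalCoweight b (e i) := rfl

theorem highestRoot_isPos : b.IsPos (highestRoot b) := by
  let := P.indexNeg
  refine (RootPairing.Base.IsPos.or_neg b (highestRoot b)).elim id fun h => ?_
  apply isPos_of_mem_closure
  have h1 := isHighestRoot_highestRoot b (-highestRoot b)
  have h2 := add_mem h1 (mem_closure_of_isPos b h)
  simpa using h2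

theorem coeff_le_highestRoot (i : ι) (j : b.support) :
    b.toWeightBasis.repr (P.root i) j ≤ b.toWeightBasis.repr (P.root (highestRoot b)) j := by
  have := coeff_nonneg_of_mem_closure b (isHighestRoot_highestRoot b i) j
  simpa using this

theorem mark_pos (i : Fin (n + 1)) : 0 < mark b e i := by
  induction i using Fin.cases with
  | zero => simp
  | succ i =>
    have := coeff_le_highestRoot b (e i) (e i)
    simp only [RootPairing.Base.toWeightBasis_repr_root, Finsupp.single_eq_same] at this
    simp only [mark_succ]
    linarith

theorem toLinearMap_fundamentalCoweight (m : M) (i : b.support) :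
    P.toLinearMap m (fundamentalCoweight b i) = b.toWeightBasis.repr m i := by
  have := P.toLinearMap.flip.apply_symm_toPerfPair_self (b.toWeightBasis.coord i)
  exact LinearMap.congr_fun this m

theorem toLinearMap_eq_sum (m : M) (x : N) : P.toLinearMap m x =
    ∑ i, b.toWeightBasis.repr m (e i) * P.toLinearMap (P.root (e i)) x := by
  conv_lhs => rw [← b.toWeightBasis.sum_repr m]
  rw [← e.sum_comp]
  simp

theorem sum_mark_mul_simpleForm (x : N) : ∑ i, mark b e i * simpleForm b e i x = 1 := by
  rw [Fin.sum_univ_succ]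
  simp only [mark_zero, simpleForm_zero, mark_succ, simpleForm_succ]
  rw [← toLinearMap_eq_sum b e]
  ring

theorem simpleForm_alcoveVertex (i j : Fin (n + 1)) :
    simpleForm b e i (alcoveVertex b e j) = if i = j then (mark b e j)⁻¹ else 0 := by
  induction j using Fin.cases with
  | zero =>
    induction i using Fin.cases with
    | zero => simp
    | succ i => simp
  | succ j =>
    have hj := (mark_pos b e j.succ).ne'
    rw [mark_succ] at hj
    induction i using Fin.cases with
    | zero =>
      simp [toLinearMap_fundamentalCoweight, hj, (Fin.succ_ne_zero j).symm]
    | succ i =>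
      by_cases h : i = j
      · subst h
        simp [toLinearMap_fundamentalCoweight]
      · have h' : e i ≠ e j := fun h' => h (e.injective h')
        simp [toLinearMap_fundamentalCoweight, h, h']

theorem ext_of_forall_simple {x y : N}
    (h : ∀ i, P.toLinearMap (P.root (e i)) x = P.toLinearMap (P.root (e i)) y) : x = y := by
  have : P.toLinearMap.flip x = P.toLinearMap.flip y := by
    ext m
    simp only [LinearMap.flip_apply]
    rw [toLinearMap_eq_sum b e, toLinearMap_eq_sum b e m y]
    simp [h]
  exact P.toLinearMap.flip.toPerfPair.injective this

/-- The numbers `nᵢ aᵢ(x)` are the barycentric coordinates of `x` with respect to the `vᵢ`. -/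
theorem sum_smul_alcoveVertex (x : N) :
    ∑ i, (mark b e i * simpleForm b e i x) • alcoveVertex b e i = x := by
  refine ext_of_forall_simple b e fun j => ?_
  have h : ∀ i, P.toLinearMap (P.root (e j)) (alcoveVertex b e i) =
    if j.succ = i then (mark b e i)⁻¹ else 0 := fun i => simpleForm_alcoveVertex b e j.succ i
  have := (mark_pos b e j.succ).ne'
  simp only [map_sum, map_smul, h, smul_eq_mul, mul_ite, mul_zero, Finset.sum_ite_eq,
    Finset.mem_univ, if_true, simpleForm_succ]
  field_simp

theorem affineMap_apply_eq_sum (f : N →ᵃ[ℝ] ℝ) (x : N) :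
    f x = ∑ i, mark b e i * simpleForm b e i x * f (alcoveVertex b e i) := by
  have hf : ∀ y, f y = f.linear y + f 0 := fun y => by
    simpa using f.map_vadd 0 y
  conv_lhs => rw [hf, ← sum_smul_alcoveVertex b e x]
  rw [map_sum]
  simp_rw [hf (alcoveVertex b e _), mul_add, Finset.sum_add_distrib, ← Finset.sum_mul,
    sum_mark_mul_simpleForm, map_smul, one_mul, smul_eq_mul]

/-- The barycentre of the fundamental alcove. -/
noncomputable def alcoveCenter : N := ((n : ℝ) + 1)⁻¹ • ∑ i, alcoveVertex b e i

theorem affineMap_alcoveCenter (f : N →ᵃ[ℝ] ℝ) :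
    f (alcoveCenter b e) = ((n : ℝ) + 1)⁻¹ * ∑ i, f (alcoveVertex b e i) := by
  have hf : ∀ y, f y = f.linear y + f 0 := fun y => by
    simpa using f.map_vadd 0 y
  have hn : (n : ℝ) + 1 ≠ 0 := by positivity
  rw [hf, alcoveCenter]
  simp_rw [hf (alcoveVertex b e _), Finset.sum_add_distrib, map_smul, map_sum]
  simp only [smul_eq_mul, Finset.sum_const, Finset.card_univ, Fintype.card_fin, nsmul_eq_mul,
    Nat.cast_add, Nat.cast_one]
  field_simp

theorem simpleForm_alcoveCenter_pos (i : Fin (n + 1)) :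
    0 < simpleForm b e i (alcoveCenter b e) := by
  rw [affineMap_alcoveCenter]
  have := mark_pos b e i
  simp only [simpleForm_alcoveVertex, Finset.sum_ite_eq, Finset.mem_univ, if_true]
  positivity

/-! ### Affine roots -/

/-- An affine root is a function `α + k` with `α` a root and `k` an integer. -/
def IsAffineRoot (P : RootPairing ι ℝ M N) (f : N →ᵃ[ℝ] ℝ) : Prop :=
  ∃ (i : ι) (k : ℤ), ∀ x, f x = P.toLinearMap (P.root i) x + k

theorem IsAffineRoot.neg {f : N →ᵃ[ℝ] ℝ} (hf : IsAffineRoot P f) : IsAffineRoot P (-f) := by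
  obtain ⟨i, k, h⟩ := hf
  let := P.indexNeg
  exact ⟨-i, -k, fun x => by simp [h]; ring⟩

theorem simpleForm_apply (i : Fin (n + 1)) (x : N) : simpleForm b e i x =
    P.toLinearMap (P.root (simpleIndex b e i)) x + (if i = 0 then 1 else 0 : ℤ) := by
  induction i using Fin.cases with
  | zero => simp [simpleIndex]; ring
  | succ i => simp [simpleIndex]

theorem isAffineRoot_simpleForm (i : Fin (n + 1)) : IsAffineRoot P (simpleForm b e i) :=
  ⟨_, _, simpleForm_apply b e i⟩

/-- The value of a positive root at `vⱼ`, `j ≥ 1`, is the quotient of its coefficient at `αⱼ` by that of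
the highest root. -/
theorem root_alcoveVertex_mem {i : ι} (hi : b.IsPos i) (j : Fin (n + 1)) :
    P.toLinearMap (P.root i) (alcoveVertex b e j) ∈ Icc 0 1 := by
  induction j using Fin.cases with
  | zero => simp
  | succ j =>
    have h0 := mark_pos b e j.succ
    have h1 := coeff_nonneg_of_mem_closure b (mem_closure_of_isPos b hi) (e j)
    have h2 := coeff_le_highestRoot b i (e j)
    rw [mark_succ] at h0
    simp only [alcoveVertex_succ, map_smul, toLinearMap_fundamentalCoweight, smul_eq_mul, mem_Icc]
    constructor
    · positivity
    · rw [inv_mul_le_iff₀ h0]; simpa using h2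

/-- An affine root has constant sign on the closed fundamental alcove. -/
theorem IsAffineRoot.nonneg_or_nonpos {f : N →ᵃ[ℝ] ℝ} (hf : IsAffineRoot P f) :
    (∀ j, 0 ≤ f (alcoveVertex b e j)) ∨ ∀ j, f (alcoveVertex b e j) ≤ 0 := by
  have key : ∀ f : N →ᵃ[ℝ] ℝ, ∀ (i : ι) (k : ℤ), b.IsPos i →
      (∀ x, f x = P.toLinearMap (P.root i) x + k) →
      (∀ j, 0 ≤ f (alcoveVertex b e j)) ∨ ∀ j, f (alcoveVertex b e j) ≤ 0 := by
    intro f i k hi h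
    rcases le_or_gt 0 k with hk | hk
    · left
      intro j
      have h1 := (root_alcoveVertex_mem b e hi j).1
      have h2 : (0 : ℝ) ≤ k := by exact_mod_cast hk
      rw [h]; linarith
    · right
      intro j
      have h1 := (root_alcoveVertex_mem b e hi j).2
      have h2 : (k : ℝ) ≤ -1 := by exact_mod_cast Int.le_sub_one_of_lt hk
      rw [h]; linarith
  obtain ⟨i, k, h⟩ := hf
  let := P.indexNeg
  rcases RootPairing.Base.IsPos.or_neg b i with hi | hi
  · exact key f i k hi h
  · have := key (-f) (-i) (-k) hi (fun x => by simp [h]; ring)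
    simp only [AffineMap.coe_neg, Pi.neg_apply] at this
    rcases this with h1 | h1
    · exact Or.inr fun j => by have := h1 j; linarith
    · exact Or.inl fun j => by have := h1 j; linarith

theorem IsAffineRoot.exists_vertex_ne {f : N →ᵃ[ℝ] ℝ} (hf : IsAffineRoot P f) :
    ∃ j, f (alcoveVertex b e j) ≠ 0 := by
  by_contra! h
  obtain ⟨i, k, hf⟩ := hf
  have h0 : ∀ x, f x = 0 := fun x => by rw [affineMap_apply_eq_sum b e]; simp [h]
  have hk : (k : ℝ) = 0 := by rw [← h0 0, hf]; simp
  have h2 : P.toLinearMap (P.root i) (P.coroot i) = 0 := by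
    have := hf (P.coroot i)
    rw [h0, hk] at this; linarith
  rw [P.root_coroot_eq_pairing, P.pairing_same] at h2
  norm_num at h2

theorem IsAffineRoot.pos_of_vertex {f : N →ᵃ[ℝ] ℝ} (hf : IsAffineRoot P f) {j : Fin (n + 1)}
    (hj : 0 < f (alcoveVertex b e j)) : 0 < f (alcoveCenter b e) := by
  have h := (hf.nonneg_or_nonpos b e).resolve_right fun h => (h j).not_gt hj
  rw [affineMap_alcoveCenter]
  have : 0 < ∑ i, f (alcoveVertex b e i) :=
    Finset.sum_pos' (fun i _ => h i) ⟨j, Finset.mem_univ _, hj⟩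
  positivity

theorem IsAffineRoot.neg_of_vertex {f : N →ᵃ[ℝ] ℝ} (hf : IsAffineRoot P f) {j : Fin (n + 1)}
    (hj : f (alcoveVertex b e j) < 0) : f (alcoveCenter b e) < 0 := by
  have := hf.neg.pos_of_vertex b e (j := j) (by simpa using hj)
  simpa using this

/-- No affine root vanishes at the centre of `A₀`, so each is either positive or negative on `A₀`. -/
theorem IsAffineRoot.center_ne {f : N →ᵃ[ℝ] ℝ} (hf : IsAffineRoot P f) :
    f (alcoveCenter b e) ≠ 0 := by
  obtain ⟨j, hj⟩ := hf.exists_vertex_ne b e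
  rcases lt_or_gt_of_ne hj with h | h
  · exact (hf.neg_of_vertex b e h).ne
  · exact (hf.pos_of_vertex b e h).ne'

theorem IsAffineRoot.vertex_nonneg {f : N →ᵃ[ℝ] ℝ} (hf : IsAffineRoot P f)
    (h : 0 < f (alcoveCenter b e)) (j : Fin (n + 1)) : 0 ≤ f (alcoveVertex b e j) :=
  not_lt.1 fun h' => (hf.neg_of_vertex b e h').not_gt h

theorem IsAffineRoot.vertex_nonpos {f : N →ᵃ[ℝ] ℝ} (hf : IsAffineRoot P f)
    (h : f (alcoveCenter b e) < 0) (j : Fin (n + 1)) : f (alcoveVertex b e j) ≤ 0 :=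
  not_lt.1 fun h' => (hf.pos_of_vertex b e h').not_gt h

/-- A negative affine root is nonpositive on the closed fundamental alcove. -/
theorem IsAffineRoot.nonpos {f : N →ᵃ[ℝ] ℝ} (hf : IsAffineRoot P f)
    (h : f (alcoveCenter b e) < 0) {x : N} (hx : ∀ i, 0 ≤ simpleForm b e i x) : f x ≤ 0 := by
  rw [affineMap_apply_eq_sum b e]
  exact Finset.sum_nonpos fun i _ => mul_nonpos_of_nonneg_of_nonpos
    (mul_nonneg (mark_pos b e i).le (hx i)) (hf.vertex_nonpos b e h i)

/-- As the root system is reduced, affine roots which are positive multiples of each other agree. -/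
theorem IsAffineRoot.eq_of_smul {f g : N →ᵃ[ℝ] ℝ} (hf : IsAffineRoot P f)
    (hg : IsAffineRoot P g) {c : ℝ} (hc : 0 < c) (h : ∀ x, f x = c * g x) : f = g := by
  obtain ⟨i, k, hi⟩ := hf
  obtain ⟨j, l, hj⟩ := hg
  have hkl : (k : ℝ) = c * l := by
    have := h 0
    simpa [hi, hj] using this
  have hroot : P.root i = c • P.root j := by
    apply P.toLinearMap.toPerfPair.injective
    ext x
    have := h x
    rw [hi, hj, hkl] at this
    simp only [map_smul, LinearMap.smul_apply, smul_eq_mul, LinearMap.toPerfPair_apply]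
    linarith
  have hdep : ¬ LinearIndependent ℝ ![P.root i, P.root j] := by
    rw [LinearIndependent.pair_iff]
    intro hli
    have := hli 1 (-c) (by simp [hroot])
    simp at this
  have hc1 : c = 1 := by
    by_cases hij : i = j
    · subst hij
      have : (c - 1) • P.root i = 0 := by rw [sub_smul, ← hroot]; simp
      rcases smul_eq_zero.1 this with h | h
      · linarith
      · exact absurd h (P.ne_zero i)
    · rcases RootPairing.IsReduced.eq_or_eq_neg i j hdep with h1 | h1
      · exact absurd (P.root.injective h1) hij
      · have : (c + 1) • P.root j = 0 := by rw [add_smul, ← hroot, h1]; simp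
        rcases smul_eq_zero.1 this with h | h
        · linarith
        · exact absurd h (P.ne_zero j)
  ext x
  rw [h, hc1, one_mul]

/-! ### Words and affine reflections -/

theorem simpleReflection_apply (i : Fin (n + 1)) (x : N) :
    (simpleReflection b e i : N ≃ᵃ[ℝ] N) x =
      x - simpleForm b e i x • P.coroot (simpleIndex b e i) := by
  induction i using Fin.cases with
  | zero =>
    have h1 : P.coroot (simpleIndex b e 0) = -P.coroot (highestRoot b) := by
      change P.coroot (P.reflectionPerm _ _) = _
      rw [P.coroot_reflectionPerm, P.coreflection_apply_self]
    have h2 : (simpleReflection b e 0 : N ≃ᵃ[ℝ] N) x = P.coroot (highestRoot b) +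
      (x - P.toLinearMap (P.root (highestRoot b)) x • P.coroot (highestRoot b)) := rfl
    rw [h1, h2, simpleForm_zero]
    module
  | succ i =>
    simp [simpleReflection, affineReflection, simpleIndex, RootPairing.coreflection_apply]

theorem simpleForm_simpleReflection (i : Fin (n + 1)) (x : N) :
    simpleForm b e i ((simpleReflection b e i : N ≃ᵃ[ℝ] N) x) = -simpleForm b e i x := by
  rw [simpleReflection_apply, simpleForm_apply, simpleForm_apply]
  simp
  ring

theorem simpleReflection_apply_of_eq_zero {i : Fin (n + 1)} {x : N}
    (h : simpleForm b e i x = 0) : (simpleReflection b e i : N ≃ᵃ[ℝ] N) x = x := by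
  simp [simpleReflection_apply, h]

theorem simpleReflection_mul_self (i : Fin (n + 1)) :
    simpleReflection b e i * simpleReflection b e i = 1 := by
  apply Subtype.ext
  ext x
  change (simpleReflection b e i : N ≃ᵃ[ℝ] N) ((simpleReflection b e i : N ≃ᵃ[ℝ] N) x) = x
  rw [simpleReflection_apply b e i (_), simpleForm_simpleReflection, simpleReflection_apply]
  simp

@[simp] theorem simpleReflection_mul_cancel_left (i : Fin (n + 1)) (w : affineWeylGroup b e) :
    simpleReflection b e i * (simpleReflection b e i * w) = w := by
  rw [← mul_assoc, simpleReflection_mul_self, one_mul]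

theorem simpleReflection_inv (i : Fin (n + 1)) :
    (simpleReflection b e i)⁻¹ = simpleReflection b e i :=
  inv_eq_of_mul_eq_one_left (simpleReflection_mul_self b e i)

/-- The element of `W_a` given by a word in the simple reflections. -/
noncomputable def wordProd (l : List (Fin (n + 1))) : affineWeylGroup b e :=
  (l.map (simpleReflection b e)).prod

@[simp] theorem wordProd_nil : wordProd b e [] = 1 := rfl

@[simp] theorem wordProd_cons (i : Fin (n + 1)) (l : List (Fin (n + 1))) :
    wordProd b e (i :: l) = simpleReflection b e i * wordProd b e l := by simp [wordProd]

@[simp] theorem wordProd_append (l l' : List (Fin (n + 1))) :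
    wordProd b e (l ++ l') = wordProd b e l * wordProd b e l' := by simp [wordProd]

theorem wordProd_inv (l : List (Fin (n + 1))) :
    (wordProd b e l)⁻¹ = wordProd b e l.reverse := by
  induction l with
  | nil => simp
  | cons i l ih => simp [ih, simpleReflection_inv]

theorem parabolic_induction {I : Finset (Fin (n + 1))} {p : affineWeylGroup b e → Prop}
    (one : p 1) (mul : ∀ i ∈ I, ∀ w ∈ parabolic b e I, p w → p (simpleReflection b e i * w))
    {w : affineWeylGroup b e} (hw : w ∈ parabolic b e I) : p w := by
  refine Subgroup.closure_induction_left (p := fun w _ => p w) one ?_ ?_ hw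
  · rintro _ ⟨i, hi, rfl⟩ y hy h
    exact mul i hi y hy h
  · rintro _ ⟨i, hi, rfl⟩ y hy h
    rw [simpleReflection_inv]
    exact mul i hi y hy h

theorem simpleReflection_mem_parabolic {I : Finset (Fin (n + 1))} {i : Fin (n + 1)} (hi : i ∈ I) :
    simpleReflection b e i ∈ parabolic b e I :=
  Subgroup.subset_closure (mem_image_of_mem _ hi)

theorem parabolic_mono {I J : Finset (Fin (n + 1))} (h : I ⊆ J) :
    parabolic b e I ≤ parabolic b e J :=
  Subgroup.closure_mono (image_mono h)

theorem mem_parabolic_univ (w : affineWeylGroup b e) : w ∈ parabolic b e Finset.univ := by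
  obtain ⟨w, hw⟩ := w
  refine Subgroup.closure_induction (p := fun w hw => (⟨w, hw⟩ : affineWeylGroup b e) ∈
    parabolic b e Finset.univ) ?_ (one_mem _) ?_ ?_ hw
  · rintro _ ⟨i, rfl⟩
    exact simpleReflection_mem_parabolic b e (Finset.mem_univ i)
  · intro x y _ _ h1 h2
    exact mul_mem h1 h2
  · intro x _ h
    exact inv_mem h

theorem weyl_induction {p : affineWeylGroup b e → Prop} (one : p 1)
    (mul : ∀ i w, p w → p (simpleReflection b e i * w)) (w : affineWeylGroup b e) : p w :=
  parabolic_induction b e one (fun i _ w _ => mul i w) (mem_parabolic_univ b e w)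

theorem exists_wordProd_eq (w : affineWeylGroup b e) : ∃ l, wordProd b e l = w := by
  induction w using weyl_induction b e with
  | one => exact ⟨[], rfl⟩
  | mul i w h =>
    obtain ⟨l, rfl⟩ := h
    exact ⟨i :: l, by simp⟩

theorem exists_reduced (w : affineWeylGroup b e) :
    ∃ l, l.length = len b e w ∧ wordProd b e l = w := by
  have : {m | ∃ l : List (Fin (n + 1)), l.length = m ∧ wordProd b e l = w}.Nonempty := by
    obtain ⟨l, hl⟩ := exists_wordProd_eq b e w
    exact ⟨_, l, rfl, hl⟩
  exact Nat.sInf_mem this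

theorem len_wordProd_le (l : List (Fin (n + 1))) : len b e (wordProd b e l) ≤ l.length :=
  Nat.sInf_le ⟨l, rfl, rfl⟩

theorem len_one : len b e 1 = 0 := Nat.le_zero.1 (len_wordProd_le b e [])

theorem eq_one_of_len_eq_zero {w : affineWeylGroup b e} (h : len b e w = 0) : w = 1 := by
  obtain ⟨l, hl, rfl⟩ := exists_reduced b e w
  rw [h, List.length_eq_zero_iff] at hl
  simp [hl]

theorem len_inv (w : affineWeylGroup b e) : len b e w⁻¹ = len b e w := by
  have key : ∀ w, len b e w⁻¹ ≤ len b e w := fun w => by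
    obtain ⟨l, hl, rfl⟩ := exists_reduced b e w
    rw [wordProd_inv, ← hl]
    simpa using len_wordProd_le b e l.reverse
  refine le_antisymm (key w) ?_
  simpa using key w⁻¹

theorem len_simple_mul_le (i : Fin (n + 1)) (w : affineWeylGroup b e) :
    len b e (simpleReflection b e i * w) ≤ len b e w + 1 := by
  obtain ⟨l, hl, rfl⟩ := exists_reduced b e w
  rw [← hl]
  simpa using len_wordProd_le b e (i :: l)

theorem le_len_simple_mul (i : Fin (n + 1)) (w : affineWeylGroup b e) :
    len b e w ≤ len b e (simpleReflection b e i * w) + 1 := by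
  simpa using len_simple_mul_le b e i (simpleReflection b e i * w)

/-! ### The action on affine roots -/

theorem IsAffineRoot.comp_simpleReflection {f : N →ᵃ[ℝ] ℝ} (hf : IsAffineRoot P f)
    (i : Fin (n + 1)) :
    IsAffineRoot P (f.comp (simpleReflection b e i : N ≃ᵃ[ℝ] N).toAffineMap) := by
  obtain ⟨j, k, h⟩ := hf
  refine ⟨P.reflectionPerm (simpleIndex b e i) j,
    k - (if i = 0 then 1 else 0) * P.pairingIn ℤ j (simpleIndex b e i), fun x => ?_⟩
  have h1 : (P.pairingIn ℤ j (simpleIndex b e i) : ℝ) = P.pairing j (simpleIndex b e i) := by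
    simpa using P.algebraMap_pairingIn ℤ j (simpleIndex b e i)
  simp only [AffineMap.coe_comp, Function.comp_apply, AffineEquiv.coe_toAffineMap, h,
    simpleReflection_apply, simpleForm_apply, map_sub, map_smul, P.root_coroot_eq_pairing,
    smul_eq_mul, P.root_reflectionPerm, P.reflection_apply_root, LinearMap.sub_apply,
    LinearMap.smul_apply]
  push_cast
  rw [h1]
  ring

/-- The composite of an affine function and an element of `W_a`. -/
noncomputable def pullback (w : affineWeylGroup b e) (f : N →ᵃ[ℝ] ℝ) : N →ᵃ[ℝ] ℝ :=
  f.comp (w : N ≃ᵃ[ℝ] N).toAffineMap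

@[simp] theorem pullback_apply (w : affineWeylGroup b e) (f : N →ᵃ[ℝ] ℝ) (x : N) :
    pullback b e w f x = f ((w : N ≃ᵃ[ℝ] N) x) := rfl

@[simp] theorem mul_apply (w w' : affineWeylGroup b e) (x : N) :
    ((w * w' : affineWeylGroup b e) : N ≃ᵃ[ℝ] N) x = (w : N ≃ᵃ[ℝ] N) ((w' : N ≃ᵃ[ℝ] N) x) := rfl

@[simp] theorem one_apply (x : N) : ((1 : affineWeylGroup b e) : N ≃ᵃ[ℝ] N) x = x := rfl

theorem IsAffineRoot.pullback {f : N →ᵃ[ℝ] ℝ} (hf : IsAffineRoot P f) (w : affineWeylGroup b e) :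
    IsAffineRoot P (pullback b e w f) := by
  induction w using weyl_induction b e generalizing f with
  | one => exact hf
  | mul i w h => exact h (hf.comp_simpleReflection b e i)

/-- A simple reflection permutes the positive affine roots other than its own simple root. -/
theorem IsAffineRoot.eq_simpleForm {f : N →ᵃ[ℝ] ℝ} (hf : IsAffineRoot P f) {i : Fin (n + 1)}
    (h1 : 0 < f (alcoveCenter b e))
    (h2 : f ((simpleReflection b e i : N ≃ᵃ[ℝ] N) (alcoveCenter b e)) < 0) :
    f = simpleForm b e i := by
  have hv : ∀ j, j ≠ i → f (alcoveVertex b e j) = 0 := by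
    intro j hj
    have h3 := (hf.comp_simpleReflection b e i).vertex_nonpos b e h2 j
    have h4 : (simpleReflection b e i : N ≃ᵃ[ℝ] N) (alcoveVertex b e j) = alcoveVertex b e j :=
      simpleReflection_apply_of_eq_zero b e (by rw [simpleForm_alcoveVertex, if_neg hj.symm])
    simp only [AffineMap.coe_comp, Function.comp_apply, AffineEquiv.coe_toAffineMap, h4] at h3
    exact le_antisymm h3 (hf.vertex_nonneg b e h1 j)
  have hsum : ∀ x, f x = mark b e i * f (alcoveVertex b e i) * simpleForm b e i x := by
    intro x
    rw [affineMap_apply_eq_sum b e, Finset.sum_eq_single i]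
    · ring
    · intro j _ hj; rw [hv j hj, mul_zero]
    · simp
  have hpos : 0 < f (alcoveVertex b e i) := by
    refine lt_of_le_of_ne (hf.vertex_nonneg b e h1 i) fun h => ?_
    rw [hsum, ← h] at h1
    simp at h1
  exact hf.eq_of_smul (isAffineRoot_simpleForm b e i) (mul_pos (mark_pos b e i) hpos) hsum

/-- The linear part of an element of `W_a` permutes roots and coroots compatibly. -/
theorem exists_root_linear (w : affineWeylGroup b e) (k : ι) :
    ∃ l, (∀ x, P.toLinearMap (P.root l) ((w : N ≃ᵃ[ℝ] N).linear x) = P.toLinearMap (P.root k) x) ∧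
      (w : N ≃ᵃ[ℝ] N).linear (P.coroot k) = P.coroot l := by
  have hs : ∀ i, ∀ x, (simpleReflection b e i : N ≃ᵃ[ℝ] N).linear x =
      P.coreflection (simpleIndex b e i) x := by
    intro i x
    have h := (simpleReflection b e i : N ≃ᵃ[ℝ] N).map_vadd 0 x
    simp only [vadd_eq_add, add_zero, simpleReflection_apply, simpleForm_apply] at h
    simp only [map_zero, zero_add, zero_sub, ← sub_eq_add_neg] at h
    rw [RootPairing.coreflection_apply, ← eq_sub_iff_add_eq.1 h, RootPairing.root']
    module
  induction w using weyl_induction b e with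
  | one => exact ⟨k, fun x => rfl, rfl⟩
  | mul i w h =>
    obtain ⟨l, h1, h2⟩ := h
    have hm : ∀ x, ((simpleReflection b e i * w : affineWeylGroup b e) : N ≃ᵃ[ℝ] N).linear x =
      (simpleReflection b e i : N ≃ᵃ[ℝ] N).linear ((w : N ≃ᵃ[ℝ] N).linear x) := fun x => rfl
    refine ⟨P.reflectionPerm (simpleIndex b e i) l, fun x => ?_, ?_⟩
    · rw [hm, hs, ← h1, P.root_reflectionPerm, P.reflection_apply_root, P.coreflection_apply]
      simp only [map_sub, LinearMap.sub_apply, map_smul, LinearMap.smul_apply, smul_eq_mul,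
        P.root_coroot_eq_pairing, P.pairing_same, RootPairing.root']
      ring
    · rw [hm, hs, h2, P.coroot_reflectionPerm]

/-- A reflection in `W_a` is determined by its affine root. -/
theorem mul_simpleReflection_of_pullback_eq {w : affineWeylGroup b e} {i j : Fin (n + 1)}
    (h : pullback b e w (simpleForm b e i) = simpleForm b e j) :
    w * simpleReflection b e j = simpleReflection b e i * w := by
  obtain ⟨l, h1, h2⟩ := exists_root_linear b e w (simpleIndex b e j)
  have h3 : ∀ x, simpleForm b e i ((w : N ≃ᵃ[ℝ] N) x) = simpleForm b e j x :=
    fun x => DFunLike.congr_fun h x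
  have hw : ∀ x y, (w : N ≃ᵃ[ℝ] N) (x + y) = (w : N ≃ᵃ[ℝ] N).linear x + (w : N ≃ᵃ[ℝ] N) y :=
    fun x y => (w : N ≃ᵃ[ℝ] N).map_vadd y x
  have hl : l = simpleIndex b e i := by
    apply P.root.injective
    apply P.toLinearMap.toPerfPair.injective
    ext y
    obtain ⟨x, rfl⟩ := (w : N ≃ᵃ[ℝ] N).linear.surjective y
    have h4 := h3 x
    have h5 := h3 0
    rw [← add_zero x, hw, simpleForm_apply, simpleForm_apply] at h4
    rw [simpleForm_apply, simpleForm_apply] at h5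
    simp only [map_add, map_zero, add_zero] at h4 h5
    simp only [LinearMap.toPerfPair_apply, h1]
    linarith
  subst hl
  apply Subtype.ext
  ext x
  change (w : N ≃ᵃ[ℝ] N) ((simpleReflection b e j : N ≃ᵃ[ℝ] N) x) =
    (simpleReflection b e i : N ≃ᵃ[ℝ] N) ((w : N ≃ᵃ[ℝ] N) x)
  rw [simpleReflection_apply, simpleReflection_apply, h3, sub_eq_neg_add, hw, map_neg, map_smul, h2]
  abel

/-! ### The exchange condition and lengths -/

/-- The exchange condition: the sign of `aᵢ` changes somewhere along the gallery of a word, and at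
that place a letter can be deleted. -/
theorem exchange (l : List (Fin (n + 1))) (i : Fin (n + 1))
    (h : simpleForm b e i ((wordProd b e l : N ≃ᵃ[ℝ] N) (alcoveCenter b e)) < 0) :
    ∃ l' : List (Fin (n + 1)), l'.length + 1 = l.length ∧
      wordProd b e l' = simpleReflection b e i * wordProd b e l := by
  induction l using List.reverseRecOn with
  | nil => exact absurd h (simpleForm_alcoveCenter_pos b e i).not_gt
  | append_singleton l j ih =>
    have hroot := (isAffineRoot_simpleForm b e i).pullback b e (wordProd b e l)
    rcases lt_or_gt_of_ne (hroot.center_ne b e) with hl | hl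
    · obtain ⟨l', h1, h2⟩ := ih hl
      exact ⟨l' ++ [j], by simpa using h1, by simp [h2, mul_assoc]⟩
    -- The sign changes at the last letter `j`, so `aᵢ` is carried to `aⱼ`, and `sᵢ` cancels that letter.
    · have h1 := hroot.eq_simpleForm b e (i := j) hl (by simpa using h)
      have h2 := mul_simpleReflection_of_pullback_eq b e h1
      refine ⟨l, by simp, ?_⟩
      simp only [wordProd_append, wordProd_cons, wordProd_nil, mul_one]
      rw [h2, simpleReflection_mul_cancel_left]

/-- `w A₀` lies on the side of `A₀` of the wall `Hᵢ`. -/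
def SameSide (i : Fin (n + 1)) (w : affineWeylGroup b e) : Prop :=
  0 < simpleForm b e i ((w : N ≃ᵃ[ℝ] N) (alcoveCenter b e))

theorem not_sameSide {i : Fin (n + 1)} {w : affineWeylGroup b e} (h : ¬ SameSide b e i w) :
    simpleForm b e i ((w : N ≃ᵃ[ℝ] N) (alcoveCenter b e)) < 0 :=
  lt_of_le_of_ne (not_lt.1 h) (((isAffineRoot_simpleForm b e i).pullback b e w).center_ne b e)

theorem sameSide_simple_mul {i : Fin (n + 1)} {w : affineWeylGroup b e} :
    SameSide b e i (simpleReflection b e i * w) ↔ ¬ SameSide b e i w := by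
  have key : ∀ w, SameSide b e i (simpleReflection b e i * w) ↔
      simpleForm b e i ((w : N ≃ᵃ[ℝ] N) (alcoveCenter b e)) < 0 := fun w => by
    rw [SameSide, mul_apply, simpleForm_simpleReflection, neg_pos]
  rw [key]
  exact ⟨fun h h' => lt_asymm h h', not_sameSide b e⟩

theorem len_simple_mul_of_not_sameSide {i : Fin (n + 1)} {w : affineWeylGroup b e}
    (h : ¬ SameSide b e i w) : len b e (simpleReflection b e i * w) + 1 = len b e w := by
  obtain ⟨l, hl, rfl⟩ := exists_reduced b e w
  obtain ⟨l', h1, h2⟩ := exchange b e l i (not_sameSide b e h)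
  have h3 := le_len_simple_mul b e i (wordProd b e l)
  have h4 := len_wordProd_le b e l'
  rw [h2] at h4
  omega

theorem len_simple_mul_of_sameSide {i : Fin (n + 1)} {w : affineWeylGroup b e}
    (h : SameSide b e i w) : len b e (simpleReflection b e i * w) = len b e w + 1 := by
  have := len_simple_mul_of_not_sameSide b e (i := i) (w := simpleReflection b e i * w)
    (by rw [sameSide_simple_mul]; exact not_not.2 h)
  rw [simpleReflection_mul_cancel_left] at this
  exact this.symm

theorem len_lt_simple_mul_iff {i : Fin (n + 1)} {w : affineWeylGroup b e} :
    len b e w < len b e (simpleReflection b e i * w) ↔ SameSide b e i w := by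
  constructor
  · intro h
    by_contra h'
    have := len_simple_mul_of_not_sameSide b e h'
    omega
  · intro h
    rw [len_simple_mul_of_sameSide b e h]; omega

theorem mem_minRight_iff {I : Finset (Fin (n + 1))} {w : affineWeylGroup b e} :
    w ∈ minRight b e I ↔ ∀ i ∈ I, SameSide b e i w :=
  forall₂_congr fun _ _ => len_lt_simple_mul_iff b e

/-- `W_a` acts freely on the alcoves. -/
theorem eq_one_of_forall_sameSide {w : affineWeylGroup b e} (h : ∀ i, SameSide b e i w) :
    w = 1 := by
  obtain ⟨l, hl, rfl⟩ := exists_reduced b e w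
  cases l with
  | nil => rfl
  | cons i l =>
    have h1 := len_simple_mul_of_sameSide b e (h i)
    have h2 := len_wordProd_le b e l
    simp only [wordProd_cons, simpleReflection_mul_cancel_left, List.length_cons] at h1 hl
    omega

theorem mem_minLeft_iff {I : Finset (Fin (n + 1))} {w : affineWeylGroup b e} :
    w ∈ minLeft b e I ↔ w⁻¹ ∈ minRight b e I := by
  refine forall₂_congr fun i _ => ?_
  rw [len_inv, ← len_inv b e (w * _), mul_inv_rev, simpleReflection_inv]

/-! ### Parabolic subgroups and minimal length representatives -/

theorem parabolic_apply_of_eq_zero {I : Finset (Fin (n + 1))} {x : N}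
    (hx : ∀ i ∈ I, simpleForm b e i x = 0) {u : affineWeylGroup b e} (hu : u ∈ parabolic b e I) :
    (u : N ≃ᵃ[ℝ] N) x = x := by
  refine parabolic_induction b e (p := fun u => (u : N ≃ᵃ[ℝ] N) x = x) rfl ?_ hu
  intro i hi w _ h
  rw [mul_apply, h, simpleReflection_apply_of_eq_zero b e (hx i hi)]

theorem simpleForm_alcoveVertex_of_mem {I : Finset (Fin (n + 1))} {j : Fin (n + 1)} (hj : j ∉ I) :
    ∀ i ∈ I, simpleForm b e i (alcoveVertex b e j) = 0 := fun i hi => by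
  rw [simpleForm_alcoveVertex, if_neg]
  rintro rfl
  exact hj hi

theorem parabolic_apply_vertex {I : Finset (Fin (n + 1))} {j : Fin (n + 1)} (hj : j ∉ I)
    {u : affineWeylGroup b e} (hu : u ∈ parabolic b e I) :
    (u : N ≃ᵃ[ℝ] N) (alcoveVertex b e j) = alcoveVertex b e j :=
  parabolic_apply_of_eq_zero b e (simpleForm_alcoveVertex_of_mem b e hj) hu

theorem sameSide_of_apply_vertex {j : Fin (n + 1)} {w : affineWeylGroup b e}
    (h : (w : N ≃ᵃ[ℝ] N) (alcoveVertex b e j) = alcoveVertex b e j) : SameSide b e j w := by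
  refine ((isAffineRoot_simpleForm b e j).pullback b e w).pos_of_vertex b e (j := j) ?_
  rw [pullback_apply, h, simpleForm_alcoveVertex, if_pos rfl]
  exact inv_pos.2 (mark_pos b e j)

/-- Elements of `(W_a)_I` are not shortened by simple reflections outside `I`. -/
theorem sameSide_of_notMem {I : Finset (Fin (n + 1))} {j : Fin (n + 1)} (hj : j ∉ I)
    {u : affineWeylGroup b e} (hu : u ∈ parabolic b e I) : SameSide b e j u :=
  sameSide_of_apply_vertex b e (parabolic_apply_vertex b e hj hu)

/-- The sign of an affine root vanishing on the face `f_I` is the same on all alcoves that lie on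
the side of `A₀` of all walls `Hᵢ`, `i ∈ I`. -/
theorem sameSide_mul_iff {I : Finset (Fin (n + 1))} {i : Fin (n + 1)} (hi : i ∈ I)
    {u w : affineWeylGroup b e} (hu : u ∈ parabolic b e I) (hw : w ∈ minRight b e I) :
    SameSide b e i (u * w) ↔ SameSide b e i u := by
  have hf := (isAffineRoot_simpleForm b e i).pullback b e u
  have hfw := hf.pullback b e w
  have h0 : ∀ j ∉ I, pullback b e u (simpleForm b e i) (alcoveVertex b e j) = 0 := by
    intro j hj
    rw [pullback_apply, parabolic_apply_vertex b e hj hu]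
    exact simpleForm_alcoveVertex_of_mem b e hj i hi
  rw [mem_minRight_iff] at hw
  constructor
  · intro h
    by_contra h'
    refine (show (0 : ℝ) < _ from h).not_ge ?_
    rw [mul_apply, ← pullback_apply, affineMap_apply_eq_sum b e]
    refine Finset.sum_nonpos fun j _ => ?_
    by_cases hj : j ∈ I
    · exact mul_nonpos_of_nonneg_of_nonpos (mul_nonneg (mark_pos b e j).le (hw j hj).le)
        (hf.vertex_nonpos b e (not_sameSide b e h') j)
    · rw [h0 j hj, mul_zero]
  · intro h
    refine lt_of_le_of_ne ?_ (hfw.center_ne b e).symm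
    rw [mul_apply, ← pullback_apply b e u, affineMap_apply_eq_sum b e]
    refine Finset.sum_nonneg fun j _ => ?_
    by_cases hj : j ∈ I
    · exact mul_nonneg (mul_nonneg (mark_pos b e j).le (hw j hj).le) (hf.vertex_nonneg b e h j)
    · rw [h0 j hj, mul_zero]

theorem exists_not_sameSide {I : Finset (Fin (n + 1))} {u : affineWeylGroup b e}
    (hu : u ∈ parabolic b e I) (h1 : u ≠ 1) : ∃ i ∈ I, ¬ SameSide b e i u := by
  by_contra! h
  refine h1 (eq_one_of_forall_sameSide b e fun i => ?_)
  by_cases hi : i ∈ I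
  · exact h i hi
  · exact sameSide_of_notMem b e hi hu

/-- Lengths add for the product of an element of `(W_a)_I` and a minimal representative. -/
theorem len_mul {I : Finset (Fin (n + 1))} {u w : affineWeylGroup b e}
    (hu : u ∈ parabolic b e I) (hw : w ∈ minRight b e I) :
    len b e (u * w) = len b e u + len b e w := by
  induction hm : len b e u generalizing u with
  | zero => simp [eq_one_of_len_eq_zero b e hm]
  | succ m ih =>
    have h1 : u ≠ 1 := by
      rintro rfl
      rw [len_one] at hm
      omega
    obtain ⟨i, hi, h⟩ := exists_not_sameSide b e hu h1
    have h2 := len_simple_mul_of_not_sameSide b e h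
    have h3 := len_simple_mul_of_not_sameSide b e
      (mt (sameSide_mul_iff b e hi hu hw).1 h)
    have h4 := ih (mul_mem (simpleReflection_mem_parabolic b e hi) hu) (by omega)
    rw [mul_assoc] at h4
    omega

theorem mul_mem_minRight {I J : Finset (Fin (n + 1))} (hJ : J ⊆ I) {x w : affineWeylGroup b e}
    (hx : x ∈ parabolic b e I) (hx' : x ∈ minRight b e J) (hw : w ∈ minRight b e I) :
    x * w ∈ minRight b e J := by
  rw [mem_minRight_iff] at hx' ⊢
  exact fun j hj => (sameSide_mul_iff b e (hJ hj) hx hw).2 (hx' j hj)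

theorem exists_mul_mem_minRight (I : Finset (Fin (n + 1))) (w : affineWeylGroup b e) :
    ∃ u ∈ parabolic b e I, u * w ∈ minRight b e I := by
  induction hm : len b e w using Nat.strong_induction_on generalizing w with
  | _ m ih =>
  by_cases h : w ∈ minRight b e I
  · exact ⟨1, one_mem _, by simpa using h⟩
  · rw [mem_minRight_iff] at h
    push Not at h
    obtain ⟨i, hi, h⟩ := h
    have h1 := len_simple_mul_of_not_sameSide b e h
    obtain ⟨u, hu, hw⟩ := ih _ (by omega) (simpleReflection b e i * w) rfl
    exact ⟨u * simpleReflection b e i, mul_mem hu (simpleReflection_mem_parabolic b e hi),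
      by rwa [mul_assoc]⟩

theorem eq_one_of_mul_mem_minRight {I : Finset (Fin (n + 1))} {u w : affineWeylGroup b e}
    (hu : u ∈ parabolic b e I) (hw : w ∈ minRight b e I) (huw : u * w ∈ minRight b e I) :
    u = 1 := by
  have h1 := len_mul b e hu hw
  have h2 := len_mul b e (inv_mem hu) huw
  rw [inv_mul_cancel_left] at h2
  exact eq_one_of_len_eq_zero b e (by omega)

theorem rightCosets_mk_eq {G : Type*} [Group G] {H : Subgroup G} {x y : G} :
    RightCosets.mk H x = RightCosets.mk H y ↔ y * x⁻¹ ∈ H := by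
  rw [RightCosets.mk, RightCosets.mk, Quotient.eq, QuotientGroup.rightRel_apply]

theorem minRight_bijective (I : Finset (Fin (n + 1))) :
    Function.Bijective (fun w : minRight b e I => RightCosets.mk (parabolic b e I) w.1) := by
  constructor
  · rintro ⟨w, hw⟩ ⟨w', hw'⟩ h
    have h1 := rightCosets_mk_eq.1 h
    have h2 := eq_one_of_mul_mem_minRight b e h1 hw (by simpa using hw')
    exact Subtype.ext (mul_inv_eq_one.1 h2).symm
  · intro q
    induction q using Quotient.inductionOn with
    | _ w =>
    obtain ⟨u, hu, hw⟩ := exists_mul_mem_minRight b e I w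
    exact ⟨⟨u * w, hw⟩, rightCosets_mk_eq.2 (by simpa using inv_mem hu)⟩

theorem minLeft_bijective (I : Finset (Fin (n + 1))) :
    Function.Bijective (fun w : minLeft b e I =>
      (w.1 : affineWeylGroup b e ⧸ parabolic b e I)) := by
  constructor
  · rintro ⟨w, hw⟩ ⟨w', hw'⟩ h
    rw [mem_minLeft_iff] at hw hw'
    have h1 : w⁻¹ * w' ∈ parabolic b e I := QuotientGroup.eq.1 h
    have h2 := eq_one_of_mul_mem_minRight b e h1 hw' (by simpa using hw)
    exact Subtype.ext (inv_mul_eq_one.1 h2)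
  · intro q
    induction q using QuotientGroup.induction_on with
    | _ w =>
    obtain ⟨u, hu, hw⟩ := exists_mul_mem_minRight b e I w⁻¹
    refine ⟨⟨w * u⁻¹, (mem_minLeft_iff b e).2 (by simpa using hw)⟩, QuotientGroup.eq.2 ?_⟩
    simpa using hu

/-- A parabolic subgroup is the pointwise stabiliser of the corresponding face. -/
theorem mem_parabolic_iff {I : Finset (Fin (n + 1))} {w : affineWeylGroup b e} :
    w ∈ parabolic b e I ↔
      ∀ j ∉ I, (w : N ≃ᵃ[ℝ] N) (alcoveVertex b e j) = alcoveVertex b e j := by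
  refine ⟨fun hw j hj => parabolic_apply_vertex b e hj hw, fun h => ?_⟩
  obtain ⟨u, hu, huw⟩ := exists_mul_mem_minRight b e I w
  have h1 : u * w = 1 := by
    rw [mem_minRight_iff] at huw
    refine eq_one_of_forall_sameSide b e fun j => ?_
    by_cases hj : j ∈ I
    · exact huw j hj
    · refine sameSide_of_apply_vertex b e ?_
      rw [mul_apply, h j hj, parabolic_apply_vertex b e hj hu]
  rw [← inv_eq_of_mul_eq_one_right h1]
  exact inv_mem hu

theorem mem_parabolic_inter {I J : Finset (Fin (n + 1))} {w : affineWeylGroup b e}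
    (hI : w ∈ parabolic b e I) (hJ : w ∈ parabolic b e J) : w ∈ parabolic b e (I ∩ J) := by
  rw [mem_parabolic_iff] at hI hJ ⊢
  intro j hj
  by_cases h : j ∈ I
  · exact hJ j fun h' => hj (Finset.mem_inter.2 ⟨h, h'⟩)
  · exact hI j h

open scoped Pointwise in
/-- For `w = u v`, the factor `u` is made minimal in its coset of `(W_a)_{I ∩ J}`; it is then minimal
in its coset of `(W_a)_J`, because no reflection in `J ∖ I` shortens an element of `(W_a)_I`. -/
theorem existsUnique_parabolicFactor (I J : Finset (Fin (n + 1))) (w : affineWeylGroup b e)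
    (hw : w ∈ (parabolic b e I : Set (affineWeylGroup b e)) * (parabolic b e J : Set _)) :
    ∃! v, IsParabolicFactor b e I J w v := by
  obtain ⟨u, hu, v, hv, rfl⟩ := hw
  have hIJ := parabolic_mono b e (Finset.inter_subset_left : I ∩ J ⊆ I)
  have hJI := parabolic_mono b e (Finset.inter_subset_right : I ∩ J ⊆ J)
  obtain ⟨t, ht, htu⟩ := exists_mul_mem_minRight b e (I ∩ J) u⁻¹
  refine ⟨t * v, ⟨mul_mem (hJI ht) hv, u * t⁻¹, mul_mem hu (inv_mem (hIJ ht)),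
    (mem_minLeft_iff b e).2 (by simpa using htu), by group, ?_⟩, ?_⟩
  · have h1 : t * u⁻¹ ∈ minRight b e J := by
      rw [mem_minRight_iff] at htu ⊢
      intro j hj
      by_cases hI : j ∈ I
      · exact htu j (Finset.mem_inter.2 ⟨hI, hj⟩)
      · exact sameSide_of_notMem b e hI (mul_mem (hIJ ht) (inv_mem hu))
    have h2 := len_mul b e (inv_mem (mul_mem (hJI ht) hv)) h1
    rw [len_inv, ← len_inv b e (t * u⁻¹), ← len_inv] at h2
    simp only [mul_inv_rev, inv_inv] at h2
    rw [add_comm, ← h2]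
    congr 1
    group
  · rintro v' ⟨hv', u', hu', hu'', h, -⟩
    change u * v = u' * v' at h
    rw [mem_minLeft_iff] at hu''
    have h1 : (t * u⁻¹) * u' = t * v * v'⁻¹ := by
      rw [mul_assoc, mul_assoc, mul_right_inj]
      rw [inv_mul_eq_iff_eq_mul, ← mul_assoc, h]; group
    have h2 : (t * u⁻¹) * u' ∈ parabolic b e (I ∩ J) :=
      mem_parabolic_inter b e (mul_mem (mul_mem (hIJ ht) (inv_mem hu)) hu')
        (h1 ▸ mul_mem (mul_mem (hJI ht) hv) (inv_mem hv'))
    have h3 := eq_one_of_mul_mem_minRight b e h2 hu'' (by simpa using htu)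
    rw [h1] at h3
    exact (mul_inv_eq_one.1 h3).symm

/-! ### The closed fundamental alcove is a fundamental domain -/

/-- The closed simplex bounded by the walls `H₀, …, Hₙ`. -/
def closedAlcove : Set N := {x | ∀ i, 0 ≤ simpleForm b e i x}

theorem alcoveVertex_mem (j : Fin (n + 1)) : alcoveVertex b e j ∈ closedAlcove b e := by
  intro i
  rw [simpleForm_alcoveVertex]
  split_ifs
  · exact (inv_pos.2 (mark_pos b e j)).le
  · exact le_rfl

theorem alcoveVertex_injective : Function.Injective (alcoveVertex b e) := by
  intro i j h
  by_contra hij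
  have h1 := simpleForm_alcoveVertex b e i j
  rw [← h, simpleForm_alcoveVertex, if_pos rfl, if_neg hij] at h1
  exact (inv_pos.2 (mark_pos b e i)).ne' h1

/-- Two points of the closed alcove in the same orbit agree, and the stabiliser of a point is
generated by the reflections in the walls through it. -/
theorem eq_and_mem_parabolic {x y : N} (hx : x ∈ closedAlcove b e) (hy : y ∈ closedAlcove b e)
    (I : Finset (Fin (n + 1))) (hI : ∀ i, simpleForm b e i x = 0 → i ∈ I)
    {w : affineWeylGroup b e} (h : (w : N ≃ᵃ[ℝ] N) x = y) : x = y ∧ w ∈ parabolic b e I := by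
  induction hm : len b e w generalizing w with
  | zero =>
    have := eq_one_of_len_eq_zero b e hm
    subst this
    exact ⟨h, one_mem _⟩
  | succ m ih =>
    have h1 : w ≠ 1 := by
      rintro rfl
      rw [len_one] at hm
      omega
    obtain ⟨i, -, hi⟩ := exists_not_sameSide b e (mem_parabolic_univ b e w) h1
    have h2 := ((isAffineRoot_simpleForm b e i).pullback b e w).nonpos b e
      (not_sameSide b e hi) hx
    rw [pullback_apply, h] at h2
    have h3 : simpleForm b e i y = 0 := le_antisymm h2 (hy i)
    have h4 : ((simpleReflection b e i * w : affineWeylGroup b e) : N ≃ᵃ[ℝ] N) x = y := by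
      rw [mul_apply, h, simpleReflection_apply_of_eq_zero b e h3]
    have h5 := len_simple_mul_of_not_sameSide b e hi
    obtain ⟨rfl, h6⟩ := ih h4 (by omega)
    refine ⟨rfl, ?_⟩
    have := mul_mem (simpleReflection_mem_parabolic b e (hI i h3)) h6
    simpa using this

theorem eq_of_apply_vertex_eq {w w' : affineWeylGroup b e} {i j : Fin (n + 1)}
    (h : (w : N ≃ᵃ[ℝ] N) (alcoveVertex b e i) = (w' : N ≃ᵃ[ℝ] N) (alcoveVertex b e j)) :
    i = j := by
  have h1 : ((w'⁻¹ * w : affineWeylGroup b e) : N ≃ᵃ[ℝ] N) (alcoveVertex b e i) =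
      alcoveVertex b e j := by
    rw [mul_apply, h, ← mul_apply, inv_mul_cancel, one_apply]
  exact alcoveVertex_injective b e (eq_and_mem_parabolic b e (alcoveVertex_mem b e i)
    (alcoveVertex_mem b e j) Finset.univ (fun i _ => Finset.mem_univ i) h1).1

theorem vertexType_apply (w : affineWeylGroup b e) (i : Fin (n + 1)) :
    vertexType b e ((w : N ≃ᵃ[ℝ] N) (alcoveVertex b e i)) = i := by
  have : {m | ∃ (j : Fin (n + 1)) (w' : affineWeylGroup b e), (j : ℕ) = m ∧
      (w' : N ≃ᵃ[ℝ] N) (alcoveVertex b e j) = (w : N ≃ᵃ[ℝ] N) (alcoveVertex b e i)} =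
      {(i : ℕ)} := by
    ext m
    constructor
    · rintro ⟨j, w', rfl, h⟩
      rw [eq_of_apply_vertex_eq b e h]; rfl
    · rintro rfl
      exact ⟨i, w, rfl, rfl⟩
  rw [vertexType, this, csInf_singleton]

/-- The affine roots separating `x` from the fundamental alcove. -/
def separating (x : N) : Set (N →ᵃ[ℝ] ℝ) :=
  {f | IsAffineRoot P f ∧ 0 < f (alcoveCenter b e) ∧ f x < 0}

theorem separating_finite (x : N) : (separating b e x).Finite := by
  refine (finite_iUnion fun i : ι => (finite_Icc ⌊-P.toLinearMap (P.root i) (alcoveCenter b e)⌋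
    ⌈-P.toLinearMap (P.root i) x⌉).image fun k : ℤ =>
      (P.toLinearMap (P.root i)).toAffineMap + AffineMap.const ℝ N (k : ℝ)).subset ?_
  rintro f ⟨⟨i, k, h⟩, h1, h2⟩
  rw [h] at h1 h2
  refine mem_iUnion.2 ⟨i, k, ⟨?_, ?_⟩, ?_⟩
  · have := Int.floor_le (-P.toLinearMap (P.root i) (alcoveCenter b e))
    exact_mod_cast (by linarith : ((⌊-P.toLinearMap (P.root i) (alcoveCenter b e)⌋ : ℤ) : ℝ) ≤ k)
  · have := Int.le_ceil (-P.toLinearMap (P.root i) x)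
    exact_mod_cast (by linarith : (k : ℝ) ≤ ((⌈-P.toLinearMap (P.root i) x⌉ : ℤ) : ℝ))
  · ext y
    simp [h]

/-- The translates of the closed fundamental alcove cover `V*`: reflecting in a wall of `A₀` that
separates `x` from `A₀` lowers the number of affine roots separating them. -/
theorem exists_apply_mem_closedAlcove (x : N) :
    ∃ w : affineWeylGroup b e, (w : N ≃ᵃ[ℝ] N) x ∈ closedAlcove b e := by
  induction hm : (separating b e x).ncard using Nat.strong_induction_on generalizing x with
  | _ m ih =>
  by_cases hx : x ∈ closedAlcove b e
  · exact ⟨1, hx⟩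
  obtain ⟨i, hi⟩ : ∃ i, simpleForm b e i x < 0 := by
    by_contra! h
    exact hx h
  have hss : ∀ y, (simpleReflection b e i : N ≃ᵃ[ℝ] N)
      ((simpleReflection b e i : N ≃ᵃ[ℝ] N) y) = y := fun y => by
    rw [← mul_apply, simpleReflection_mul_self, one_apply]
  have hinj : Function.Injective (pullback b e (simpleReflection b e i)) := by
    intro f g h
    ext y
    have := DFunLike.congr_fun h ((simpleReflection b e i : N ≃ᵃ[ℝ] N) y)
    simpa [hss] using this
  have hmem : simpleForm b e i ∈ separating b e x :=
    ⟨isAffineRoot_simpleForm b e i, simpleForm_alcoveCenter_pos b e i, hi⟩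
  have hmaps : pullback b e (simpleReflection b e i) ''
      separating b e ((simpleReflection b e i : N ≃ᵃ[ℝ] N) x) ⊆
      separating b e x \ {simpleForm b e i} := by
    rintro _ ⟨f, ⟨h1, h2, h3⟩, rfl⟩
    have hroot := h1.pullback b e (simpleReflection b e i)
    refine ⟨⟨hroot, ?_, h3⟩, fun h => ?_⟩
    · by_contra h4
      have h5 := h1.eq_simpleForm b e (i := i) h2
        (lt_of_le_of_ne (not_lt.1 h4) (hroot.center_ne b e))
      subst h5
      rw [simpleForm_simpleReflection] at h3
      linarith
    · have h6 := DFunLike.congr_fun h ((simpleReflection b e i : N ≃ᵃ[ℝ] N) (alcoveCenter b e))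
      rw [pullback_apply, hss, simpleForm_simpleReflection] at h6
      have := simpleForm_alcoveCenter_pos b e i
      linarith
  have hlt : (separating b e ((simpleReflection b e i : N ≃ᵃ[ℝ] N) x)).ncard < m := by
    rw [← ncard_image_of_injective _ hinj, ← hm]
    refine lt_of_le_of_lt (ncard_le_ncard hmaps ((separating_finite b e x).sdiff)) ?_
    exact ncard_sdiff_singleton_lt_of_mem hmem (separating_finite b e x)
  obtain ⟨w, hw⟩ := ih _ hlt _ rfl
  exact ⟨w * simpleReflection b e i, hw⟩

/-! ### Local finiteness -/

theorem root_mem_Icc {i : ι} (hi : b.IsPos i) {x : N} (hx : x ∈ closedAlcove b e) :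
    P.toLinearMap (P.root i) x ∈ Icc 0 1 := by
  have h := affineMap_apply_eq_sum b e (P.toLinearMap (P.root i)).toAffineMap x
  simp only [LinearMap.coe_toAffineMap] at h
  have h0 : ∀ j, 0 ≤ mark b e j * simpleForm b e j x :=
    fun j => mul_nonneg (mark_pos b e j).le (hx j)
  rw [h]
  constructor
  · exact Finset.sum_nonneg fun j _ => mul_nonneg (h0 j) (root_alcoveVertex_mem b e hi j).1
  · rw [← sum_mark_mul_simpleForm b e x]
    exact Finset.sum_le_sum fun j _ =>
      mul_le_of_le_one_right (h0 j) (root_alcoveVertex_mem b e hi j).2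

/-- An affine root varies by at most one on the closed fundamental alcove. -/
theorem IsAffineRoot.abs_sub_le_one {f : N →ᵃ[ℝ] ℝ} (hf : IsAffineRoot P f) {x y : N}
    (hx : x ∈ closedAlcove b e) (hy : y ∈ closedAlcove b e) : |f x - f y| ≤ 1 := by
  obtain ⟨i, k, h⟩ := hf
  rw [h, h, abs_le]
  let := P.indexNeg
  rcases RootPairing.Base.IsPos.or_neg b i with hi | hi
  · have h1 := root_mem_Icc b e hi hx
    have h2 := root_mem_Icc b e hi hy
    constructor <;> linarith [h1.1, h1.2, h2.1, h2.2]
  · have h1 := root_mem_Icc b e hi hx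
    have h2 := root_mem_Icc b e hi hy
    simp only [RootPairing.root_reflectionPerm, RootPairing.indexNeg_neg,
      RootPairing.reflection_apply_self, map_neg, LinearMap.neg_apply] at h1 h2
    constructor <;> linarith [h1.1, h1.2, h2.1, h2.2]

theorem alcoveCenter_mem : alcoveCenter b e ∈ closedAlcove b e :=
  fun i => (simpleForm_alcoveCenter_pos b e i).le

/-- Only finitely many alcoves have their centre in a bounded region: an alcove is determined by
the integer parts of the roots at its centre. -/
theorem finite_setOf_near (x : N) (C : ℝ) :
    {w : affineWeylGroup b e | ∀ i, |P.toLinearMap (P.root i) ((w : N ≃ᵃ[ℝ] N) (alcoveCenter b e)) -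
      P.toLinearMap (P.root i) x| ≤ C}.Finite := by
  let F : affineWeylGroup b e → ι → ℤ := fun w i =>
    ⌊P.toLinearMap (P.root i) ((w : N ≃ᵃ[ℝ] N) (alcoveCenter b e))⌋
  have hinj : Function.Injective F := by
    intro w w' h
    have : w⁻¹ * w' = 1 := by
      refine eq_one_of_forall_sameSide b e fun i => ?_
      have hf := (isAffineRoot_simpleForm b e i).pullback b e w⁻¹
      refine lt_of_le_of_ne ?_ ((hf.pullback b e w').center_ne b e).symm
      have h1 : 0 < pullback b e w⁻¹ (simpleForm b e i)
          ((w : N ≃ᵃ[ℝ] N) (alcoveCenter b e)) := by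
        rw [pullback_apply, ← mul_apply, inv_mul_cancel]
        exact simpleForm_alcoveCenter_pos b e i
      rw [mul_apply, ← pullback_apply b e w⁻¹]
      obtain ⟨j, k, hf⟩ := hf
      rw [hf] at h1 ⊢
      have h2 : -k ≤ F w j := Int.le_floor.2 (by push_cast; linarith)
      rw [h] at h2
      have h3 := Int.le_floor.1 h2
      push_cast at h3
      linarith
    exact inv_mul_eq_one.1 this
  refine Finite.of_finite_image (f := F) ?_ hinj.injOn
  refine (Finite.pi' fun i : ι => finite_Icc ⌊P.toLinearMap (P.root i) x - C⌋
    ⌊P.toLinearMap (P.root i) x + C⌋).subset ?_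
  rintro _ ⟨w, hw, rfl⟩ i
  have := abs_le.1 (hw i)
  exact ⟨Int.floor_mono (by linarith), Int.floor_mono (by linarith)⟩

theorem isAffineRoot_root (i : ι) : IsAffineRoot P (P.toLinearMap (P.root i)).toAffineMap :=
  ⟨i, 0, fun x => by simp⟩

theorem finite_setOf_alcove_near (x : N) (C : ℝ) :
    {w : affineWeylGroup b e | ∃ y ∈ closedAlcove b e, ∀ i,
      |P.toLinearMap (P.root i) ((w : N ≃ᵃ[ℝ] N) y) - P.toLinearMap (P.root i) x| ≤ C}.Finite := by
  refine (finite_setOf_near b e x (C + 1)).subset ?_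
  rintro w ⟨y, hy, h⟩ i
  have h1 := ((isAffineRoot_root (P := P) i).pullback b e w).abs_sub_le_one b e
    (alcoveCenter_mem b e) hy
  have h2 := h i
  simp only [pullback_apply, LinearMap.coe_toAffineMap] at h1
  rw [abs_le] at h1 h2 ⊢
  constructor <;> linarith [h1.1, h1.2, h2.1, h2.2]

/-- Proper parabolic subgroups are finite. -/
theorem parabolic_finite {I : Finset (Fin (n + 1))} (hI : I ≠ Finset.univ) :
    (parabolic b e I : Set (affineWeylGroup b e)).Finite := by
  obtain ⟨j, hj⟩ : ∃ j, j ∉ I := by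
    by_contra! h
    exact hI (Finset.eq_univ_iff_forall.2 h)
  refine (finite_setOf_alcove_near b e (alcoveVertex b e j) 0).subset fun u hu => ?_
  refine ⟨_, alcoveVertex_mem b e j, fun i => ?_⟩
  rw [parabolic_apply_vertex b e hj hu]
  simp

open SimplicialCochains

/-! ### The faces of the fundamental alcove -/

theorem mem_faceVertices {I : Finset (Fin (n + 1))} {x : N} :
    x ∈ faceVertices b e I ↔ ∃ j ∉ I, alcoveVertex b e j = x := by
  simp [faceVertices]

theorem card_faceVertices (I : Finset (Fin (n + 1))) :
    (faceVertices b e I).card + I.card = n + 1 := by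
  classical
  rw [faceVertices, Finset.card_image_of_injective _ (alcoveVertex_injective b e)]
  have := Finset.card_compl_add_card I
  simpa using this

theorem convexHull_faceVertices (I : Finset (Fin (n + 1))) :
    convexHull ℝ (faceVertices b e I : Set N) =
      {x | x ∈ closedAlcove b e ∧ ∀ i ∈ I, simpleForm b e i x = 0} := by
  apply subset_antisymm
  · refine convexHull_min ?_ ?_
    · intro x hx
      obtain ⟨j, hj, rfl⟩ := (mem_faceVertices b e).1 hx
      exact ⟨alcoveVertex_mem b e j, simpleForm_alcoveVertex_of_mem b e hj⟩
    · rintro x ⟨hx, hx'⟩ y ⟨hy, hy'⟩ s t hs ht hst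
      have h : ∀ i, simpleForm b e i (s • x + t • y) =
          s * simpleForm b e i x + t * simpleForm b e i y := fun i => by
        have := Convex.combo_affine_apply (f := simpleForm b e i) (x := x) (y := y) hst
        simpa using this
      refine ⟨fun i => ?_, fun i hi => ?_⟩
      · rw [h]
        exact add_nonneg (mul_nonneg hs (hx i)) (mul_nonneg ht (hy i))
      · rw [h, hx' i hi, hy' i hi]; simp
  · rintro x ⟨hx, hx'⟩
    rw [← sum_smul_alcoveVertex b e x]
    have h0 : ∀ i ∈ (Finset.univ : Finset (Fin (n + 1))), i ∉ Iᶜ →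
        mark b e i * simpleForm b e i x = 0 := fun i _ hi => by
      rw [hx' i (by simpa using hi), mul_zero]
    rw [← Finset.sum_subset (Finset.subset_univ Iᶜ) fun i hi hi' => by rw [h0 i hi hi', zero_smul]]
    refine (convex_convexHull ℝ _).sum_mem
      (fun i _ => mul_nonneg (mark_pos b e i).le (hx i)) ?_ fun i hi => ?_
    · rw [Finset.sum_subset (Finset.subset_univ Iᶜ) h0, sum_mark_mul_simpleForm]
    · exact subset_convexHull ℝ _ ((mem_faceVertices b e).2 ⟨i, by simpa using hi, rfl⟩)

/-- By the maximality of `α₀`, the walls `H₀, …, Hₙ` suffice to bound the fundamental alcove. -/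
theorem mem_fundamentalAlcove_iff {x : N} :
    x ∈ fundamentalAlcove b ↔ ∀ i, 0 < simpleForm b e i x := by
  constructor
  · intro h i
    induction i using Fin.cases with
    | zero =>
      have := (h _ (highestRoot_isPos b)).2
      rw [simpleForm_zero]; linarith
    | succ i => exact (h _ (RootPairing.Base.isPos_of_mem_support (e i).2)).1
  · intro h i hi
    have hc := fun j => coeff_nonneg_of_mem_closure b (mem_closure_of_isPos b hi) (e j)
    have hθ := h 0
    rw [simpleForm_zero, toLinearMap_eq_sum b e] at hθ
    rw [toLinearMap_eq_sum b e]
    constructor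
    · obtain ⟨k, hk⟩ : ∃ k, b.toWeightBasis.repr (P.root i) (e k) ≠ 0 := by
        by_contra! h
        apply P.ne_zero i
        rw [← b.toWeightBasis.sum_repr (P.root i), ← e.sum_comp]
        simp [h]
      exact Finset.sum_pos' (fun j _ => mul_nonneg (hc j) (h j.succ).le)
        ⟨k, Finset.mem_univ _, mul_pos (lt_of_le_of_ne (hc k) hk.symm) (h k.succ)⟩
    · have : ∑ j, b.toWeightBasis.repr (P.root i) (e j) * P.toLinearMap (P.root (e j)) x ≤
          ∑ j, b.toWeightBasis.repr (P.root (highestRoot b)) (e j) *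
            P.toLinearMap (P.root (e j)) x :=
        Finset.sum_le_sum fun j _ =>
          mul_le_mul_of_nonneg_right (coeff_le_highestRoot b i (e j)) (h j.succ).le
      linarith

theorem mem_wall_iff {i : Fin (n + 1)} {x : N} : x ∈ wall b e i ↔ simpleForm b e i x = 0 := by
  induction i using Fin.cases with
  | zero =>
    rw [simpleForm_zero, sub_eq_zero, eq_comm]; rfl
  | succ i => rfl

theorem finiteDimensional_coweights (b : P.Base) : FiniteDimensional ℝ N :=
  Module.Finite.of_basis b.toCoweightBasis

section

variable [TopologicalSpace N] [IsTopologicalAddGroup N] [ContinuousSMul ℝ N] [T2Space N]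

theorem continuous_simpleForm (i : Fin (n + 1)) : Continuous (simpleForm b e i) := by
  have := finiteDimensional_coweights b
  rw [funext (simpleForm_apply b e i)]
  exact ((P.toLinearMap (P.root (simpleIndex b e i))).continuous_of_finiteDimensional).add
    continuous_const

theorem closure_fundamentalAlcove : closure (fundamentalAlcove b) = closedAlcove b e := by
  apply subset_antisymm
  · refine closure_minimal (fun x hx i => ((mem_fundamentalAlcove_iff b e).1 hx i).le) ?_
    rw [closedAlcove, ofPred_forall]
    exact isClosed_iInter fun i => isClosed_le continuous_const (continuous_simpleForm b e i)
  · intro x hx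
    -- The points of the segment from `x` to the centre approach `x` from inside the alcove.
    have hlim : Filter.Tendsto (fun t : ℝ => x + t • (alcoveCenter b e - x))
        (nhdsWithin 0 (Ioo 0 1)) (nhds x) := by
      have : Continuous fun t : ℝ => x + t • (alcoveCenter b e - x) := by fun_prop
      have h := this.tendsto 0
      simp only [zero_smul, add_zero] at h
      exact h.mono_left nhdsWithin_le_nhds
    have : (nhdsWithin (0 : ℝ) (Ioo 0 1)).NeBot := by
      rw [← mem_closure_iff_nhdsWithin_neBot, closure_Ioo (by norm_num)]
      simp
    refine mem_closure_of_tendsto hlim ?_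
    filter_upwards [self_mem_nhdsWithin] with t ht
    rw [mem_fundamentalAlcove_iff b e]
    intro i
    have h1 : simpleForm b e i (x + t • (alcoveCenter b e - x)) =
        (1 - t) * simpleForm b e i x + t * simpleForm b e i (alcoveCenter b e) := by
      have := Convex.combo_affine_apply (f := simpleForm b e i) (x := x) (y := alcoveCenter b e)
        (a := 1 - t) (b := t) (by ring)
      rw [show x + t • (alcoveCenter b e - x) = (1 - t) • x + t • alcoveCenter b e by module]
      simpa using this
    rw [h1]
    have h2 := simpleForm_alcoveCenter_pos b e i
    have h3 := mul_nonneg (sub_nonneg.2 ht.2.le) (hx i)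
    have h4 := mul_pos ht.1 h2
    linarith

theorem convexHull_faceVertices_eq (I : Finset (Fin (n + 1))) :
    convexHull ℝ (faceVertices b e I : Set N) =
      closure (fundamentalAlcove b) ∩ ⋂ i ∈ I, wall b e i := by
  rw [convexHull_faceVertices, closure_fundamentalAlcove b e]
  ext x
  simp [mem_wall_iff]

end

/-! ### The triangulation -/

theorem mem_move {w : affineWeylGroup b e} {I : Finset (Fin (n + 1))} {x : N} :
    x ∈ move b e w (faceVertices b e I) ↔
      ∃ j ∉ I, (w : N ≃ᵃ[ℝ] N) (alcoveVertex b e j) = x := by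
  simp only [move, Finset.mem_map, mem_faceVertices]
  constructor
  · rintro ⟨_, ⟨j, hj, rfl⟩, rfl⟩
    exact ⟨j, hj, rfl⟩
  · rintro ⟨j, hj, rfl⟩
    exact ⟨_, ⟨j, hj, rfl⟩, rfl⟩

theorem convexHull_move (w : affineWeylGroup b e) (s : Finset N) :
    convexHull ℝ (move b e w s : Set N) = (w : N ≃ᵃ[ℝ] N) '' convexHull ℝ (s : Set N) := by
  rw [move, Finset.coe_map]
  exact ((w : N ≃ᵃ[ℝ] N).toAffineMap.image_convexHull (s : Set N)).symm

theorem move_mem (w : affineWeylGroup b e) {s : Finset N} (hs : s ∈ alcoveSimplices b e) :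
    move b e w s ∈ alcoveSimplices b e := by
  obtain ⟨u, I, hI, rfl⟩ := hs
  exact ⟨w * u, I, hI, (move_mul b e w u _).symm⟩

theorem move_mem_iff (w : affineWeylGroup b e) (s : Finset N) :
    move b e w s ∈ alcoveSimplices b e ↔ s ∈ alcoveSimplices b e := by
  refine ⟨fun h => ?_, move_mem b e w⟩
  have := move_mem b e w⁻¹ h
  rwa [← move_mul, inv_mul_cancel, move_one] at this

theorem ne_univ_of_card {I : Finset (Fin (n + 1))} {k : ℕ} (h : I.card + k = n) :
    I ≠ Finset.univ := by
  rintro rfl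
  simp at h
  omega

theorem move_faceVertices_mem (w : affineWeylGroup b e) {I : Finset (Fin (n + 1))}
    (hI : I ≠ Finset.univ) : move b e w (faceVertices b e I) ∈ alcoveSimplices b e :=
  ⟨w, I, hI, rfl⟩

theorem subset_eq_move {w : affineWeylGroup b e} {I : Finset (Fin (n + 1))} {t : Finset N}
    (h : t ⊆ move b e w (faceVertices b e I)) :
    ∃ J, I ⊆ J ∧ t = move b e w (faceVertices b e J) := by
  classical
  refine ⟨Finset.univ.filter fun j => (w : N ≃ᵃ[ℝ] N) (alcoveVertex b e j) ∉ t, ?_, ?_⟩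
  · intro j hj
    simp only [Finset.mem_filter, Finset.mem_univ, true_and]
    intro h'
    obtain ⟨i, hi, h2⟩ := (mem_move b e).1 (h h')
    rw [eq_of_apply_vertex_eq b e h2] at hi
    exact hi hj
  · ext x
    rw [mem_move]
    constructor
    · intro hx
      obtain ⟨i, hi, rfl⟩ := (mem_move b e).1 (h hx)
      exact ⟨i, by simpa using hx, rfl⟩
    · rintro ⟨j, hj, rfl⟩
      simpa using hj

theorem faceVertices_univ : faceVertices b e Finset.univ = ∅ := by simp [faceVertices]

theorem isOrderedComplex : IsOrderedComplex (alcoveSimplices b e) (vertexType b e) where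
  nonempty := by
    rintro _ ⟨w, I, hI, rfl⟩
    obtain ⟨j, hj⟩ : ∃ j, j ∉ I := by
      by_contra! h
      exact hI (Finset.eq_univ_iff_forall.2 h)
    exact ⟨_, (mem_move b e).2 ⟨j, hj, rfl⟩⟩
  down_closed := by
    rintro _ ⟨w, I, hI, rfl⟩ t ht hne
    obtain ⟨J, -, rfl⟩ := subset_eq_move b e ht
    refine ⟨w, J, ?_, rfl⟩
    rintro rfl
    simp [faceVertices_univ, move] at hne
  injOn := by
    rintro _ ⟨w, I, hI, rfl⟩ x hx y hy h
    obtain ⟨i, -, rfl⟩ := (mem_move b e).1 hx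
    obtain ⟨j, -, rfl⟩ := (mem_move b e).1 hy
    rw [vertexType_apply, vertexType_apply] at h
    rw [Fin.ext h]

theorem isSymmetry (w : affineWeylGroup b e) :
    IsSymmetry (alcoveSimplices b e) (vertexType b e) (w : N ≃ᵃ[ℝ] N).toEquiv where
  map_mem_iff s := move_mem_iff b e w s
  label := by
    rintro _ ⟨u, I, hI, rfl⟩ x hx
    obtain ⟨i, -, rfl⟩ := (mem_move b e).1 hx
    rw [vertexType_apply]
    exact vertexType_apply b e (w * u) i

/-- A translate of a face determines the face, and the translating element up to the parabolic
subgroup of the face. -/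
theorem move_eq_move_iff {w w' : affineWeylGroup b e} {I J : Finset (Fin (n + 1))} :
    move b e w (faceVertices b e I) = move b e w' (faceVertices b e J) ↔
      I = J ∧ w⁻¹ * w' ∈ parabolic b e I := by
  constructor
  · intro h
    have key : ∀ {w w' : affineWeylGroup b e} {I J : Finset (Fin (n + 1))},
        move b e w (faceVertices b e I) = move b e w' (faceVertices b e J) → ∀ j ∉ I, j ∉ J ∧
          (w : N ≃ᵃ[ℝ] N) (alcoveVertex b e j) = (w' : N ≃ᵃ[ℝ] N) (alcoveVertex b e j) := by
      intro w w' I J h j hj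
      have h1 := (mem_move b e (w := w)).2 ⟨j, hj, rfl⟩
      rw [h, mem_move] at h1
      obtain ⟨i, hi, h2⟩ := h1
      obtain rfl := eq_of_apply_vertex_eq b e h2
      exact ⟨hi, h2.symm⟩
    refine ⟨?_, ?_⟩
    · ext j
      exact ⟨fun hj => by_contra fun hj' => (key h.symm j hj').1 hj,
        fun hj => by_contra fun hj' => (key h j hj').1 hj⟩
    · rw [mem_parabolic_iff]
      intro j hj
      rw [mul_apply, ← (key h j hj).2, ← mul_apply, inv_mul_cancel, one_apply]
  · rintro ⟨rfl, h⟩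
    ext x
    rw [mem_move, mem_move]
    refine exists_congr fun j => and_congr_right fun hj => ?_
    rw [show w' = w * (w⁻¹ * w') by group, mul_apply, parabolic_apply_vertex b e hj h]

theorem move_eq_self {w : affineWeylGroup b e} {s : Finset N} (hs : s ∈ alcoveSimplices b e)
    (h : move b e w s = s) {x : N} (hx : x ∈ convexHull ℝ (s : Set N)) :
    (w : N ≃ᵃ[ℝ] N) x = x := by
  obtain ⟨u, I, hI, rfl⟩ := hs
  rw [← move_mul, move_eq_move_iff] at h
  rw [convexHull_move, convexHull_faceVertices] at hx
  obtain ⟨y, hy, rfl⟩ := hx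
  have h1 := parabolic_apply_of_eq_zero b e hy.2 h.2
  rw [mul_inv_rev] at h1
  rw [← mul_apply]
  conv_lhs => rw [← h1]
  rw [← mul_apply]
  congr 2
  group

theorem affineIndependent_alcoveVertex : AffineIndependent ℝ (alcoveVertex b e) := by
  rw [affineIndependent_iff]
  intro s w hw hv i hi
  have h : ∀ f : N →ᵃ[ℝ] ℝ, ∑ j ∈ s, w j * f (alcoveVertex b e j) = 0 := by
    intro f
    have hf : ∀ y, f y = f.linear y + f 0 := fun y => by
      simpa using f.map_vadd 0 y
    simp_rw [hf (alcoveVertex b e _), mul_add, Finset.sum_add_distrib, ← Finset.sum_mul, hw,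
      zero_mul, add_zero]
    simpa using congrArg f.linear hv
  have h1 := h (simpleForm b e i)
  simp only [simpleForm_alcoveVertex, mul_ite, mul_zero, Finset.sum_ite_eq, hi, if_true] at h1
  exact (mul_eq_zero.1 h1).resolve_right (inv_pos.2 (mark_pos b e i)).ne'

/-- The alcove triangulation of `V*`. -/
noncomputable def alcoveComplex : Geometry.SimplicialComplex ℝ N where
  faces := alcoveSimplices b e
  isRelLowerSet_faces := fun s hs => ⟨(isOrderedComplex b e).nonempty s hs,
    fun t ht hne => (isOrderedComplex b e).down_closed s hs t ht hne⟩
  indep := by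
    rintro _ ⟨w, I, hI, rfl⟩
    have h1 := ((affineIndependent_alcoveVertex b e).map' (w : N ≃ᵃ[ℝ] N).toAffineMap
      (w : N ≃ᵃ[ℝ] N).injective).range
    refine h1.mono ?_
    intro x hx
    obtain ⟨j, -, rfl⟩ := (mem_move b e).1 hx
    exact ⟨j, rfl⟩
  inter_subset_convexHull := by
    classical
    rintro _ _ ⟨w, I, hI, rfl⟩ ⟨w', J, hJ, rfl⟩ x ⟨hx, hx'⟩
    rw [convexHull_move, convexHull_faceVertices] at hx hx'
    obtain ⟨y, hy, rfl⟩ := hx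
    obtain ⟨y', hy', h⟩ := hx'
    -- The common point lies in the relative interior of the face of the type of its zero set.
    let K : Finset (Fin (n + 1)) := Finset.univ.filter fun i => simpleForm b e i y = 0
    have h1 : ((w'⁻¹ * w : affineWeylGroup b e) : N ≃ᵃ[ℝ] N) y = y' := by
      rw [mul_apply, ← h, ← mul_apply, inv_mul_cancel, one_apply]
    obtain ⟨rfl, hK⟩ := eq_and_mem_parabolic b e hy.1 hy'.1 K (by simp [K]) h1
    have h2 : (w : N ≃ᵃ[ℝ] N) y ∈ convexHull ℝ (move b e w (faceVertices b e K) : Set N) := by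
      rw [convexHull_move, convexHull_faceVertices]
      exact ⟨y, ⟨hy.1, by simp [K]⟩, rfl⟩
    refine convexHull_mono ?_ h2
    intro z hz
    obtain ⟨j, hj, rfl⟩ := (mem_move b e).1 hz
    refine ⟨(mem_move b e).2 ⟨j, fun hj' => hj (by simp [K, hy.2 j hj']), rfl⟩,
      (mem_move b e).2 ⟨j, fun hj' => hj (by simp [K, hy'.2 j hj']), ?_⟩⟩
    conv_lhs => rw [← parabolic_apply_vertex b e hj hK]
    rw [← mul_apply]
    congr 2
    group

/-- A simplex of the triangulation lies in a closed alcove. -/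
theorem convexHull_subset_alcove {w : affineWeylGroup b e} {I : Finset (Fin (n + 1))} :
    convexHull ℝ (move b e w (faceVertices b e I) : Set N) ⊆
      (w : N ≃ᵃ[ℝ] N) '' closedAlcove b e := by
  rw [convexHull_move, convexHull_faceVertices]
  exact image_mono fun x hx => hx.1

theorem space_alcoveComplex : (alcoveComplex b e).space = univ := by
  rw [eq_univ_iff_forall]
  intro x
  rw [Geometry.SimplicialComplex.mem_space_iff]
  obtain ⟨w, hw⟩ := exists_apply_mem_closedAlcove b e x
  refine ⟨_, move_faceVertices_mem b e w⁻¹ (I := ∅) Finset.univ_nonempty.ne_empty.symm, ?_⟩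
  rw [convexHull_move, convexHull_faceVertices]
  refine ⟨_, ⟨hw, by simp⟩, ?_⟩
  rw [← mul_apply, inv_mul_cancel, one_apply]

/-- Finitely many alcoves have only finitely many faces. -/
theorem finite_of_alcoves {S : Set (affineWeylGroup b e)} (hS : S.Finite) :
    {s : Finset N | ∃ w ∈ S, ∃ I, s = move b e w (faceVertices b e I)}.Finite := by
  refine (hS.image2 (fun w I => move b e w (faceVertices b e I))
    (finite_univ (α := Finset (Fin (n + 1))))).subset ?_
  rintro _ ⟨w, hw, I, rfl⟩
  exact ⟨w, hw, I, mem_univ _, rfl⟩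

theorem finite_star (t : Finset N) (ht : t ∈ alcoveSimplices b e) :
    {s ∈ alcoveSimplices b e | t ⊆ s}.Finite := by
  obtain ⟨x, hx⟩ := (isOrderedComplex b e).nonempty t ht
  refine (finite_of_alcoves b e (finite_setOf_alcove_near b e x 0)).subset ?_
  rintro _ ⟨⟨w, I, hI, rfl⟩, hts⟩
  obtain ⟨j, hj, rfl⟩ := (mem_move b e).1 (hts hx)
  exact ⟨w, ⟨_, alcoveVertex_mem b e j, fun i => by simp⟩, I, rfl⟩

theorem locallyFinite_alcoveSimplices [TopologicalSpace N] [IsTopologicalAddGroup N]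
    [ContinuousSMul ℝ N] [T2Space N] :
    LocallyFinite fun s : alcoveSimplices b e => convexHull ℝ ((s : Finset N) : Set N) := by
  have := finiteDimensional_coweights b
  intro x
  refine ⟨⋂ i, {y | |P.toLinearMap (P.root i) y - P.toLinearMap (P.root i) x| < 1},
    Filter.iInter_mem.2 fun i => ?_, ?_⟩
  · have hc : Continuous fun y => |P.toLinearMap (P.root i) y - P.toLinearMap (P.root i) x| :=
      ((P.toLinearMap (P.root i)).continuous_of_finiteDimensional.sub continuous_const).abs
    exact (isOpen_lt hc continuous_const).mem_nhds (by simp)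
  · refine Finite.of_finite_image (f := Subtype.val) ?_ Subtype.val_injective.injOn
    refine (finite_of_alcoves b e (finite_setOf_alcove_near b e x 1)).subset ?_
    rintro _ ⟨⟨_, w, I, hI, rfl⟩, ⟨y, hy, hy'⟩, rfl⟩
    obtain ⟨z, hz, rfl⟩ := convexHull_subset_alcove b e hy
    exact ⟨w, ⟨z, hz, fun i => (mem_iInter.1 hy' i).le⟩, I, rfl⟩

/-! ### Simplices and cosets -/

theorem card_move (w : affineWeylGroup b e) (I : Finset (Fin (n + 1))) :
    (move b e w (faceVertices b e I)).card + I.card = n + 1 := by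
  rw [move, Finset.card_map, card_faceVertices]

/-- The `k`-simplices of the alcove triangulation are the cosets `w (W_a)_I` with
`|I| = n - k`. -/
noncomputable def cosetEquivSimplices (k : ℕ) :
    (Σ I : {I : Finset (Fin (n + 1)) // I.card + k = n},
      affineWeylGroup b e ⧸ parabolic b e I.1) ≃
      {s : Finset N | s ∈ alcoveSimplices b e ∧ s.card = k + 1} :=
  Equiv.ofBijective
    (fun q => Quotient.liftOn' q.2
      (fun w => ⟨move b e w (faceVertices b e q.1.1),
        move_faceVertices_mem b e w (ne_univ_of_card q.1.2), by
          have := card_move b e w q.1.1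
          have := q.1.2
          omega⟩)
      (fun w w' h => Subtype.ext ((move_eq_move_iff b e).2
        ⟨rfl, QuotientGroup.leftRel_apply.1 h⟩))) (by
    constructor
    · rintro ⟨⟨I, hI⟩, q⟩ ⟨⟨J, hJ⟩, q'⟩ h
      induction q using QuotientGroup.induction_on with
      | _ w =>
      induction q' using QuotientGroup.induction_on with
      | _ w' =>
      obtain ⟨h1, h2⟩ := (move_eq_move_iff b e).1 (congrArg Subtype.val h)
      simp only at h1
      subst h1
      congr 1
      exact QuotientGroup.eq.2 h2
    · rintro ⟨_, ⟨w, I, hI, rfl⟩, hk⟩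
      refine ⟨⟨⟨I, ?_⟩, (w : affineWeylGroup b e ⧸ parabolic b e I)⟩, rfl⟩
      have := card_move b e w I
      omega)

/-- The isomorphism of `⨁ ℤ[W_a / (W_a)_I]` with the group of `k`-chains. -/
noncomputable def chainsEquiv (k : ℕ) :
    ((Σ I : {I : Finset (Fin (n + 1)) // I.card + k = n},
      affineWeylGroup b e ⧸ parabolic b e I.1) →₀ ℤ) ≃ₗ[ℤ] chains (alcoveSimplices b e) k :=
  (Finsupp.domLCongr (cosetEquivSimplices b e k)).trans
    (Finsupp.supportedEquivFinsupp {s | s ∈ alcoveSimplices b e ∧ s.card = k + 1}).symm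

theorem chainsEquiv_single (k : ℕ) (I : {I : Finset (Fin (n + 1)) // I.card + k = n})
    (w : affineWeylGroup b e) :
    (chainsEquiv b e k (Finsupp.single
      ⟨I, (w : affineWeylGroup b e ⧸ parabolic b e I.1)⟩ 1) : Finset N →₀ ℤ) =
      cell b e I.1 w := by
  have h := Finsupp.supportedEquivFinsupp_symm_single (R := ℤ)
    {s | s ∈ alcoveSimplices b e ∧ s.card = k + 1}
    (cosetEquivSimplices b e k ⟨I, (w : affineWeylGroup b e ⧸ parabolic b e I.1)⟩) (1 : ℤ)
  rw [← Finsupp.domLCongr_single (R := ℤ)] at h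
  exact h

theorem chainAction_mem {k : ℕ} (w : affineWeylGroup b e) {c : Finset N →₀ ℤ}
    (hc : c ∈ chains (alcoveSimplices b e) k) :
    chainAction b e w c ∈ chains (alcoveSimplices b e) k := by
  have hc' : c = ∑ s ∈ c.support, c s • Finsupp.single s 1 := by
    conv_lhs => rw [← c.sum_single]
    simp [Finsupp.sum]
  rw [hc']
  simp only [map_sum, map_smul]
  refine Submodule.sum_mem _ fun s hs => Submodule.smul_mem _ _ ?_
  obtain ⟨h1, h2⟩ := (Finsupp.mem_supported ℤ c).1 hc hs
  have h3 : chainAction b e w (Finsupp.single s 1) = Finsupp.single (move b e w s) 1 :=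
    Finsupp.mapDomain_single
  rw [h3]
  refine Finsupp.single_mem_supported ℤ _ ⟨move_mem b e w h1, ?_⟩
  rw [move, Finset.card_map, h2]

theorem chainAction_cell (I : Finset (Fin (n + 1))) (w w' : affineWeylGroup b e) :
    chainAction b e w (cell b e I w') = cell b e I (w * w') := by
  rw [cell, cell, move_mul]
  exact Finsupp.mapDomain_single

theorem chainsEquiv_leftCosetRep (k : ℕ) (w : affineWeylGroup b e)
    (a : (Σ I : {I : Finset (Fin (n + 1)) // I.card + k = n},
      affineWeylGroup b e ⧸ parabolic b e I.1) →₀ ℤ) :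
    (chainsEquiv b e k (leftCosetRep (fun I : {I : Finset (Fin (n + 1)) // I.card + k = n} =>
      parabolic b e I.1) w a) : Finset N →₀ ℤ) = chainAction b e w (chainsEquiv b e k a) := by
  induction a using Finsupp.induction_linear with
  | zero => simp
  | add a a' h h' => simp only [map_add, Submodule.coe_add, h, h']
  | single q c =>
    obtain ⟨I, q⟩ := q
    induction q using QuotientGroup.induction_on with
    | _ w' =>
    rw [← mul_one c, ← smul_eq_mul, ← Finsupp.smul_single]
    simp only [map_smul, Submodule.coe_smul]
    congr 1
    rw [chainsEquiv_single, chainAction_cell, ← chainsEquiv_single]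
    congr 2
    exact Finsupp.mapDomain_single

theorem dualCell_eq (I : Finset (Fin (n + 1))) (w : affineWeylGroup b e) :
    dualCell b e I w = cell b e I w⁻¹ := by
  classical
  rw [dualCell, cell, Finsupp.single_eq_pi_single]

/-- The isomorphism of `⨁ ℤ[(W_a)_I \ W_a]` with the group of finitely supported `k`-cochains. -/
noncomputable def finiteCochainsEquiv (k : ℕ) :
    ((Σ I : {I : Finset (Fin (n + 1)) // I.card + k = n},
      RightCosets (parabolic b e I.1)) →₀ ℤ) ≃ₗ[ℤ] finiteCochains (alcoveSimplices b e) k :=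
  ((Finsupp.domLCongr (Equiv.sigmaCongrRight fun _ =>
    QuotientGroup.quotientRightRelEquivQuotientLeftRel _)).trans (chainsEquiv b e k)).trans
    (chainsEquivFiniteCochains _ k)

theorem finiteCochainsEquiv_single (k : ℕ) (I : {I : Finset (Fin (n + 1)) // I.card + k = n})
    (w : affineWeylGroup b e) :
    (finiteCochainsEquiv b e k (Finsupp.single ⟨I, RightCosets.mk (parabolic b e I.1) w⟩ 1) :
      Finset N → ℤ) = dualCell b e I.1 w := by
  rw [dualCell_eq, ← chainsEquiv_single]
  simp only [finiteCochainsEquiv, LinearEquiv.trans_apply, Finsupp.domLCongr_single]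
  rfl

theorem cochainAction_dualCell (I : Finset (Fin (n + 1))) (w : (affineWeylGroup b e)ᵐᵒᵖ)
    (w' : affineWeylGroup b e) :
    cochainAction b e w (dualCell b e I w') = dualCell b e I (w' * w.unop) := by
  classical
  funext s
  change dualCell b e I w' (move b e w.unop s) = _
  rw [dualCell, dualCell, Pi.single_apply, Pi.single_apply]
  have : move b e w.unop s = move b e w'⁻¹ (faceVertices b e I) ↔
      s = move b e (w' * w.unop)⁻¹ (faceVertices b e I) := by
    rw [mul_inv_rev, move_mul]
    constructor
    · intro h
      rw [← h, ← move_mul, inv_mul_cancel, move_one]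
    · rintro rfl
      rw [← move_mul, mul_inv_cancel, move_one]
  simp only [this]

theorem finiteCochainsEquiv_rightCosetRep (k : ℕ) (w : (affineWeylGroup b e)ᵐᵒᵖ)
    (a : (Σ I : {I : Finset (Fin (n + 1)) // I.card + k = n},
      RightCosets (parabolic b e I.1)) →₀ ℤ) :
    (finiteCochainsEquiv b e k
      (rightCosetRep (fun I : {I : Finset (Fin (n + 1)) // I.card + k = n} =>
        parabolic b e I.1) w a) : Finset N → ℤ) =
      cochainAction b e w (finiteCochainsEquiv b e k a) := by
  induction a using Finsupp.induction_linear with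
  | zero => simp
  | add a a' h h' => simp only [map_add, Submodule.coe_add, h, h']
  | single q c =>
    obtain ⟨I, q⟩ := q
    induction q using Quotient.inductionOn with
    | _ w' =>
    rw [← mul_one c, ← smul_eq_mul, ← Finsupp.smul_single]
    simp only [map_smul, Submodule.coe_smul]
    congr 1
    change _ = cochainAction b e w (finiteCochainsEquiv b e k
      (Finsupp.single ⟨I, RightCosets.mk (parabolic b e I.1) w'⟩ 1) : Finset N → ℤ)
    rw [finiteCochainsEquiv_single, cochainAction_dualCell, ← finiteCochainsEquiv_single]
    congr 2
    exact Finsupp.mapDomain_single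

/-! ### Boundary, coboundary and cup product on cells -/

/-- The vertices `w vⱼ` as an embedding of the set of types. -/
noncomputable def vertexEmbedding (w : affineWeylGroup b e) : Fin (n + 1) ↪ N :=
  ⟨fun j => (w : N ≃ᵃ[ℝ] N) (alcoveVertex b e j), fun _ _ h => eq_of_apply_vertex_eq b e h⟩

theorem move_faceVertices_eq_map (w : affineWeylGroup b e) (I : Finset (Fin (n + 1))) :
    move b e w (faceVertices b e I) = Iᶜ.map (vertexEmbedding b e w) := by
  ext x
  simp only [mem_move, Finset.mem_map, Finset.mem_compl]
  rfl

@[simp] theorem vertexType_vertexEmbedding (w : affineWeylGroup b e) (j : Fin (n + 1)) :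
    vertexType b e (vertexEmbedding b e w j) = j := vertexType_apply b e w j

theorem position_move (w : affineWeylGroup b e) (I : Finset (Fin (n + 1))) (j : Fin (n + 1)) :
    position (vertexType b e) (move b e w (faceVertices b e I)) (vertexEmbedding b e w j) =
      below I j := by
  rw [position, move_faceVertices_eq_map, Finset.filter_map, Finset.card_map, below]
  congr 1
  refine Finset.filter_congr fun i _ => ?_
  simp

open scoped Classical in
theorem erase_move (w : affineWeylGroup b e) (I : Finset (Fin (n + 1))) (j : Fin (n + 1)) :
    (move b e w (faceVertices b e I)).erase (vertexEmbedding b e w j) =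
      move b e w (faceVertices b e (insert j I)) := by
  rw [move_faceVertices_eq_map, move_faceVertices_eq_map, ← Finset.map_erase]
  congr 1
  ext i
  simp

theorem filter_le_move (w : affineWeylGroup b e) (I : Finset (Fin (n + 1))) (j : Fin (n + 1)) :
    ((move b e w (faceVertices b e I)).filter fun y =>
      vertexType b e y ≤ vertexType b e (vertexEmbedding b e w j)) =
      move b e w (faceVertices b e (I ∪ Finset.univ.filter fun i => j < i)) := by
  rw [move_faceVertices_eq_map, move_faceVertices_eq_map, Finset.filter_map]
  congr 1
  ext i
  simp

theorem filter_ge_move (w : affineWeylGroup b e) (I : Finset (Fin (n + 1))) (j : Fin (n + 1)) :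
    ((move b e w (faceVertices b e I)).filter fun y =>
      vertexType b e (vertexEmbedding b e w j) ≤ vertexType b e y) =
      move b e w (faceVertices b e (I ∪ Finset.univ.filter fun i => i < j)) := by
  rw [move_faceVertices_eq_map, move_faceVertices_eq_map, Finset.filter_map]
  congr 1
  ext i
  simp

theorem boundary_cell (I : Finset (Fin (n + 1))) (w : affineWeylGroup b e) (hI : I.card < n) :
    boundary (vertexType b e) (cell b e I w) =
      ∑ j ∈ Iᶜ, (-1 : ℤ) ^ below I j • cell b e (insert j I) w := by
  classical
  rw [cell, boundary_single]
  conv_lhs => rw [Finset.sum_congr (move_faceVertices_eq_map b e w I) fun _ _ => rfl]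
  rw [Finset.sum_map]
  refine Finset.sum_congr rfl fun j hj => ?_
  rw [position_move, if_pos, erase_move]
  · rfl
  · rw [erase_move, ← Finset.card_pos]
    have h1 := card_move b e w (insert j I)
    have h2 := Finset.card_insert_le j I
    omega

theorem boundary_cell_of_card (I : Finset (Fin (n + 1))) (w : affineWeylGroup b e)
    (hI : I.card = n) : boundary (vertexType b e) (cell b e I w) = 0 := by
  classical
  rw [cell, boundary_single]
  refine Finset.sum_eq_zero fun x hx => ?_
  rw [if_neg, smul_zero]
  rw [← Finset.card_pos, Finset.card_erase_of_mem hx]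
  have h1 := card_move b e w I
  omega

open scoped Classical in
theorem dualCell_move (I K : Finset (Fin (n + 1))) (w z : affineWeylGroup b e) :
    dualCell b e I w (move b e z (faceVertices b e K)) =
      if I = K ∧ w * z ∈ parabolic b e I then 1 else 0 := by
  rw [dualCell, Pi.single_apply]
  have : move b e z (faceVertices b e K) = move b e w⁻¹ (faceVertices b e I) ↔
      I = K ∧ w * z ∈ parabolic b e I := by
    rw [eq_comm, move_eq_move_iff, inv_inv]
  simp only [this]

theorem dualCell_of_notMem {I : Finset (Fin (n + 1))} (hI : I ≠ Finset.univ)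
    (w : affineWeylGroup b e) {s : Finset N} (hs : s ∉ alcoveSimplices b e) :
    dualCell b e I w s = 0 := by
  classical
  rw [dualCell, Pi.single_apply, if_neg]
  rintro rfl
  exact hs (move_faceVertices_mem b e _ hI)

theorem dualCell_empty {I : Finset (Fin (n + 1))} (hI : I ≠ Finset.univ)
    (w : affineWeylGroup b e) : dualCell b e I w ∅ = 0 :=
  dualCell_of_notMem b e hI w (isOrderedComplex b e).empty_notMem

theorem below_insert (K : Finset (Fin (n + 1))) (j : Fin (n + 1)) :
    below (insert j K) j = below K j := by
  rw [below, below]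
  congr 1
  ext i
  simp only [Finset.compl_insert, Finset.mem_filter, Finset.mem_erase]
  constructor
  · rintro ⟨⟨-, h1⟩, h2⟩
    exact ⟨h1, h2⟩
  · rintro ⟨h1, h2⟩
    exact ⟨⟨h2.ne, h1⟩, h2⟩

open scoped Classical in
/-- Among the cosets of `(W_a)_{I ∖ {j}}` in `(W_a)_I w`, exactly one corresponds to a given coface
of the cell of `(W_a)_I w`. -/
theorem finsum_dualCell_move {I : Finset (Fin (n + 1))} (hI : I ≠ Finset.univ) (j : Fin (n + 1))
    (w z : affineWeylGroup b e) (K : Finset (Fin (n + 1))) :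
    (∑ᶠ x ∈ (parabolic b e I : Set (affineWeylGroup b e)) ∩ minRight b e (I.erase j),
      dualCell b e (I.erase j) (x * w)) (move b e z (faceVertices b e K)) =
      if I.erase j = K ∧ w * z ∈ parabolic b e I then 1 else 0 := by
  have hfin : ((parabolic b e I : Set (affineWeylGroup b e)) ∩ minRight b e (I.erase j)).Finite :=
    (parabolic_finite b e hI).subset inter_subset_left
  rw [finsum_mem_eq_finite_toFinset_sum _ hfin, Finset.sum_apply]
  have hle := parabolic_mono b e (Finset.erase_subset j I)
  by_cases h : I.erase j = K ∧ w * z ∈ parabolic b e I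
  · rw [if_pos h]
    obtain ⟨u, hu, hux⟩ := exists_mul_mem_minRight b e (I.erase j) (w * z)⁻¹
    rw [Finset.sum_eq_single (u * (w * z)⁻¹)]
    · have hu' : u * (w * z)⁻¹ * w * z ∈ parabolic b e (I.erase j) := by
        rwa [mul_assoc _ w z, inv_mul_cancel_right]
      rw [dualCell_move, if_pos ⟨h.1, hu'⟩]
    · intro x hx hne
      rw [dualCell_move, if_neg]
      rintro ⟨-, hx'⟩
      rw [hfin.mem_toFinset] at hx
      refine hne ?_
      have h1 : x * w * z * u⁻¹ = 1 :=
        eq_one_of_mul_mem_minRight b e (mul_mem hx' (inv_mem hu)) hux (by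
          convert hx.2 using 1
          group)
      rw [mul_inv_eq_one] at h1
      rw [← h1]
      group
    · intro h'
      refine absurd (hfin.mem_toFinset.2 ⟨?_, hux⟩) h'
      exact mul_mem (hle hu) (inv_mem h.2)
  · rw [if_neg h]
    refine Finset.sum_eq_zero fun x hx => ?_
    rw [hfin.mem_toFinset] at hx
    rw [dualCell_move, if_neg]
    rintro ⟨h1, h2⟩
    refine h ⟨h1, ?_⟩
    have := mul_mem (inv_mem hx.1) (hle h2)
    convert this using 1
    group

theorem coboundary_dualCell {I : Finset (Fin (n + 1))} (hI : I ≠ Finset.univ)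
    (w : affineWeylGroup b e) :
    coboundary (alcoveSimplices b e) (vertexType b e) (dualCell b e I w) =
      ∑ j ∈ I, (-1 : ℤ) ^ below I j •
        ∑ᶠ x ∈ (parabolic b e I : Set (affineWeylGroup b e)) ∩ minRight b e (I.erase j),
          dualCell b e (I.erase j) (x * w) := by
  classical
  funext s
  rw [Finset.sum_apply]
  by_cases hs : s ∈ alcoveSimplices b e
  swap
  · rw [coboundary_apply_of_notMem hs]
    symm
    refine Finset.sum_eq_zero fun j hj => ?_
    have hfin : ((parabolic b e I : Set (affineWeylGroup b e)) ∩
        minRight b e (I.erase j)).Finite := (parabolic_finite b e hI).subset inter_subset_left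
    rw [Pi.smul_apply, finsum_mem_eq_finite_toFinset_sum _ hfin, Finset.sum_apply,
      Finset.sum_eq_zero, smul_zero]
    intro x _
    refine dualCell_of_notMem b e (fun h => ?_) _ hs
    exact Finset.notMem_erase j I (h ▸ Finset.mem_univ j)
  rw [coboundary_apply hs (dualCell_empty b e hI w)]
  obtain ⟨z, K, hK, rfl⟩ := hs
  conv_lhs => rw [Finset.sum_congr (move_faceVertices_eq_map b e z K) fun _ _ => rfl]
  rw [Finset.sum_map]
  simp only [position_move, erase_move, dualCell_move, Pi.smul_apply, finsum_dualCell_move b e hI,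
    smul_eq_mul]
  have hsum : ∀ (A : Finset (Fin (n + 1))) (f : Fin (n + 1) → ℤ),
      ∑ j ∈ A, f j = ∑ j, if j ∈ A then f j else 0 := fun A f => by
    rw [Finset.sum_ite_mem, Finset.univ_inter]
  rw [hsum Kᶜ, hsum I]
  refine Finset.sum_congr rfl fun j _ => ?_
  have hiff : (j ∈ Kᶜ ∧ I = insert j K) ↔ (j ∈ I ∧ I.erase j = K) := by
    rw [Finset.mem_compl]
    constructor
    · rintro ⟨h, rfl⟩
      exact ⟨Finset.mem_insert_self j K, Finset.erase_insert h⟩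
    · rintro ⟨h, rfl⟩
      exact ⟨Finset.notMem_erase j I, (Finset.insert_erase h).symm⟩
  by_cases h : j ∈ Kᶜ ∧ I = insert j K
  · have h' := hiff.1 h
    rw [if_pos h.1, if_pos h'.1]
    simp only [h.2 ▸ below_insert K j, ← h.2, h'.2, true_and]
  · have h' := mt hiff.2 h
    have h1 : (if j ∈ Kᶜ then (-1 : ℤ) ^ below K j *
        (if I = insert j K ∧ w * z ∈ parabolic b e I then 1 else 0) else 0) = 0 := by
      split_ifs with h1 h2
      · exact absurd ⟨h1, h2.1⟩ h
      · simp
      · rfl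
    have h2 : (if j ∈ I then (-1 : ℤ) ^ below I j *
        (if I.erase j = K ∧ w * z ∈ parabolic b e I then 1 else 0) else 0) = 0 := by
      split_ifs with h1 h2
      · exact absurd ⟨h1, h2.1⟩ h'
      · simp
      · rfl
    rw [h1, h2]

open scoped Pointwise Classical in
/-- At the simplex `z f_K` only the cut at a vertex of type `max Iᶜ = min Jᶜ` can contribute, and it
does if and only if `z⁻¹` lies in `(W_a)_I x ∩ (W_a)_J y`, which is the coset
`(W_a)_{I ∩ J} v y` for `x y⁻¹ = u v`. -/
theorem cup_dualCell (I J : Finset (Fin (n + 1))) (hI : Iᶜ.Nonempty) (hJ : Jᶜ.Nonempty)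
    (x y : affineWeylGroup b e) :
    cup (alcoveSimplices b e) (vertexType b e) (dualCell b e I x) (dualCell b e J y) =
      if Iᶜ.max' hI = Jᶜ.min' hJ ∧
          x * y⁻¹ ∈ (parabolic b e I : Set (affineWeylGroup b e)) * (parabolic b e J : Set _)
      then dualCell b e (I ∩ J) (parabolicFactor b e I J (x * y⁻¹) * y) else 0 := by
  have hIJ : I ∩ J ≠ Finset.univ := by
    obtain ⟨i, hi⟩ := hI
    rw [Finset.mem_compl] at hi
    exact fun h => hi (Finset.mem_of_mem_inter_left (h ▸ Finset.mem_univ i))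
  have hmaxI := Finset.mem_compl.1 (Iᶜ.max'_mem hI)
  have hminJ := Finset.mem_compl.1 (Jᶜ.min'_mem hJ)
  have hle : ∀ i ∉ I, i ≤ Iᶜ.max' hI := fun i hi => Iᶜ.le_max' i (Finset.mem_compl.2 hi)
  have hge : ∀ i ∉ J, Jᶜ.min' hJ ≤ i := fun i hi => Jᶜ.min'_le i (Finset.mem_compl.2 hi)
  generalize Iᶜ.max' hI = m at hmaxI hle ⊢
  generalize Jᶜ.min' hJ = m' at hminJ hge ⊢
  funext s
  by_cases hs : s ∈ alcoveSimplices b e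
  swap
  · rw [cup_apply_of_notMem hs]
    split_ifs
    · rw [dualCell_of_notMem b e hIJ _ hs]
    · rfl
  rw [cup_apply hs]
  obtain ⟨z, K, hK, rfl⟩ := hs
  conv_lhs => rw [Finset.sum_congr (move_faceVertices_eq_map b e z K) fun _ _ => rfl]
  rw [Finset.sum_map]
  simp only [filter_le_move, filter_ge_move, dualCell_move]
  -- A nonzero summand forces the cut vertex to have type `max Iᶜ = min Jᶜ`.
  have key : ∀ j ∈ Kᶜ, (I = K ∪ Finset.univ.filter fun i => j < i) →
      (J = K ∪ Finset.univ.filter fun i => i < j) → x * z ∈ parabolic b e I →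
      y * z ∈ parabolic b e J → j = m ∧ m = m' ∧ I ∩ J = K ∧
      x * y⁻¹ ∈ (parabolic b e I : Set (affineWeylGroup b e)) * (parabolic b e J : Set _) := by
    intro j hj h1 h2 h3 h4
    have hjK := Finset.mem_compl.1 hj
    have hI' : ∀ i, i ∈ I ↔ i ∈ K ∨ j < i := fun i => by rw [h1]; simp
    have hJ' : ∀ i, i ∈ J ↔ i ∈ K ∨ i < j := fun i => by rw [h2]; simp
    have hjI : j ∉ I := fun h => ((hI' j).1 h).elim hjK (lt_irrefl j)
    have hjJ : j ∉ J := fun h => ((hJ' j).1 h).elim hjK (lt_irrefl j)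
    have hm : j = m := le_antisymm (hle j hjI) (not_lt.1 fun h => hmaxI ((hI' m).2 (Or.inr h)))
    have hm' : j = m' := le_antisymm (not_lt.1 fun h => hminJ ((hJ' m').2 (Or.inr h))) (hge j hjJ)
    refine ⟨hm, hm ▸ hm', ?_, ?_⟩
    · ext i
      rw [Finset.mem_inter, hI', hJ']
      constructor
      · rintro ⟨h | h, h' | h'⟩
        · exact h
        · exact h
        · exact h'
        · exact absurd h h'.not_gt
      · exact fun h => ⟨Or.inl h, Or.inl h⟩
    · exact ⟨x * z, h3, (y * z)⁻¹, inv_mem h4, by group⟩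
  by_cases hc : m = m' ∧
      x * y⁻¹ ∈ (parabolic b e I : Set (affineWeylGroup b e)) * (parabolic b e J : Set _)
  swap
  · rw [if_neg hc]
    refine Finset.sum_eq_zero fun j hj => ?_
    by_contra h
    have h1 := left_ne_zero_of_mul h
    have h2 := right_ne_zero_of_mul h
    simp only [ne_eq, ite_eq_right_iff, one_ne_zero, imp_false, not_not] at h1 h2
    obtain ⟨-, h3, -, h4⟩ := key j hj h1.1 h2.1 h1.2 h2.2
    exact hc ⟨h3, h4⟩
  rw [if_pos hc, dualCell_move]
  obtain ⟨rfl, hmem⟩ := hc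
  -- The factorisation `x y⁻¹ = u v`.
  obtain ⟨hv, u, hu, -, huv, -⟩ : IsParabolicFactor b e I J (x * y⁻¹)
      (parabolicFactor b e I J (x * y⁻¹)) :=
    Classical.epsilon_spec (existsUnique_parabolicFactor b e I J _ hmem).exists
  set v := parabolicFactor b e I J (x * y⁻¹)
  have hx : x * z = u * (v * y * z) := by
    rw [mul_inv_eq_iff_eq_mul] at huv
    rw [huv]; group
  have hy : y * z = v⁻¹ * (v * y * z) := by group
  rw [Finset.sum_eq_single m]
  · by_cases h : I ∩ J = K ∧ v * y * z ∈ parabolic b e (I ∩ J)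
    · rw [if_pos h, if_pos, if_pos, mul_one]
      · refine ⟨?_, ?_⟩
        · ext i
          rw [← h.1]
          simp only [Finset.mem_union, Finset.mem_inter, Finset.mem_filter, Finset.mem_univ,
            true_and]
          constructor
          · intro hi
            by_cases hi' : i ∈ I
            · exact Or.inl ⟨hi', hi⟩
            · exact Or.inr (lt_of_le_of_ne (hle i hi') fun h => hminJ (h ▸ hi))
          · rintro (hi | hi)
            · exact hi.2
            · exact by_contra fun h => (hge i h).not_gt hi
        · rw [hy]
          exact mul_mem (inv_mem hv) (parabolic_mono b e Finset.inter_subset_right h.2)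
      · refine ⟨?_, ?_⟩
        · ext i
          rw [← h.1]
          simp only [Finset.mem_union, Finset.mem_inter, Finset.mem_filter, Finset.mem_univ,
            true_and]
          constructor
          · intro hi
            by_cases hi' : i ∈ J
            · exact Or.inl ⟨hi, hi'⟩
            · exact Or.inr (lt_of_le_of_ne (hge i hi') fun h => hmaxI (h ▸ hi))
          · rintro (hi | hi)
            · exact hi.1
            · exact by_contra fun h => (hle i h).not_gt hi
        · rw [hx]
          exact mul_mem hu (parabolic_mono b e Finset.inter_subset_left h.2)
    · rw [if_neg h]
      by_contra h0
      have h1 := left_ne_zero_of_mul h0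
      have h2 := right_ne_zero_of_mul h0
      simp only [ne_eq, ite_eq_right_iff, one_ne_zero, imp_false, not_not] at h1 h2
      have hmK : m ∈ Kᶜ := by
        rw [Finset.mem_compl]
        intro hm
        exact hmaxI (by rw [h1.1]; exact Finset.mem_union_left _ hm)
      obtain ⟨-, -, h3, -⟩ := key m hmK h1.1 h2.1 h1.2 h2.2
      refine h ⟨h3, mem_parabolic_inter b e ?_ ?_⟩
      · have := mul_mem (inv_mem hu) h1.2
        rwa [hx, inv_mul_cancel_left] at this
      · rw [mul_assoc]
        exact mul_mem hv h2.2
  · intro j hj hne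
    by_contra h
    have h1 := left_ne_zero_of_mul h
    have h2 := right_ne_zero_of_mul h
    simp only [ne_eq, ite_eq_right_iff, one_ne_zero, imp_false, not_not] at h1 h2
    exact hne (key j hj h1.1 h2.1 h1.2 h2.2).1
  · intro hm
    rw [Finset.mem_compl, not_not] at hm
    rw [if_neg, zero_mul]
    rintro ⟨h1, -⟩
    exact hmaxI (by rw [h1]; exact Finset.mem_union_left _ hm)

end

end AffineWeyl

/-! ### The alcove triangulation with its chains and cochains -/

open AffineWeyl SimplicialCochains in
open scoped Pointwise Classical in
theorem mainTheorem2 {ι M N : Type*} [Finite ι] [AddCommGroup M] [Module ℝ M]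
    [AddCommGroup N] [Module ℝ N] [TopologicalSpace N] [IsTopologicalAddGroup N]
    [ContinuousSMul ℝ N] [T2Space N]
    (P : RootPairing ι ℝ M N) [P.IsRootSystem] [P.IsCrystallographic] [P.IsReduced]
    [P.IsIrreducible] (b : P.Base) {n : ℕ} (e : Fin n ≃ b.support) :
    -- The faces of the closed fundamental alcove are the simplices with vertices `vᵢ`, `i ∉ I`, and
    -- their translates form a locally finite triangulation of `V*`.
    (∀ I : Finset (Fin (n + 1)), convexHull ℝ (faceVertices b e I : Set N) =
      closure (fundamentalAlcove b) ∩ ⋂ i ∈ I, wall b e i) ∧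
    (∃ K : Geometry.SimplicialComplex ℝ N, K.faces = alcoveSimplices b e ∧ K.space = Set.univ ∧
      LocallyFinite fun s : alcoveSimplices b e => convexHull ℝ ((s : Finset N) : Set N)) ∧
    -- The triangulation is `W_a`-equivariant, cells stabilised by `w` being fixed pointwise, and
    -- `W_a` preserves the well-defined types of the vertices, hence the orientations.
    (∀ w : affineWeylGroup b e, ∀ s ∈ alcoveSimplices b e, move b e w s ∈ alcoveSimplices b e ∧
      (move b e w s = s → ∀ x ∈ convexHull ℝ (s : Set N), (w : N ≃ᵃ[ℝ] N) x = x)) ∧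
    (∀ (w : affineWeylGroup b e) (i : Fin (n + 1)),
      vertexType b e ((w : N ≃ᵃ[ℝ] N) (alcoveVertex b e i)) = i) ∧
    -- Minimal length coset representatives.
    (∀ I : Finset (Fin (n + 1)),
      Function.Bijective (fun w : minLeft b e I =>
        ((w : affineWeylGroup b e) : affineWeylGroup b e ⧸ parabolic b e I)) ∧
      Function.Bijective (fun w : minRight b e I => RightCosets.mk (parabolic b e I) w)) ∧
    -- The cellular chain complex of left `ℤ[W_a]`-modules, its components and its boundaries.
    (∀ k, ∀ c ∈ chains (alcoveSimplices b e) (k + 1),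
      boundary (vertexType b e) c ∈ chains (alcoveSimplices b e) k ∧
      boundary (vertexType b e) (boundary (vertexType b e) c) = 0) ∧
    (∀ k, ∀ c ∈ chains (alcoveSimplices b e) k, ∀ w,
      chainAction b e w c ∈ chains (alcoveSimplices b e) k ∧
      boundary (vertexType b e) (chainAction b e w c) =
        chainAction b e w (boundary (vertexType b e) c)) ∧
    (∀ k : ℕ, ∃ Ψ : ((Σ I : {I : Finset (Fin (n + 1)) // I.card + k = n},
          affineWeylGroup b e ⧸ parabolic b e I.1) →₀ ℤ) ≃ₗ[ℤ] chains (alcoveSimplices b e) k,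
      (∀ I (w : affineWeylGroup b e),
        (Ψ (Finsupp.single ⟨I, (w : affineWeylGroup b e ⧸ parabolic b e I.1)⟩ 1) :
          Finset N →₀ ℤ) = cell b e I.1 w) ∧
      ∀ w a, (Ψ (leftCosetRep (fun I : {I : Finset (Fin (n + 1)) // I.card + k = n} =>
          parabolic b e I.1) w a) : Finset N →₀ ℤ) = chainAction b e w (Ψ a)) ∧
    (∀ I : Finset (Fin (n + 1)), ∀ w : affineWeylGroup b e,
      (I.card < n → boundary (vertexType b e) (cell b e I w) =
        ∑ j ∈ Iᶜ, (-1 : ℤ) ^ below I j • cell b e (insert j I) w) ∧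
      (I.card = n → boundary (vertexType b e) (cell b e I w) = 0)) ∧
    -- The cochains form a unital dg-algebra; the finitely supported cochains form a dg-algebra.
    IsDGAlgebra (cochainAction b e) (cochains (alcoveSimplices b e))
      (coboundary (alcoveSimplices b e) (vertexType b e))
      (cup (alcoveSimplices b e) (vertexType b e)) ∧
    (∃ u ∈ cochains (alcoveSimplices b e) 0, (∀ w, cochainAction b e w u = u) ∧
      coboundary (alcoveSimplices b e) (vertexType b e) u = 0 ∧
      ∀ k, ∀ a ∈ cochains (alcoveSimplices b e) k,
        cup (alcoveSimplices b e) (vertexType b e) u a = a ∧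
        cup (alcoveSimplices b e) (vertexType b e) a u = a) ∧
    IsDGAlgebra (cochainAction b e) (finiteCochains (alcoveSimplices b e))
      (coboundary (alcoveSimplices b e) (vertexType b e))
      (cup (alcoveSimplices b e) (vertexType b e)) ∧
    -- The components of the finitely supported cochain complex.
    (∀ k : ℕ, ∃ Φ : ((Σ I : {I : Finset (Fin (n + 1)) // I.card + k = n},
          RightCosets (parabolic b e I.1)) →₀ ℤ) ≃ₗ[ℤ] finiteCochains (alcoveSimplices b e) k,
      (∀ I (w : affineWeylGroup b e),
        (Φ (Finsupp.single ⟨I, RightCosets.mk (parabolic b e I.1) w⟩ 1) : Finset N → ℤ) =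
          dualCell b e I.1 w) ∧
      ∀ w a, (Φ (rightCosetRep (fun I : {I : Finset (Fin (n + 1)) // I.card + k = n} =>
          parabolic b e I.1) w a) : Finset N → ℤ) = cochainAction b e w (Φ a)) ∧
    -- The differentials, as sums over minimal length coset representatives.
    (∀ I J : Finset (Fin (n + 1)), J ⊆ I → ∀ x ∈ parabolic b e I, x ∈ minRight b e J →
      ∀ w ∈ minRight b e I, x * w ∈ minRight b e J) ∧
    (∀ I : Finset (Fin (n + 1)), I ≠ Finset.univ →
      (parabolic b e I : Set (affineWeylGroup b e)).Finite ∧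
      ∀ w, coboundary (alcoveSimplices b e) (vertexType b e) (dualCell b e I w) =
        ∑ j ∈ I, (-1 : ℤ) ^ below I j •
          ∑ᶠ x ∈ (parabolic b e I : Set (affineWeylGroup b e)) ∩ minRight b e (I.erase j),
            dualCell b e (I.erase j) (x * w)) ∧
    -- The cup product.
    (∀ (I J : Finset (Fin (n + 1))) (w : affineWeylGroup b e),
      w ∈ (parabolic b e I : Set (affineWeylGroup b e)) * (parabolic b e J : Set _) →
        ∃! v, IsParabolicFactor b e I J w v) ∧
    (∀ (I J : Finset (Fin (n + 1))) (hI : Iᶜ.Nonempty) (hJ : Jᶜ.Nonempty)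
      (x y : affineWeylGroup b e),
      cup (alcoveSimplices b e) (vertexType b e) (dualCell b e I x) (dualCell b e J y) =
        if Iᶜ.max' hI = Jᶜ.min' hJ ∧
            x * y⁻¹ ∈ (parabolic b e I : Set (affineWeylGroup b e)) * (parabolic b e J : Set _)
        then dualCell b e (I ∩ J) (parabolicFactor b e I J (x * y⁻¹) * y) else 0) := by
  refine ⟨convexHull_faceVertices_eq b e,
    ⟨alcoveComplex b e, rfl, space_alcoveComplex b e, locallyFinite_alcoveSimplices b e⟩,
    fun w s hs => ⟨move_mem b e w hs, fun h x hx => move_eq_self b e hs h hx⟩,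
    vertexType_apply b e,
    fun I => ⟨minLeft_bijective b e I, minRight_bijective b e I⟩,
    fun k c hc => ⟨(isOrderedComplex b e).boundary_mem hc,
      (isOrderedComplex b e).boundary_boundary hc⟩,
    fun k c hc w => ⟨chainAction_mem b e w hc, (isSymmetry b e w).boundary_map hc⟩,
    fun k => ⟨chainsEquiv b e k, chainsEquiv_single b e k, chainsEquiv_leftCosetRep b e k⟩,
    fun I w => ⟨boundary_cell b e I w, boundary_cell_of_card b e I w⟩,
    (isOrderedComplex b e).isDGAlgebra _ _ (fun w => isSymmetry b e w.unop) fun _ _ => rfl,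
    ⟨unitCochain _, unitCochain_mem _, fun w => funext (isSymmetry b e w.unop).unitCochain_map,
      (isOrderedComplex b e).coboundary_unitCochain,
      fun k a ha => ⟨(isOrderedComplex b e).unitCochain_cup ha,
        (isOrderedComplex b e).cup_unitCochain ha⟩⟩,
    (isOrderedComplex b e).isDGAlgebra_finite (finite_star b e) _ _
      (fun w => isSymmetry b e w.unop) fun _ _ => rfl,
    fun k => ⟨finiteCochainsEquiv b e k, finiteCochainsEquiv_single b e k,
      finiteCochainsEquiv_rightCosetRep b e k⟩,
    fun I J hJ x hx hx' w hw => mul_mem_minRight b e hJ hx hx' hw,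
    fun I hI => ⟨parabolic_finite b e hI, coboundary_dualCell b e hI⟩,
    existsUnique_parabolicFactor b e, cup_dualCell b e⟩
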